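/- Let $H\ge 0$ be a self-adjoint operator (the Hamiltonian) on a complex Hilbert space $\mathcal H$, with spectral projections $P(E)$ for $[0,E]$ and $U(t)=e^{iHt}$. Notation. $\Sigma$ is the space of ultraweakly continuous linear functionals on $\mathcal B(\mathcal H)$. For $\ell>0$ put $\|\sigma\|_\ell=\|\sigma((1+H)^\ell\,\cdot\,(1+H)^\ell)\|$ and $\Sigma_\ell=\{\sigma\in\Sigma:\|\sigma\|_\ell<\infty\}$. Let $\|\phi\|_{-\ell}$ be the dual norm on $\Sigma_\ell^*$, let $C^\infty(\Sigma)=\bigcap_{\ell>0}\Sigma_\ell$, with dual $C^\infty(\Sigma)^*=\bigcup_{\ell>0}\Sigma_\ell^*$, and let $\Sigma(E)=\{\sigma(P(E)\,\cdot\,P(E)):\sigma\in\Sigma\}$. $\mathcal K^\ell$ is the space of analytic functions $F$ on the open lower half plane with $\|F\|_{-\ell}:=\sup_{-1\le\operatorname{Im}z<0}|F(z)|\,|\operatorname{Im}z|^\ell<\infty$; $F(x-i0)$ denotes its distributional boundary value. For $f\in\mathcal D(-d,d)$, $m\in\mathbb N_0$, put $\|f\|_{d,m}=\max_{0\le n\le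 m}d^n\|f^{(n)}\|_1$. A $C^\infty(\Sigma)^*$-valued distribution is a linear map $T:\mathcal D(\mathbb R)\to C^\infty(\Sigma)^*$ for which there are $k>0$ and $m\in\mathbb N_0$ and, for each $d>0$, a constant $c_d$, with $\|T(f)\|_{-k}\le c_d\|f\|_{d,m}$ for all $f\in\mathcal D(-d,d)$; $\|T\|_{-k;d,m}$ is the operator norm of $T$ on $\mathcal D(-d,d)$ from $\|\cdot\|_{d,m}$ to $\|\cdot\|_{-k}$. Statement. Let $\ell>0$ be real. Every $\sigma\in\bigcup_{E>0}\Sigma(E)$ lies in $C^\infty(\Sigma)$, and for $\phi,\phi'\in\Sigma_\ell^*$ the function $$F_{\sigma,\phi,\phi'}(z)=\sigma\big(\phi(z/2)\,\phi'(-z/2)\big):=\sigma\big(e^{izH/2}\,\phi\,e^{-izH}\,\phi'\,e^{izH/2}\big),\qquad \operatorname{Im}z<0,$$ belongs to $\mathcal K^q$ for some $q>0$. To each $\Pi=\sum_j K_j\otimes\phi_j\otimes\phi_j'$ (a finite sum) in $\mathcal K^\ell\otimes\Sigma_\ell^*\otimes\Sigma_\ell^*$ there exists a unique $C^\infty(\Sigma)^*$-valued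 distribution $O_\Pi$ such that for all $\sigma\in\bigcup_{E>0}\Sigma(E)$ and $f\in\mathcal D(\mathbb R)$ $$\sigma(O_\Pi(f))=\sum_j\int ds'\,f(s')\,K_j(s'-i0)\,\sigma\big(\phi_j(s'/2-i0)\,\phi_j'(-s'/2+i0)\big),$$ where the product of the two boundary distributions is the boundary value of $K_j\cdot F_{\sigma,\phi_j,\phi_j'}$, i.e. the $j$-th integral is $\lim_{y\to0+}\int f(s')\,(K_jF_{\sigma,\phi_j,\phi_j'})(s'-iy)\,ds'$, and this limit exists. The map $\Pi\mapsto O_\Pi$ is well defined and linear. Further, for every integer $m\ge 3\ell+2$ (in particular for $m=3\ell+2$ if this is an integer) there is a constant $c>0$ such that for all $0<d\le1$ and all such finite sums $\Pi=\sum_jK_j\otimes\phi_j\otimes\phi_j'$, $$\|O_\Pi\|_{-5\ell-1;\,d,m}\le c\,d^{-m}\sum_j\|K_j\|_{-\ell}\,\|\phi_j\|_{-\ell}\,\|\phi_j'\|_{-\ell}.$$ -/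

import Mathlib

open Complex Set Filter Topology MeasureTheory
open scoped ENNReal TensorProduct Distributions InnerProductSpace

/-- A Hamiltonian on a Hilbert space: a (generally unbounded) self-adjoint operator `H ≥ 0`,
the generator of the time translations `U(t) = exp(i t H)`. -/
structure Hamiltonian (V : Type*) [NormedAddCommGroup V] [InnerProductSpace ℂ V]
    [CompleteSpace V] where
  /-- the operator, with its domain -/
  op : V →ₗ.[ℂ] V
  selfAdjoint : IsSelfAdjoint op
  nonneg : ∀ x : op.domain, 0 ≤ (inner ℂ (x : V) (op x)).re

namespace Hamiltonian

section

variable {V : Type*} [NormedAddCommGroup V] [InnerProductSpace ℂ V] [CompleteSpace V]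

/-! ### The resolvent and functions of the Hamiltonian -/

theorem norm_le (H : Hamiltonian V) (x : H.op.domain) :
    ‖(x : V)‖ ≤ ‖(x : V) + H.op x‖ := by
  by_cases hx : ‖(x : V)‖ = 0
  · rw [hx]; exact norm_nonneg _
  have h1 : ‖(x : V)‖ ^ 2 ≤ (inner ℂ (x : V) ((x : V) + H.op x)).re := by
    rw [inner_add_right, Complex.add_re]
    have h := H.nonneg x
    have h2 : (inner ℂ (x : V) (x : V)).re = ‖(x : V)‖ ^ 2 := by
      rw [inner_self_eq_norm_sq_to_K]
      norm_cast
    linarith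
  have h3 : (inner ℂ (x : V) ((x : V) + H.op x)).re ≤ ‖(x : V)‖ * ‖(x : V) + H.op x‖ :=
    (Complex.re_le_norm _).trans (norm_inner_le_norm _ _)
  have hpos : 0 < ‖(x : V)‖ := lt_of_le_of_ne (norm_nonneg _) (Ne.symm hx)
  nlinarith

/-- The operator `1 + H` as a linear map on the domain of `H`. -/
def onePlus (H : Hamiltonian V) : H.op.domain →ₗ[ℂ] V :=
  H.op.domain.subtype + H.op.toFun

theorem onePlus_apply (H : Hamiltonian V) (x : H.op.domain) :
    H.onePlus x = (x : V) + H.op x := rfl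

theorem onePlus_injective (H : Hamiltonian V) : Function.Injective H.onePlus := by
  rw [← LinearMap.ker_eq_bot, LinearMap.ker_eq_bot']
  intro x hx
  have h := H.norm_le x
  rw [← onePlus_apply, hx, norm_zero] at h
  exact Subtype.ext (norm_le_zero_iff.1 h)

theorem isClosed_range_onePlus (H : Hamiltonian V) :
    IsClosed (LinearMap.range H.onePlus : Set V) := by
  have hcl : IsClosed (H.op.graph : Set (V × V)) := H.selfAdjoint.isClosed
  refine isClosed_of_closure_subset fun z hz => ?_
  obtain ⟨u, hu, hlim⟩ := mem_closure_iff_seq_limit.1 hz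
  choose y hy using hu
  have hcau : CauchySeq (fun n => ((y n : H.op.domain) : V)) := by
    have hcu : CauchySeq u := hlim.cauchySeq
    rw [Metric.cauchySeq_iff] at hcu ⊢
    intro ε hε
    obtain ⟨N, hN⟩ := hcu ε hε
    refine ⟨N, fun m hm n hn => lt_of_le_of_lt ?_ (hN m hm n hn)⟩
    rw [dist_eq_norm, dist_eq_norm, ← hy m, ← hy n, ← map_sub]
    exact H.norm_le (y m - y n)
  obtain ⟨w, hw⟩ := cauchySeq_tendsto_of_complete hcau
  have hop : Tendsto (fun n => H.op (y n)) atTop (𝓝 (z - w)) := by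
    have h := hlim.sub hw
    refine h.congr fun n => ?_
    rw [← hy n, onePlus_apply, add_sub_cancel_left]
  have hmem : (w, z - w) ∈ (H.op.graph : Set (V × V)) :=
    hcl.mem_of_tendsto (hw.prodMk_nhds hop)
      (Eventually.of_forall fun n => LinearPMap.mem_graph H.op (y n))
  obtain ⟨x, hx1, hx2⟩ := (LinearPMap.mem_graph_iff H.op).1 hmem
  refine ⟨x, ?_⟩
  rw [onePlus_apply, hx1, hx2]
  simp

theorem onePlus_surjective (H : Hamiltonian V) : Function.Surjective H.onePlus := by
  have hdense := H.selfAdjoint.dense_domain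
  have hadj : H.op.adjoint = H.op := H.selfAdjoint
  have : CompleteSpace (LinearMap.range H.onePlus) :=
    H.isClosed_range_onePlus.completeSpace_coe
  rw [← LinearMap.range_eq_top, ← Submodule.orthogonal_eq_bot_iff, Submodule.eq_bot_iff]
  intro z hz
  have hz' : ∀ x : H.op.domain, inner ℂ (-z) (x : V) = inner ℂ z (H.op x) := by
    intro x
    have h := Submodule.inner_left_of_mem_orthogonal (LinearMap.mem_range_self H.onePlus x) hz
    rw [onePlus_apply, inner_add_right] at h
    rw [inner_neg_left]
    linear_combination (-1 : ℂ) * h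
  have hdom : z ∈ H.op.adjoint.domain :=
    LinearPMap.mem_adjoint_domain_of_exists z ⟨-z, hz'⟩
  have hval : H.op.adjoint ⟨z, hdom⟩ = -z := LinearPMap.adjoint_apply_eq hdense _ hz'
  have hgr : (z, -z) ∈ H.op.graph := by
    rw [← hadj, ← hval]
    exact LinearPMap.mem_graph H.op.adjoint ⟨z, hdom⟩
  obtain ⟨x, hx1, hx2⟩ := (LinearPMap.mem_graph_iff H.op).1 hgr
  have h := H.norm_le x
  rw [hx1, hx2] at h
  simpa using h

/-- The bounded operator `R = (1 + H)⁻¹`. -/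
noncomputable def resolvent (H : Hamiltonian V) : V →L[ℂ] V :=
  LinearMap.mkContinuous
    (H.op.domain.subtype ∘ₗ
      (LinearEquiv.ofBijective H.onePlus
        ⟨H.onePlus_injective, H.onePlus_surjective⟩).symm.toLinearMap) 1
    (fun x => by
      rw [one_mul]
      have h := H.norm_le ((LinearEquiv.ofBijective H.onePlus
        ⟨H.onePlus_injective, H.onePlus_surjective⟩).symm x)
      have h2 := (LinearEquiv.ofBijective H.onePlus
        ⟨H.onePlus_injective, H.onePlus_surjective⟩).apply_symm_apply x
      have h3 := congrArg norm h2
      exact h.trans h3.le)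

theorem resolvent_onePlus (H : Hamiltonian V) (x : H.op.domain) :
    H.resolvent (H.onePlus x) = x := by
  have h := (LinearEquiv.ofBijective H.onePlus
    ⟨H.onePlus_injective, H.onePlus_surjective⟩).symm_apply_apply x
  exact congrArg Subtype.val h

theorem resolvent_nonneg (H : Hamiltonian V) : 0 ≤ H.resolvent := by
  rw [ContinuousLinearMap.nonneg_iff_isPositive,
    ContinuousLinearMap.isPositive_iff_complex]
  intro z
  obtain ⟨x, rfl⟩ := H.onePlus_surjective z
  have hdense := H.selfAdjoint.dense_domain
  have hadj : H.op.adjoint = H.op := H.selfAdjoint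
  have hsymm : inner ℂ (H.op x) (x : V) = inner ℂ (x : V) (H.op x) := by
    have h := LinearPMap.adjoint_isFormalAdjoint (T := H.op) hdense
    rw [hadj] at h
    exact h x x
  have hreal : ((inner ℂ (H.op x) (x : V)).re : ℂ) = inner ℂ (H.op x) (x : V) := by
    rw [← Complex.conj_eq_iff_re, inner_conj_symm, hsymm]
  have hself : ((inner ℂ (x : V) (x : V)).re : ℂ) = inner ℂ (x : V) (x : V) := by
    rw [← Complex.conj_eq_iff_re, inner_conj_symm]
  have hn : 0 ≤ (inner ℂ (x : V) (x : V)).re := inner_self_nonneg (𝕜 := ℂ)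
  have hn2 : 0 ≤ (inner ℂ (H.op x) (x : V)).re := by rw [hsymm]; exact H.nonneg x
  rw [resolvent_onePlus, onePlus_apply, inner_add_right, ← hsymm]
  refine ⟨?_, ?_⟩
  · change (((_ + _ : ℂ).re : ℝ) : ℂ) = _
    rw [Complex.add_re, Complex.ofReal_add, hreal, hself]
  · change 0 ≤ (_ + _ : ℂ).re
    rw [Complex.add_re]
    exact add_nonneg hn hn2

theorem norm_resolvent_le (H : Hamiltonian V) : ‖H.resolvent‖ ≤ 1 :=
  LinearMap.mkContinuous_norm_le _ zero_le_one _

/-- The bounded operator `f(H)` for a continuous `f : [0,∞) → ℂ` that vanishes at infinity: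
`f(H) = g(R)` with `R = (1 + H)⁻¹`, `g(x) = f(1/x - 1)` for `x > 0` and `g(0) = 0`. -/
noncomputable def apply (H : Hamiltonian V) (f : ℝ → ℂ) : V →L[ℂ] V :=
  cfc (fun x : ℂ => if x = 0 then 0 else f (x.re⁻¹ - 1)) H.resolvent

/-- `(1 + H)^(-ℓ)` for `ℓ > 0`. -/
noncomputable def powNeg (H : Hamiltonian V) (ℓ : ℝ) : V →L[ℂ] V :=
  H.apply fun t => (((1 + t) ^ (-ℓ) : ℝ) : ℂ)

/-- The spectral projection `P(E)` of `H` for the interval `[0,E]`: the orthogonal projection onto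
the kernel of `f(H)`, where `f(t) = max(0, t - E) / (1 + t)²` vanishes on `[0,E]` only. -/
noncomputable def specProj (H : Hamiltonian V) (E : ℝ) : V →L[ℂ] V :=
  (H.apply fun t => ((max 0 (t - E) / (1 + t) ^ 2 : ℝ) : ℂ)).ker.starProjection

/-- `exp(-i z H / 2)` for `Im z < 0`. -/
noncomputable def expDecay (H : Hamiltonian V) (z : ℂ) : V →L[ℂ] V :=
  H.apply fun t => Complex.exp (-(I * z * t / 2))

/-- `exp(i z H / 2) P(E)`, for arbitrary complex `z`. The cut-off factor makes the function
compactly supported; it is `1` on `[0,E]`, so it does not change the product with `P(E)`. -/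
noncomputable def expLow (H : Hamiltonian V) (E : ℝ) (z : ℂ) : V →L[ℂ] V :=
  H.apply (fun t => Complex.exp (I * z * t / 2) * ((max 0 (1 - max 0 (t - E)) : ℝ) : ℂ)) *
    H.specProj E

open ComplexOrder in
theorem spectrum_resolvent (H : Hamiltonian V) {x : ℂ} (hx : x ∈ spectrum ℂ H.resolvent) :
    x = (x.re : ℂ) ∧ 0 ≤ x.re ∧ x.re ≤ 1 := by
  have h0 : 0 ≤ x := spectrum_nonneg_of_nonneg H.resolvent_nonneg hx
  rw [Complex.nonneg_iff] at h0
  refine ⟨Complex.ext rfl (by simp [← h0.2]), h0.1, ?_⟩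
  have hne : Nontrivial (V →L[ℂ] V) := by
    by_contra hn
    rw [not_nontrivial_iff_subsingleton] at hn
    rw [spectrum.of_subsingleton] at hx
    exact hx
  have h1 := (spectrum.norm_le_norm_of_mem hx).trans H.norm_resolvent_le
  exact (Complex.re_le_norm x).trans h1

theorem powNeg_eq (H : Hamiltonian V) {ℓ : ℝ} (hℓ : 0 < ℓ) :
    H.powNeg ℓ = cfc (fun x : ℂ => ((x.re ^ ℓ : ℝ) : ℂ)) H.resolvent := by
  unfold powNeg apply
  refine cfc_congr fun x hx => ?_
  obtain ⟨h1, h2, -⟩ := H.spectrum_resolvent hx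
  by_cases h : x = 0
  · simp [h, Real.zero_rpow hℓ.ne']
  · simp only [if_neg h]
    have h3 : 0 < x.re := lt_of_le_of_ne h2 fun h4 => h (by rw [h1, ← h4]; simp)
    rw [add_sub_cancel, Real.inv_rpow h2, Real.rpow_neg h2, inv_inv]

theorem powNeg_add (H : Hamiltonian V) {k ℓ : ℝ} (hk : 0 < k) (hℓ : 0 < ℓ) :
    H.powNeg (k + ℓ) = H.powNeg k * H.powNeg ℓ := by
  have hc : ∀ {s : ℝ}, 0 < s → ContinuousOn (fun x : ℂ => ((x.re ^ s : ℝ) : ℂ))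
      (spectrum ℂ H.resolvent) := fun hs => (Complex.continuous_ofReal.comp
      (Complex.continuous_re.rpow_const fun _ => Or.inr hs.le)).continuousOn
  rw [powNeg_eq H hk, powNeg_eq H hℓ, powNeg_eq H (add_pos hk hℓ),
    ← cfc_mul _ _ _ (hc hk) (hc hℓ)]
  refine cfc_congr fun x hx => ?_
  obtain ⟨-, h2, -⟩ := H.spectrum_resolvent hx
  change ((x.re ^ (k + ℓ) : ℝ) : ℂ) = _
  rw [Real.rpow_add_of_nonneg h2 hk.le hℓ.le, Complex.ofReal_mul]

theorem norm_powNeg_le (H : Hamiltonian V) {ℓ : ℝ} (hℓ : 0 < ℓ) : ‖H.powNeg ℓ‖ ≤ 1 := by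
  rw [powNeg_eq H hℓ]
  refine norm_cfc_le zero_le_one fun x hx => ?_
  obtain ⟨-, h2, h3⟩ := H.spectrum_resolvent hx
  rw [Complex.norm_real, Real.norm_of_nonneg (Real.rpow_nonneg h2 _)]
  exact Real.rpow_le_one h2 h3 hℓ.le

/-! ### Ultraweakly continuous functionals and the energy norms -/

/-- The ultraweak topology on the bounded operators: the coarsest topology for which all maps
`A ↦ ∑ₙ ⟪xₙ, A yₙ⟫` with `∑ₙ ‖xₙ‖² < ∞`, `∑ₙ ‖yₙ‖² < ∞` are continuous. -/
noncomputable abbrev ultraweak (V : Type*) [NormedAddCommGroup V] [InnerProductSpace ℂ V] :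
    TopologicalSpace (V →L[ℂ] V) :=
  ⨅ p : {p : (ℕ → V) × (ℕ → V) // (Summable fun n => ‖p.1 n‖ ^ 2) ∧
      Summable fun n => ‖p.2 n‖ ^ 2},
    TopologicalSpace.induced
      (fun A : V →L[ℂ] V => ∑' n, inner ℂ (p.1.1 n) (A (p.1.2 n))) inferInstance

/-- The space `Σ` of ultraweakly continuous linear functionals on the bounded operators. -/
def normalFunctionals (V : Type*) [NormedAddCommGroup V] [InnerProductSpace ℂ V] :
    Submodule ℂ (Module.Dual ℂ (V →L[ℂ] V)) where
  carrier := {σ | @Continuous _ _ (ultraweak V) _ σ}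
  zero_mem' := @continuous_const _ _ (ultraweak V) _ 0
  add_mem' {σ τ} hσ hτ :=
    @Continuous.comp _ _ _ (ultraweak V) _ _ (fun A => (σ A, τ A)) (fun q : ℂ × ℂ => q.1 + q.2)
      continuous_add (@Continuous.prodMk _ _ _ _ _ (ultraweak V) _ _ hσ hτ)
  smul_mem' c {σ} hσ :=
    @Continuous.comp _ _ _ (ultraweak V) _ _ σ (fun q : ℂ => c • q) (continuous_const_smul c) hσ

/-- `‖σ‖_ℓ = ‖σ((1+H)^ℓ · (1+H)^ℓ)‖`, the supremum of `|σ((1+H)^ℓ A (1+H)^ℓ)|` over all `A` in the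
unit ball for which `B = (1+H)^ℓ A (1+H)^ℓ` is bounded, i.e. `A = (1+H)^(-ℓ) B (1+H)^(-ℓ)`. -/
noncomputable def lnorm (H : Hamiltonian V) (ℓ : ℝ) (σ : Module.Dual ℂ (V →L[ℂ] V)) : ℝ≥0∞ :=
  ⨆ (B : V →L[ℂ] V) (_ : ‖H.powNeg ℓ * B * H.powNeg ℓ‖ ≤ 1), ‖σ B‖ₑ

theorem lnorm_add_le (H : Hamiltonian V) (ℓ : ℝ) (σ τ : Module.Dual ℂ (V →L[ℂ] V)) :
    H.lnorm ℓ (σ + τ) ≤ H.lnorm ℓ σ + H.lnorm ℓ τ :=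
  iSup₂_le fun B hB => (enorm_add_le (σ B) (τ B)).trans
    (add_le_add (le_iSup₂ (f := fun B (_ : ‖H.powNeg ℓ * B * H.powNeg ℓ‖ ≤ 1) => ‖σ B‖ₑ) B hB)
      (le_iSup₂ (f := fun B (_ : ‖H.powNeg ℓ * B * H.powNeg ℓ‖ ≤ 1) => ‖τ B‖ₑ) B hB))

theorem lnorm_smul_le (H : Hamiltonian V) (ℓ : ℝ) (c : ℂ) (σ : Module.Dual ℂ (V →L[ℂ] V)) :
    H.lnorm ℓ (c • σ) ≤ ‖c‖ₑ * H.lnorm ℓ σ :=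
  iSup₂_le fun B hB => by
    rw [LinearMap.smul_apply, enorm_smul]
    exact mul_le_mul_right
      (le_iSup₂ (f := fun B (_ : ‖H.powNeg ℓ * B * H.powNeg ℓ‖ ≤ 1) => ‖σ B‖ₑ) B hB) _

theorem lnorm_mono (H : Hamiltonian V) {k ℓ : ℝ} (hk : 0 < k) (hkℓ : k ≤ ℓ)
    (σ : Module.Dual ℂ (V →L[ℂ] V)) : H.lnorm k σ ≤ H.lnorm ℓ σ := by
  rcases hkℓ.eq_or_lt with rfl | hlt
  · exact le_rfl
  refine iSup₂_le fun B hB =>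
    le_iSup₂ (f := fun B (_ : ‖H.powNeg ℓ * B * H.powNeg ℓ‖ ≤ 1) => ‖σ B‖ₑ) B ?_
  have hd : 0 < ℓ - k := sub_pos.2 hlt
  have h1 : H.powNeg ℓ = H.powNeg (ℓ - k) * H.powNeg k := by
    rw [← powNeg_add H hd hk, sub_add_cancel]
  have h2 : H.powNeg ℓ = H.powNeg k * H.powNeg (ℓ - k) := by
    rw [← powNeg_add H hk hd, add_sub_cancel]
  have h3 : H.powNeg ℓ * B * H.powNeg ℓ =
      H.powNeg (ℓ - k) * (H.powNeg k * B * H.powNeg k) * H.powNeg (ℓ - k) := by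
    nth_rewrite 1 [h1]
    rw [h2]
    simp only [mul_assoc]
  rw [h3]
  have h4 := H.norm_powNeg_le hd
  calc _ ≤ ‖H.powNeg (ℓ - k)‖ * ‖H.powNeg k * B * H.powNeg k‖ * ‖H.powNeg (ℓ - k)‖ :=
        (norm_mul_le _ _).trans (mul_le_mul_of_nonneg_right (norm_mul_le _ _) (norm_nonneg _))
    _ ≤ 1 * 1 * 1 := by gcongr
    _ = 1 := by norm_num

/-- The space of smooth functionals `C^∞(Σ) = ⋂_{ℓ > 0} Σ_ℓ`, where
`Σ_ℓ = {σ ∈ Σ : ‖σ‖_ℓ < ∞}`. -/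
def smoothFunctionals (H : Hamiltonian V) : Submodule ℂ (Module.Dual ℂ (V →L[ℂ] V)) where
  carrier := {σ | σ ∈ normalFunctionals V ∧ ∀ ℓ : ℝ, 0 < ℓ → H.lnorm ℓ σ < ⊤}
  zero_mem' := ⟨Submodule.zero_mem _, fun ℓ _ => by simp [lnorm]⟩
  add_mem' {σ τ} hσ hτ := ⟨Submodule.add_mem _ hσ.1 hτ.1, fun ℓ hℓ =>
    (H.lnorm_add_le ℓ σ τ).trans_lt (ENNReal.add_lt_top.2 ⟨hσ.2 ℓ hℓ, hτ.2 ℓ hℓ⟩)⟩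
  smul_mem' c {σ} hσ := ⟨Submodule.smul_mem _ c hσ.1, fun ℓ hℓ =>
    (H.lnorm_smul_le ℓ c σ).trans_lt (ENNReal.mul_lt_top enorm_lt_top (hσ.2 ℓ hℓ))⟩

/-- The energy-bounded functionals `Σ(E) = {σ(P(E) · P(E)) : σ ∈ Σ}`. -/
def energyBounded (H : Hamiltonian V) (E : ℝ) : Set (Module.Dual ℂ (V →L[ℂ] V)) :=
  {σ | ∃ τ ∈ normalFunctionals V, ∀ A, σ A = τ (H.specProj E * A * H.specProj E)}

/-- The norm `‖φ‖_{-ℓ}` dual to `‖·‖_ℓ`. -/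
noncomputable def dualNorm (H : Hamiltonian V) (ℓ : ℝ)
    (φ : Module.Dual ℂ H.smoothFunctionals) : ℝ≥0∞ :=
  ⨆ (σ : H.smoothFunctionals) (_ : H.lnorm ℓ σ ≤ 1), ‖φ σ‖ₑ

theorem dualNorm_add_le (H : Hamiltonian V) (ℓ : ℝ) (φ ψ : Module.Dual ℂ H.smoothFunctionals) :
    H.dualNorm ℓ (φ + ψ) ≤ H.dualNorm ℓ φ + H.dualNorm ℓ ψ :=
  iSup₂_le fun σ hσ => (enorm_add_le (φ σ) (ψ σ)).trans
    (add_le_add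
      (le_iSup₂ (f := fun (σ : H.smoothFunctionals) (_ : H.lnorm ℓ σ ≤ 1) => ‖φ σ‖ₑ) σ hσ)
      (le_iSup₂ (f := fun (σ : H.smoothFunctionals) (_ : H.lnorm ℓ σ ≤ 1) => ‖ψ σ‖ₑ) σ hσ))

theorem dualNorm_smul_le (H : Hamiltonian V) (ℓ : ℝ) (c : ℂ)
    (φ : Module.Dual ℂ H.smoothFunctionals) :
    H.dualNorm ℓ (c • φ) ≤ ‖c‖ₑ * H.dualNorm ℓ φ :=
  iSup₂_le fun σ hσ => by
    rw [LinearMap.smul_apply, enorm_smul]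
    exact mul_le_mul_right
      (le_iSup₂ (f := fun (σ : H.smoothFunctionals) (_ : H.lnorm ℓ σ ≤ 1) => ‖φ σ‖ₑ) σ hσ) _

theorem dualNorm_anti (H : Hamiltonian V) {k ℓ : ℝ} (hk : 0 < k) (hkℓ : k ≤ ℓ)
    (φ : Module.Dual ℂ H.smoothFunctionals) : H.dualNorm ℓ φ ≤ H.dualNorm k φ :=
  iSup₂_le fun σ hσ =>
    le_iSup₂ (f := fun (σ : H.smoothFunctionals) (_ : H.lnorm k σ ≤ 1) => ‖φ σ‖ₑ) σ
      ((H.lnorm_mono hk hkℓ σ).trans hσ)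

/-- The dual `Σ_ℓ^*`, realised by restriction to the dense subspace `C^∞(Σ)` of `Σ_ℓ`: the linear
forms `φ` on `C^∞(Σ)` with `‖φ‖_{-ℓ} < ∞`. -/
def dualSpace (H : Hamiltonian V) (ℓ : ℝ) :
    Submodule ℂ (Module.Dual ℂ H.smoothFunctionals) where
  carrier := {φ | H.dualNorm ℓ φ < ⊤}
  zero_mem' := by simp [dualNorm]
  add_mem' {φ ψ} hφ hψ :=
    (H.dualNorm_add_le ℓ φ ψ).trans_lt (ENNReal.add_lt_top.2 ⟨hφ, hψ⟩)
  smul_mem' c {φ} hφ :=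
    (H.dualNorm_smul_le ℓ c φ).trans_lt (ENNReal.mul_lt_top enorm_lt_top hφ)

/-- The dual `C^∞(Σ)^* = ⋃_{ℓ > 0} Σ_ℓ^*`. -/
def smoothDual (H : Hamiltonian V) : Submodule ℂ (Module.Dual ℂ H.smoothFunctionals) where
  carrier := {φ | ∃ ℓ : ℝ, 0 < ℓ ∧ H.dualNorm ℓ φ < ⊤}
  zero_mem' := ⟨1, one_pos, by simp [dualNorm]⟩
  add_mem' := by
    rintro φ ψ ⟨k, hk, hφ⟩ ⟨ℓ, hℓ, hψ⟩
    refine ⟨max k ℓ, lt_max_of_lt_left hk, ?_⟩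
    refine (H.dualNorm_add_le _ φ ψ).trans_lt (ENNReal.add_lt_top.2 ⟨?_, ?_⟩)
    · exact (H.dualNorm_anti hk (le_max_left _ _) φ).trans_lt hφ
    · exact (H.dualNorm_anti hℓ (le_max_right _ _) ψ).trans_lt hψ
  smul_mem' := by
    rintro c φ ⟨ℓ, hℓ, hφ⟩
    exact ⟨ℓ, hℓ, (H.dualNorm_smul_le ℓ c φ).trans_lt (ENNReal.mul_lt_top enorm_lt_top hφ)⟩

/-! ### Products of smeared-out fields -/

/-- The functional `A ↦ ⟪x, A y⟫`. -/
noncomputable def vecFunctional (x y : V) : Module.Dual ℂ (V →L[ℂ] V) where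
  toFun A := inner ℂ x (A y)
  map_add' A B := by rw [add_apply, inner_add_right]
  map_smul' c A := by
    rw [smul_apply, inner_smul_right]; rfl

open Classical in
/-- The quadratic form `⟪x, φ y⟫` of `φ ∈ C^∞(Σ)^*`: the value of `φ` on the functional
`A ↦ ⟪x, A y⟫`, defined if that functional lies in `C^∞(Σ)`, in particular if `x` and `y` are in
`C^∞(H) = ⋂_ℓ (1+H)^(-ℓ) V`. -/
noncomputable def form (H : Hamiltonian V) (φ : Module.Dual ℂ H.smoothFunctionals) (x y : V) : ℂ :=
  if h : vecFunctional x y ∈ H.smoothFunctionals then φ ⟨vecFunctional x y, h⟩ else 0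

open Classical in
/-- For bounded operators `S`, `T` such that `S^*` and `T` map into `C^∞(H)`: the bounded operator
`S φ T`, i.e. the unique one with `⟪x, (S φ T) y⟫ = ⟪S^* x, φ (T y)⟫` for all `x`, `y`. -/
noncomputable def sandwich (H : Hamiltonian V) (S : V →L[ℂ] V)
    (φ : Module.Dual ℂ H.smoothFunctionals) (T : V →L[ℂ] V) : V →L[ℂ] V :=
  if h : ∃ A : V →L[ℂ] V, ∀ x y, inner ℂ x (A y) =
      H.form φ (ContinuousLinearMap.adjoint S x) (T y)
  then h.choose else 0

/-- For `σ ∈ Σ(E)`, the function `z ↦ σ(φ(z/2) φ'(-z/2))` on the lower half plane (extended by `0`),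
where `φ(w) = exp(i w H) φ exp(-i w H)`, that is
`σ(exp(i z H / 2) φ exp(-i z H) φ' exp(i z H / 2))`. -/
noncomputable def corr (H : Hamiltonian V) (E : ℝ) (σ : Module.Dual ℂ (V →L[ℂ] V))
    (φ φ' : Module.Dual ℂ H.smoothFunctionals) (z : ℂ) : ℂ :=
  if z.im < 0 then
    σ (H.sandwich (ContinuousLinearMap.adjoint (H.expLow E (-(starRingEnd ℂ) z))) φ
        (H.expDecay z) *
      H.sandwich (H.expDecay z) φ' (H.expLow E z))
  else 0

end

end Hamiltonian

/-! ### Analytic functions regular at the boundary -/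

/-- `‖F‖_{-ℓ} = sup_{-1 ≤ Im z < 0} |F(z)| |Im z|^ℓ`. -/
noncomputable def kernelNorm (ℓ : ℝ) (F : ℂ → ℂ) : ℝ≥0∞ :=
  ⨆ (z : ℂ) (_ : -1 ≤ z.im ∧ z.im < 0), ‖F z‖ₑ * ENNReal.ofReal (|z.im| ^ ℓ)

theorem kernelNorm_add_le (ℓ : ℝ) (F G : ℂ → ℂ) :
    kernelNorm ℓ (F + G) ≤ kernelNorm ℓ F + kernelNorm ℓ G :=
  iSup₂_le fun z hz => by
    refine (mul_le_mul_left (enorm_add_le (F z) (G z)) _).trans ?_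
    rw [add_mul]
    exact add_le_add
      (le_iSup₂ (f := fun (z : ℂ) (_ : -1 ≤ z.im ∧ z.im < 0) =>
        ‖F z‖ₑ * ENNReal.ofReal (|z.im| ^ ℓ)) z hz)
      (le_iSup₂ (f := fun (z : ℂ) (_ : -1 ≤ z.im ∧ z.im < 0) =>
        ‖G z‖ₑ * ENNReal.ofReal (|z.im| ^ ℓ)) z hz)

theorem kernelNorm_smul_le (ℓ : ℝ) (c : ℂ) (F : ℂ → ℂ) :
    kernelNorm ℓ (c • F) ≤ ‖c‖ₑ * kernelNorm ℓ F :=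
  iSup₂_le fun z hz => by
    rw [Pi.smul_apply, enorm_smul, mul_assoc]
    exact mul_le_mul_right
      (le_iSup₂ (f := fun (z : ℂ) (_ : -1 ≤ z.im ∧ z.im < 0) =>
        ‖F z‖ₑ * ENNReal.ofReal (|z.im| ^ ℓ)) z hz) _

/-- The space `𝒦^ℓ` of analytic functions on the open lower half plane with `‖F‖_{-ℓ} < ∞`. Such a
function is represented by its extension by `0` to the whole plane. -/
def kernelSpace (ℓ : ℝ) : Submodule ℂ (ℂ → ℂ) where
  carrier := {F | DifferentiableOn ℂ F {z | z.im < 0} ∧ (∀ z : ℂ, 0 ≤ z.im → F z = 0) ∧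
    kernelNorm ℓ F < ⊤}
  zero_mem' := ⟨differentiableOn_const 0, fun _ _ => rfl, by simp [kernelNorm]⟩
  add_mem' {F G} hF hG := ⟨hF.1.add hG.1, fun z hz => by simp [hF.2.1 z hz, hG.2.1 z hz],
    (kernelNorm_add_le ℓ F G).trans_lt (ENNReal.add_lt_top.2 ⟨hF.2.2, hG.2.2⟩)⟩
  smul_mem' c {F} hF := ⟨hF.1.const_smul c, fun z hz => by simp [hF.2.1 z hz],
    (kernelNorm_smul_le ℓ c F).trans_lt (ENNReal.mul_lt_top enorm_lt_top hF.2.2)⟩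

/-- `b = ∫ f(x) G(x - i0) dx := lim_{y → 0+} ∫ f(x) G(x - i y) dx`. -/
def IsBoundaryIntegral (f : ℝ → ℂ) (G : ℂ → ℂ) (b : ℂ) : Prop :=
  Tendsto (fun y : ℝ => ∫ x : ℝ, f x * G (x - I * y)) (𝓝[>] 0) (𝓝 b)

/-! ### Vector-valued distributions -/

/-- The scaled Sobolev norm `‖f‖_{d,m} = max_{0 ≤ n ≤ m} dⁿ ‖f⁽ⁿ⁾‖₁`. -/
noncomputable def sobNorm (d : ℝ) (m : ℕ) (f : ℝ → ℂ) : ℝ :=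
  (Finset.range (m + 1)).sup' Finset.nonempty_range_add_one
    fun n => d ^ n * ∫ x : ℝ, ‖iteratedDeriv n f x‖

/-- The test functions on the real line. -/
abbrev LineTest : Type := 𝓓((⊤ : TopologicalSpace.Opens ℝ), ℂ)

namespace Hamiltonian

section

variable {V : Type*} [NormedAddCommGroup V] [InnerProductSpace ℂ V] [CompleteSpace V]

/-- `T` is a `C^∞(Σ)^*`-valued distribution (of finite energy order and finite order). The test
functions in `𝓓(-d,d)` are those with support in the open interval `(-d,d)`. -/
def IsDistribution (H : Hamiltonian V) (T : LineTest →ₗ[ℂ] H.smoothDual) : Prop :=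
  ∃ ℓ : ℝ, 0 < ℓ ∧ ∃ m : ℕ, ∀ d : ℝ, 0 < d → ∃ c : ℝ,
    ∀ f : LineTest, tsupport f ⊆ Ioo (-d) d →
      H.dualNorm ℓ (T f) ≤ ENNReal.ofReal (c * sobNorm d m f)

/-- `‖T‖_{-ℓ; d, m}`, the operator norm of `T` on `𝓓(-d,d)` from the norm `‖·‖_{d,m}` to `‖·‖_{-ℓ}`. -/
noncomputable def distNorm (H : Hamiltonian V) (ℓ d : ℝ) (m : ℕ)
    (T : LineTest →ₗ[ℂ] H.smoothDual) : ℝ≥0∞ :=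
  ⨆ (f : LineTest) (_ : tsupport f ⊆ Ioo (-d) d ∧ sobNorm d m f ≤ 1), H.dualNorm ℓ (T f)

/-- The product space `𝒦^ℓ ⊗ Σ_ℓ^* ⊗ Σ_ℓ^*` of level `ℓ`. -/
abbrev ProductSpace (H : Hamiltonian V) (ℓ : ℝ) : Type _ :=
  kernelSpace ℓ ⊗[ℂ] (H.dualSpace ℓ ⊗[ℂ] H.dualSpace ℓ)

/-- On energy-bounded functionals `σ`, the expectation values of `T` are
`σ(T(f)) = ∑ⱼ ∫ ds' f(s') Kⱼ(s' - i0) σ(φⱼ(s'/2 - i0) φ'ⱼ(-s'/2 + i0))`; the product of the boundary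
distributions is the boundary value of the product of the analytic functions. -/
def HasProductExpectations (H : Hamiltonian V) {n : ℕ} (K : Fin n → ℂ → ℂ)
    (φ φ' : Fin n → Module.Dual ℂ H.smoothFunctionals) (T : LineTest →ₗ[ℂ] H.smoothDual) : Prop :=
  ∀ E : ℝ, 0 < E → ∀ σ : H.smoothFunctionals, (σ : Module.Dual ℂ (V →L[ℂ] V)) ∈ H.energyBounded E →
    ∀ f : LineTest, ∃ b : Fin n → ℂ,
      (∀ j, IsBoundaryIntegral f (fun z => K j z * H.corr E σ (φ j) (φ' j) z) (b j)) ∧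
      (T f : Module.Dual ℂ H.smoothFunctionals) σ = ∑ j, b j

end

end Hamiltonian

/-! Write R = (1+H)⁻¹. An element φ of Σ_ℓ^* is only a form, but R^ℓ φ R^ℓ is a bounded operator of
norm at most ‖φ‖_{-ℓ} (`exists_regularized`). For Im z = -y < 0 the factor exp(-izH) between the two
fields damps high energies: each half of it absorbs the (1+H)^ℓ of the adjacent field at the price
y^{-ℓ} (`norm_decayOp_le`). Together with K this gives a singularity y^{-3ℓ}. The outer factors
exp(izH/2) do not damp: at energy E they have size exp(yE/2). On Σ(E) this is harmless, but it
yields no estimate uniform in E.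

An analytic function with |G| ≤ M y^{-p} in a strip 0 < y ≤ y₀ ≤ 1 has a distributional boundary
value, because a y-derivative is an x-derivative and can be moved to the test function. A Taylor
expansion in y, started at y₀, bounds the smeared function by M y₀^{-p} times the sum of the L¹
norms of the derivatives of f up to order m+1, for any m ≥ p (`norm_lineIntegral_le_of_bound`).

The decisive point is to let the height of the strip depend on the energy. Both sides are cut into
energy slices, roughly (j,j+1] and (k,k+1], and for this pair y₀ = 1/(1+max(j,k)), so that the outer
exponentials stay bounded. The left side then costs (1+j)^ℓ for its field and at most (1+j)^{3ℓ} as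
its share of y₀^{-3ℓ}, and it gains (1+j)^{-(5ℓ+1)} from the norm ‖σ‖_{5ℓ+1}; likewise on the right
with k. What remains is (1+j)^{-(ℓ+1)} (1+k)^{-(ℓ+1)}, which is summable (`norm_sliceVal_le`). The
product distribution is the sum of the slice contributions, defined for every smooth σ.

For energy-bounded σ only finitely many slices contribute, and the sum is the boundary integral of
the statement (`isBoundaryIntegral_corr`). These σ determine an element of C^∞(Σ)^*, since cutting σ
off at energy E changes it in ‖·‖_k by O(1/E) ‖σ‖_{k+1} (`eq_zero_of_forall_energyBounded`); this
gives uniqueness. Each slice contribution is linear in the kernel and in both fields, so the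
construction passes to the tensor product.

No Borel calculus is used. Functions of H are continuous functions of R that vanish at 0, P(E) is
the projection onto a kernel, and `apply_mul_specProj_eq_zero` and
`apply_mul_one_sub_specProj_eq_zero` tie the two together. -/

/-- Continuous functions on `[0,∞)` that vanish at infinity. -/
structure VanishesAtTop (f : ℝ → ℂ) : Prop where
  continuousOn : ContinuousOn f (Ici 0)
  tendsto : Tendsto f atTop (𝓝 0)

namespace VanishesAtTop

variable {f g : ℝ → ℂ}

theorem add (hf : VanishesAtTop f) (hg : VanishesAtTop g) :
    VanishesAtTop fun t => f t + g t :=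
  ⟨hf.1.add hg.1, by simpa using hf.2.add hg.2⟩

theorem sub (hf : VanishesAtTop f) (hg : VanishesAtTop g) :
    VanishesAtTop fun t => f t - g t :=
  ⟨hf.1.sub hg.1, by simpa using hf.2.sub hg.2⟩

theorem mul (hf : VanishesAtTop f) (hg : VanishesAtTop g) :
    VanishesAtTop fun t => f t * g t :=
  ⟨hf.1.mul hg.1, by simpa using hf.2.mul hg.2⟩

theorem const_mul (c : ℂ) (hf : VanishesAtTop f) : VanishesAtTop fun t => c * f t :=
  ⟨continuousOn_const.mul hf.1, by simpa using hf.2.const_mul c⟩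

theorem star (hf : VanishesAtTop f) : VanishesAtTop fun t => star (f t) :=
  ⟨hf.1.star, by simpa using hf.2.star⟩

theorem of_eventually_zero (hf : ContinuousOn f (Ici 0)) (h : ∀ᶠ t in atTop, f t = 0) :
    VanishesAtTop f :=
  ⟨hf, tendsto_const_nhds.congr' (h.mono fun _ ht => ht.symm)⟩

theorem of_norm_le (hf : ContinuousOn f (Ici 0)) {b : ℝ → ℝ} (hb : Tendsto b atTop (𝓝 0))
    (h : ∀ᶠ t in atTop, ‖f t‖ ≤ b t) : VanishesAtTop f :=
  ⟨hf, squeeze_zero_norm' h hb⟩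

theorem exists_norm_le (hf : VanishesAtTop f) : ∃ C, 0 ≤ C ∧ ∀ t, 0 ≤ t → ‖f t‖ ≤ C := by
  obtain ⟨T, hT⟩ := eventually_atTop.1
    ((tendsto_zero_iff_norm_tendsto_zero.1 hf.2).eventually (gt_mem_nhds one_pos))
  obtain ⟨C, hC⟩ := (isCompact_Icc (a := (0 : ℝ)) (b := T)).exists_bound_of_continuousOn
    (hf.1.mono Icc_subset_Ici_self)
  refine ⟨max 1 C, zero_le_one.trans (le_max_left _ _), fun t ht => ?_⟩
  rcases le_total t T with h | h
  · exact (hC t ⟨ht, h⟩).trans (le_max_right _ _)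
  · exact (hT t h).le.trans (le_max_left _ _)

end VanishesAtTop

namespace Hamiltonian

section

variable {V : Type*} [NormedAddCommGroup V] [InnerProductSpace ℂ V] [CompleteSpace V]

/-! ### The functional calculus -/

theorem isSelfAdjoint_resolvent (H : Hamiltonian V) : IsSelfAdjoint H.resolvent :=
  IsSelfAdjoint.of_nonneg H.resolvent_nonneg

/-- The substitution t = 1/x - 1 sends the nonzero spectrum of R, contained in (0,1], into [0,∞),
and x → 0 corresponds to t → ∞, where f tends to the prescribed value 0. -/
theorem continuousOn_compactified (H : Hamiltonian V) {f : ℝ → ℂ} (hf : VanishesAtTop f) :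
    ContinuousOn (fun x : ℂ => if x = 0 then 0 else f (x.re⁻¹ - 1))
      (spectrum ℂ H.resolvent) := by
  intro x hx
  by_cases h0 : x = 0
  · subst h0
    rw [ContinuousWithinAt, if_pos rfl]
    have hle : 𝓝[spectrum ℂ H.resolvent] (0 : ℂ) ≤ 𝓝[{x : ℂ | x = x.re ∧ 0 ≤ x.re}] 0 :=
      nhdsWithin_mono _ fun y hy => ⟨(H.spectrum_resolvent hy).1, (H.spectrum_resolvent hy).2.1⟩
    refine Tendsto.mono_left ?_ hle
    rw [Metric.tendsto_nhdsWithin_nhds]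
    intro ε hε
    obtain ⟨T, hT⟩ := eventually_atTop.1
      ((tendsto_zero_iff_norm_tendsto_zero.1 hf.2).eventually (gt_mem_nhds hε))
    refine ⟨(max T 0 + 1)⁻¹, by positivity, fun y hy hd => ?_⟩
    rw [dist_zero_right] at hd ⊢
    split_ifs with h
    · simpa using hε
    · have hpos : 0 < y.re := lt_of_le_of_ne hy.2 fun h4 => h (by rw [hy.1, ← h4]; simp)
      refine hT _ ?_
      have h1 : y.re < (max T 0 + 1)⁻¹ := (Complex.re_le_norm y).trans_lt hd
      have h2 : max T 0 + 1 < y.re⁻¹ := (lt_inv_comm₀ hpos (by positivity)).1 h1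
      linarith [le_max_left T 0]
  · obtain ⟨hx1, hx2, hx3⟩ := H.spectrum_resolvent hx
    have hpos : 0 < x.re := lt_of_le_of_ne hx2 fun h4 => h0 (by rw [hx1, ← h4]; simp)
    have h1 : ContinuousWithinAt (fun x : ℂ => f (x.re⁻¹ - 1))
        (spectrum ℂ H.resolvent ∩ {y | 0 < y.re}) x := by
      have h2 : ContinuousWithinAt (fun x : ℂ => x.re⁻¹ - 1)
          (spectrum ℂ H.resolvent ∩ {y | 0 < y.re}) x :=
        ((Complex.continuous_re.continuousAt.inv₀ hpos.ne').sub
          continuousAt_const).continuousWithinAt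
      refine (hf.1 _ ?_).comp h2 ?_
      · exact sub_nonneg.2 ((one_le_inv₀ hpos).2 hx3)
      · intro y hy
        exact sub_nonneg.2 ((one_le_inv₀ hy.2).2 (H.spectrum_resolvent hy.1).2.2)
    have hopen : {y : ℂ | 0 < y.re} ∈ 𝓝 x :=
      (isOpen_lt continuous_const Complex.continuous_re).mem_nhds hpos
    rw [continuousWithinAt_inter hopen] at h1
    refine h1.congr_of_eventuallyEq ?_ (if_neg h0)
    filter_upwards [mem_nhdsWithin_of_mem_nhds (isOpen_ne.mem_nhds h0)] with y hy
    exact if_neg hy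

theorem apply_congr (H : Hamiltonian V) {f g : ℝ → ℂ} (h : ∀ t, 0 ≤ t → f t = g t) :
    H.apply f = H.apply g := by
  refine cfc_congr fun x hx => ?_
  obtain ⟨hx1, hx2, hx3⟩ := H.spectrum_resolvent hx
  by_cases h0 : x = 0
  · simp [h0]
  · have hpos : 0 < x.re := lt_of_le_of_ne hx2 fun h4 => h0 (by rw [hx1, ← h4]; simp)
    simp only [if_neg h0]
    exact h _ (sub_nonneg.2 ((one_le_inv₀ hpos).2 hx3))

/-- Continuity of f is not needed, because `cfc` takes the value 0 on functions that are not
continuous on the spectrum. -/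
theorem norm_apply_le (H : Hamiltonian V) {f : ℝ → ℂ} {c : ℝ} (hc : 0 ≤ c)
    (h : ∀ t, 0 ≤ t → ‖f t‖ ≤ c) : ‖H.apply f‖ ≤ c := by
  refine norm_cfc_le hc fun x hx => ?_
  obtain ⟨hx1, hx2, hx3⟩ := H.spectrum_resolvent hx
  by_cases h0 : x = 0
  · simpa [h0] using hc
  · have hpos : 0 < x.re := lt_of_le_of_ne hx2 fun h4 => h0 (by rw [hx1, ← h4]; simp)
    simp only [if_neg h0]
    exact h _ (sub_nonneg.2 ((one_le_inv₀ hpos).2 hx3))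

theorem apply_mul (H : Hamiltonian V) {f g : ℝ → ℂ} (hf : VanishesAtTop f)
    (hg : VanishesAtTop g) : H.apply (fun t => f t * g t) = H.apply f * H.apply g := by
  unfold apply
  rw [← cfc_mul _ _ _ (H.continuousOn_compactified hf) (H.continuousOn_compactified hg)]
  congr 1
  ext x
  split_ifs <;> simp

theorem apply_add (H : Hamiltonian V) {f g : ℝ → ℂ} (hf : VanishesAtTop f)
    (hg : VanishesAtTop g) : H.apply (fun t => f t + g t) = H.apply f + H.apply g := by
  unfold apply
  rw [← cfc_add _ _ _ (H.continuousOn_compactified hf) (H.continuousOn_compactified hg)]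
  congr 1
  ext x
  split_ifs <;> simp

theorem apply_sub (H : Hamiltonian V) {f g : ℝ → ℂ} (hf : VanishesAtTop f)
    (hg : VanishesAtTop g) : H.apply (fun t => f t - g t) = H.apply f - H.apply g := by
  unfold apply
  rw [← cfc_sub (A := V →L[ℂ] V) (a := H.resolvent) (f := _) (g := _)
    (hf := H.continuousOn_compactified hf) (hg := H.continuousOn_compactified hg)]
  congr 1
  ext x
  split_ifs <;> simp

theorem apply_const_mul (H : Hamiltonian V) {f : ℝ → ℂ} (c : ℂ) (hf : VanishesAtTop f) :
    H.apply (fun t => c * f t) = c • H.apply f := by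
  unfold apply
  rw [← cfc_const_mul c _ _ (H.continuousOn_compactified hf)]
  congr 1
  ext x
  split_ifs <;> simp

theorem adjoint_apply (H : Hamiltonian V) (f : ℝ → ℂ) :
    ContinuousLinearMap.adjoint (H.apply f) = H.apply fun t => star (f t) := by
  rw [← ContinuousLinearMap.star_eq_adjoint]
  unfold apply
  rw [← cfc_star]
  congr 1
  ext x
  split_ifs <;> simp

theorem apply_commute (H : Hamiltonian V) (f g : ℝ → ℂ) : Commute (H.apply f) (H.apply g) :=
  cfc_commute_cfc _ _ _

theorem apply_zero (H : Hamiltonian V) : H.apply (fun _ => 0) = 0 := by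
  have h := H.norm_apply_le (f := fun _ => 0) le_rfl (fun t _ => by simp)
  exact norm_le_zero_iff.1 h

/-! ### Powers -/

theorem vanishesAtTop_rpow_neg {ℓ : ℝ} (hℓ : 0 < ℓ) :
    VanishesAtTop fun t => (((1 + t) ^ (-ℓ) : ℝ) : ℂ) := by
  refine ⟨?_, ?_⟩
  · refine Complex.continuous_ofReal.comp_continuousOn ?_
    refine ContinuousOn.rpow_const (by fun_prop) fun t ht => Or.inl ?_
    have : (0 : ℝ) ≤ t := ht
    positivity
  · have h : Tendsto (fun t : ℝ => (1 + t) ^ (-ℓ)) atTop (𝓝 0) :=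
      (tendsto_rpow_neg_atTop hℓ).comp (tendsto_atTop_add_const_left _ 1 tendsto_id)
    have h2 := (Complex.continuous_ofReal.tendsto 0).comp h
    rw [Complex.ofReal_zero] at h2
    exact h2

theorem adjoint_powNeg (H : Hamiltonian V) (ℓ : ℝ) :
    ContinuousLinearMap.adjoint (H.powNeg ℓ) = H.powNeg ℓ := by
  unfold powNeg
  rw [adjoint_apply]
  exact H.apply_congr fun t _ => by simp

theorem powNeg_commute_apply (H : Hamiltonian V) (ℓ : ℝ) (f : ℝ → ℂ) :
    Commute (H.powNeg ℓ) (H.apply f) := H.apply_commute _ _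

theorem powNeg_commute (H : Hamiltonian V) (k ℓ : ℝ) : Commute (H.powNeg k) (H.powNeg ℓ) :=
  H.apply_commute _ _

/-- This is the device that takes a factor (1+H)^{-ℓ} out of an exponential and hands it to the
neighbouring field. -/
theorem apply_eq_powNeg_mul (H : Hamiltonian V) {f : ℝ → ℂ} {ℓ : ℝ} (hℓ : 0 < ℓ)
    (hf : VanishesAtTop fun t => f t * (((1 + t) ^ ℓ : ℝ) : ℂ)) :
    H.apply f = H.powNeg ℓ * H.apply fun t => f t * (((1 + t) ^ ℓ : ℝ) : ℂ) := by
  unfold powNeg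
  rw [← H.apply_mul (vanishesAtTop_rpow_neg hℓ) hf]
  refine H.apply_congr fun t ht => ?_
  have h : (((1 + t) ^ (-ℓ) : ℝ) : ℂ) * (((1 + t) ^ ℓ : ℝ) : ℂ) = 1 := by
    rw [← Complex.ofReal_mul, ← Real.rpow_add (by positivity)]
    simp
  linear_combination (-f t) * h

theorem powNeg_one (H : Hamiltonian V) : H.powNeg 1 = H.resolvent := by
  rw [powNeg_eq H one_pos]
  have h : cfc (fun x : ℂ => ((x.re ^ (1 : ℝ) : ℝ) : ℂ)) H.resolvent =
      cfc (id : ℂ → ℂ) H.resolvent := by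
    refine cfc_congr fun x hx => ?_
    rw [Real.rpow_one]
    exact (H.spectrum_resolvent hx).1.symm
  rw [h]
  exact cfc_id ℂ H.resolvent (ha := H.isSelfAdjoint_resolvent.isStarNormal)

theorem denseRange_resolvent (H : Hamiltonian V) : DenseRange H.resolvent := by
  refine H.selfAdjoint.dense_domain.mono ?_
  intro x hx
  exact ⟨H.onePlus ⟨x, hx⟩, H.resolvent_onePlus ⟨x, hx⟩⟩

/-! ### Spectral projections -/

/-- The function whose null space defines `P(E)`. -/
noncomputable def excess (E t : ℝ) : ℝ := max 0 (t - E) / (1 + t) ^ 2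

theorem excess_nonneg (E t : ℝ) : 0 ≤ excess E t := by unfold excess; positivity

theorem excess_eq_zero {E t : ℝ} (h : t ≤ E) : excess E t = 0 := by
  simp [excess, max_eq_left (sub_nonpos.2 h)]

theorem excess_pos {E t : ℝ} (ht : 0 ≤ t) (h : E < t) : 0 < excess E t := by
  unfold excess
  have : 0 < t - E := sub_pos.2 h
  have h2 : 0 < max 0 (t - E) := lt_max_of_lt_right this
  positivity

theorem continuousOn_excess (E : ℝ) : ContinuousOn (excess E) (Ici 0) := by
  unfold excess
  refine ContinuousOn.div (by fun_prop) (by fun_prop) fun t ht => ?_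
  have : (0 : ℝ) ≤ t := ht
  positivity

theorem vanishesAtTop_excess (E : ℝ) : VanishesAtTop fun t => ((excess E t : ℝ) : ℂ) := by
  refine VanishesAtTop.of_norm_le (b := fun t => (1 + |E|) * (1 + t)⁻¹)
    (Complex.continuous_ofReal.comp_continuousOn (continuousOn_excess E)) ?_ ?_
  · have h : Tendsto (fun t : ℝ => (1 + t)⁻¹) atTop (𝓝 0) :=
      tendsto_inv_atTop_zero.comp (tendsto_atTop_add_const_left _ 1 tendsto_id)
    simpa using h.const_mul (1 + |E|)
  · filter_upwards [eventually_ge_atTop 0] with t ht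
    rw [Complex.norm_real, Real.norm_of_nonneg (excess_nonneg E t)]
    unfold excess
    have h1 : max 0 (t - E) ≤ (1 + |E|) * (1 + t) := by
      refine max_le (by positivity) ?_
      nlinarith [neg_abs_le E, abs_nonneg E]
    calc _ ≤ (1 + |E|) * (1 + t) / (1 + t) ^ 2 := by gcongr
      _ = _ := by field_simp

theorem specProj_eq (H : Hamiltonian V) (E : ℝ) : H.specProj E =
    (H.apply fun t => ((excess E t : ℝ) : ℂ)).ker.starProjection := rfl

theorem specProj_apply_eq_self_iff (H : Hamiltonian V) (E : ℝ) (x : V) :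
    H.specProj E x = x ↔ H.apply (fun t => ((excess E t : ℝ) : ℂ)) x = 0 := by
  rw [specProj_eq, Submodule.starProjection_eq_self_iff]
  exact LinearMap.mem_ker

theorem specProj_mem (H : Hamiltonian V) (E : ℝ) (x : V) :
    H.apply (fun t => ((excess E t : ℝ) : ℂ)) (H.specProj E x) = 0 :=
  LinearMap.mem_ker.1 (Submodule.starProjection_apply_mem
    (H.apply fun t => ((excess E t : ℝ) : ℂ)).ker x)

theorem specProj_mul_self (H : Hamiltonian V) (E : ℝ) :
    H.specProj E * H.specProj E = H.specProj E := by
  ext x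
  exact (H.specProj_apply_eq_self_iff E _).2 (H.specProj_mem E x)

theorem adjoint_specProj (H : Hamiltonian V) (E : ℝ) :
    ContinuousLinearMap.adjoint (H.specProj E) = H.specProj E := by
  rw [← ContinuousLinearMap.star_eq_adjoint]
  exact isSelfAdjoint_starProjection _

theorem norm_specProj_le (H : Hamiltonian V) (E : ℝ) : ‖H.specProj E‖ ≤ 1 :=
  Submodule.starProjection_norm_le _

theorem norm_one_sub_specProj_le (H : Hamiltonian V) (E : ℝ) : ‖1 - H.specProj E‖ ≤ 1 := by
  have h : 1 - H.specProj E =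
      (H.apply fun t => ((excess E t : ℝ) : ℂ)).kerᗮ.starProjection := by
    rw [Submodule.starProjection_orthogonal]; rfl
  rw [h]
  exact Submodule.starProjection_norm_le _

/-- Since g(H) commutes with the operator whose kernel is the range of P, it preserves this range,
so P g(H) P = g(H) P. Taking g = f, and the adjoint of the relation for the conjugate of f, gives
f(H) P = P f(H) P = P f(H). -/
theorem specProj_commute_apply (H : Hamiltonian V) (E : ℝ) (f : ℝ → ℂ) :
    Commute (H.specProj E) (H.apply f) := by
  have key : ∀ g : ℝ → ℂ, H.specProj E * H.apply g * H.specProj E =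
      H.apply g * H.specProj E := by
    intro g
    ext x
    refine (H.specProj_apply_eq_self_iff E _).2 ?_
    have h := (H.apply_commute (fun t => ((excess E t : ℝ) : ℂ)) g).eq
    have h2 := congrArg (fun A : V →L[ℂ] V => A (H.specProj E x)) h
    change H.apply _ (H.apply g (H.specProj E x)) = H.apply g (H.apply _ (H.specProj E x)) at h2
    change H.apply _ (H.apply g (H.specProj E x)) = 0
    rw [h2, specProj_mem, map_zero]
  have h1 := key f
  have h2 := congrArg star (key fun t => star (f t))
  simp only [star_mul, ContinuousLinearMap.star_eq_adjoint, adjoint_specProj, adjoint_apply,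
    star_star] at h2
  exact h2.symm.trans ((mul_assoc _ _ _).symm.trans h1)

theorem specProj_commute_powNeg (H : Hamiltonian V) (E k : ℝ) :
    Commute (H.specProj E) (H.powNeg k) := H.specProj_commute_apply _ _

/-- Functions that vanish on `[0,E]` vanish on the range of `P(E)`. -/
theorem apply_mul_specProj_eq_zero (H : Hamiltonian V) {E : ℝ} {u : ℝ → ℂ}
    (hu : VanishesAtTop u) (h : ∀ t, 0 ≤ t → t ≤ E → u t = 0) :
    H.apply u * H.specProj E = 0 := by
  have key : ∀ ε : ℝ, 0 < ε → ‖H.apply u * H.specProj E‖ ≤ ε := by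
    intro ε hε
    -- The set where ‖u‖ ≥ ε is compact and lies in (E,∞), so `excess E` has a positive minimum on
    -- it; a large multiple of `excess E` then dominates the bound C of u there.
    obtain ⟨n, hn0, hn⟩ : ∃ n : ℝ, 0 ≤ n ∧
        ∀ t, 0 ≤ t → ‖u t‖ ≤ ε * (1 + n * excess E t) := by
      obtain ⟨C, hC0, hC⟩ := hu.exists_norm_le
      obtain ⟨T, hT⟩ := eventually_atTop.1
        ((tendsto_zero_iff_norm_tendsto_zero.1 hu.2).eventually (gt_mem_nhds hε))
      have hcl : IsClosed {t : ℝ | t ∈ Icc 0 T ∧ ‖u t‖ ∈ Ici ε} :=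
        ContinuousOn.preimage_isClosed_of_isClosed
          ((hu.1.mono Icc_subset_Ici_self).norm) isClosed_Icc isClosed_Ici
      have hcomp : IsCompact {t : ℝ | t ∈ Icc 0 T ∧ ‖u t‖ ∈ Ici ε} :=
        isCompact_Icc.of_isClosed_subset hcl fun t ht => ht.1
      rcases ({t : ℝ | t ∈ Icc 0 T ∧ ‖u t‖ ∈ Ici ε}).eq_empty_or_nonempty with he | hne
      · refine ⟨0, le_rfl, fun t ht => ?_⟩
        rw [zero_mul, add_zero, mul_one]
        by_contra! hlt
        have : t ∈ ({t : ℝ | t ∈ Icc 0 T ∧ ‖u t‖ ∈ Ici ε}) := by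
          refine ⟨⟨ht, ?_⟩, hlt.le⟩
          by_contra! hTt
          exact absurd (hT t hTt.le) (not_lt.2 hlt.le)
        rw [he] at this
        exact this
      · obtain ⟨t0, ht0, hmin⟩ := hcomp.exists_isMinOn hne
          ((continuousOn_excess E).mono fun t ht => ht.1.1)
        have hpos : 0 < excess E t0 := by
          refine excess_pos ht0.1.1 ?_
          by_contra! hle
          have h1 := h t0 ht0.1.1 hle
          have h2 : ε ≤ ‖u t0‖ := ht0.2
          rw [h1, norm_zero] at h2
          linarith
        refine ⟨C / (ε * excess E t0), by positivity, fun t ht => ?_⟩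
        by_cases hmem : t ∈ ({t : ℝ | t ∈ Icc 0 T ∧ ‖u t‖ ∈ Ici ε})
        · have h3 : excess E t0 ≤ excess E t := hmin hmem
          have h4 : C ≤ ε * (C / (ε * excess E t0) * excess E t) := by
            have : C = ε * (C / (ε * excess E t0) * excess E t0) := by field_simp
            calc C = ε * (C / (ε * excess E t0) * excess E t0) := this
              _ ≤ _ := by gcongr
          nlinarith [hC t ht]
        · have hlt : ‖u t‖ < ε := by
            by_contra! hge
            refine hmem ⟨⟨ht, ?_⟩, hge⟩
            by_contra! hTt
            exact absurd (hT t hTt.le) (not_lt.2 hge)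
          have := excess_nonneg E t
          have h5 : 0 ≤ ε * (C / (ε * excess E t0) * excess E t) := by positivity
          nlinarith
    have hden : ∀ t, (1 + n * excess E t : ℝ) ≠ 0 := fun t => by
      have := excess_nonneg E t
      positivity
    have hdenc : ∀ t, ((1 + n * excess E t : ℝ) : ℂ) ≠ 0 := fun t =>
      Complex.ofReal_ne_zero.2 (hden t)
    have hcont : ContinuousOn (fun t => ((1 + n * excess E t : ℝ) : ℂ)) (Ici 0) :=
      Complex.continuous_ofReal.comp_continuousOn
        (continuousOn_const.add (continuousOn_const.mul (continuousOn_excess E)))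
    set r : ℝ → ℂ := fun t => u t / ((1 + n * excess E t : ℝ) : ℂ) with hr
    have hrn : ∀ t, ‖r t‖ = ‖u t‖ / (1 + n * excess E t) := fun t => by
      have := excess_nonneg E t
      rw [hr, norm_div, Complex.norm_real, Real.norm_of_nonneg (by positivity)]
    have hrv : VanishesAtTop r := by
      refine VanishesAtTop.of_norm_le (hu.1.div hcont fun t _ => hdenc t)
        (tendsto_zero_iff_norm_tendsto_zero.1 hu.2) (Eventually.of_forall fun t => ?_)
      rw [hrn]
      have := excess_nonneg E t
      refine div_le_self (norm_nonneg _) ?_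
      have : 0 ≤ n * excess E t := by positivity
      linarith
    -- The second summand is killed by P(E), because `excess E` of H vanishes on its range. What is
    -- left is r(H) P(E), and ‖r‖ ≤ ε on [0,∞).
    have hsplit : H.apply u = H.apply r +
        (n : ℂ) • (H.apply r * H.apply fun t => ((excess E t : ℝ) : ℂ)) := by
      rw [← H.apply_mul hrv (vanishesAtTop_excess E), ← H.apply_const_mul _
        (hrv.mul (vanishesAtTop_excess E)), ← H.apply_add hrv
        ((hrv.mul (vanishesAtTop_excess E)).const_mul _)]
      refine H.apply_congr fun t _ => ?_
      have h6 : r t * ((1 + n * excess E t : ℝ) : ℂ) = u t := div_mul_cancel₀ _ (hdenc t)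
      rw [← h6]
      push_cast
      ring
    have hP : H.apply u * H.specProj E = H.apply r * H.specProj E := by
      ext x
      rw [hsplit]
      change H.apply r (H.specProj E x) +
        (n : ℂ) • (H.apply r (H.apply _ (H.specProj E x))) = H.apply r (H.specProj E x)
      rw [specProj_mem]
      simp
    rw [hP]
    have h7 : ‖H.apply r‖ ≤ ε := H.norm_apply_le hε.le fun t ht => by
      have := excess_nonneg E t
      rw [hrn, div_le_iff₀ (by positivity)]
      exact hn t ht
    calc _ ≤ ‖H.apply r‖ * ‖H.specProj E‖ := norm_mul_le _ _
      _ ≤ ε * 1 := by gcongr; exact H.norm_specProj_le E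
      _ = ε := mul_one _
  exact norm_le_zero_iff.1 (le_of_forall_gt_imp_ge_of_dense fun ε hε => key ε hε)

/-- Functions that vanish on `[E,∞)` vanish on the range of `1 - P(E)`. -/
theorem apply_mul_one_sub_specProj_eq_zero (H : Hamiltonian V) {E : ℝ} {u : ℝ → ℂ}
    (hu : VanishesAtTop u) (h : ∀ t, 0 ≤ t → E ≤ t → u t = 0) :
    H.apply u * (1 - H.specProj E) = 0 := by
  have h1 : H.apply (fun t => ((excess E t : ℝ) : ℂ)) * H.apply u = 0 := by
    rw [← H.apply_mul (vanishesAtTop_excess E) hu, ← H.apply_zero]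
    refine H.apply_congr fun t ht => ?_
    rcases le_total t E with hle | hle
    · simp [excess_eq_zero hle]
    · simp [h t ht hle]
  -- The range of u(H) lies in the kernel that defines P(E), because the product of u with `excess
  -- E` is 0.
  have h2 : H.specProj E * H.apply u = H.apply u := by
    ext x
    refine (H.specProj_apply_eq_self_iff E _).2 ?_
    exact congrArg (fun A : V →L[ℂ] V => A x) h1
  rw [mul_sub, mul_one, ← (H.specProj_commute_apply E u).eq, h2, sub_self]

/-- On the range of 1 - P(E) the function f may be replaced by f(max t E), whose supremum over [0,∞)
is the supremum of f over [E,∞). -/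
theorem norm_apply_mul_one_sub_specProj_le (H : Hamiltonian V) {E : ℝ} (hE : 0 ≤ E)
    {f : ℝ → ℂ} (hf : VanishesAtTop f) {c : ℝ} (hc : 0 ≤ c) (h : ∀ t, E ≤ t → ‖f t‖ ≤ c) :
    ‖H.apply f * (1 - H.specProj E)‖ ≤ c := by
  have hg : VanishesAtTop fun t => f (max t E) := by
    refine ⟨hf.1.comp (by fun_prop) fun t _ => hE.trans (le_max_right _ _),
      hf.2.comp (tendsto_atTop_mono (fun t => le_max_left t E) tendsto_id)⟩
  have h1 : H.apply f * (1 - H.specProj E) =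
      H.apply (fun t => f (max t E)) * (1 - H.specProj E) := by
    rw [← sub_eq_zero, ← sub_mul, ← H.apply_sub hf hg]
    exact H.apply_mul_one_sub_specProj_eq_zero (hf.sub hg) fun t _ ht => by
      rw [max_eq_left ht, sub_self]
  rw [h1]
  calc _ ≤ ‖H.apply fun t => f (max t E)‖ * ‖1 - H.specProj E‖ := norm_mul_le _ _
    _ ≤ c * 1 := by
      gcongr
      · exact H.norm_apply_le hc fun t _ => h _ (le_max_right _ _)
      · exact H.norm_one_sub_specProj_le E
    _ = c := mul_one _

theorem specProj_mul_specProj_of_le (H : Hamiltonian V) {E F : ℝ} (h : E ≤ F) :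
    H.specProj F * H.specProj E = H.specProj E := by
  have h1 := H.apply_mul_specProj_eq_zero (E := E) (vanishesAtTop_excess F)
    fun t _ ht => by simp [excess_eq_zero (ht.trans h)]
  ext x
  refine (H.specProj_apply_eq_self_iff F _).2 ?_
  exact congrArg (fun A : V →L[ℂ] V => A x) h1

theorem specProj_mul_specProj_of_ge (H : Hamiltonian V) {E F : ℝ} (h : E ≤ F) :
    H.specProj E * H.specProj F = H.specProj E := by
  have h1 := congrArg star (H.specProj_mul_specProj_of_le h)
  simpa only [star_mul, ContinuousLinearMap.star_eq_adjoint, adjoint_specProj] using h1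

theorem norm_powNeg_mul_one_sub_specProj_le (H : Hamiltonian V) {E k : ℝ} (hE : 0 ≤ E)
    (hk : 0 < k) : ‖H.powNeg k * (1 - H.specProj E)‖ ≤ (1 + E) ^ (-k) := by
  refine H.norm_apply_mul_one_sub_specProj_le hE (vanishesAtTop_rpow_neg hk) (by positivity)
    fun t ht => ?_
  have : 0 ≤ t := hE.trans ht
  rw [Complex.norm_real, Real.norm_of_nonneg (by positivity)]
  exact Real.rpow_le_rpow_of_nonpos (by positivity) (by linarith) (by linarith)

/-- On the dense range of R the error is at most ‖y‖/(1+n) at the vector R y; the bound ‖1 - P(n)‖ ≤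
1 extends the convergence to all vectors. -/
theorem tendsto_specProj (H : Hamiltonian V) (x : V) :
    Tendsto (fun n : ℕ => H.specProj n x) atTop (𝓝 x) := by
  rw [Metric.tendsto_atTop]
  intro ε hε
  obtain ⟨y, hy⟩ := H.denseRange_resolvent.exists_dist_lt x (half_pos hε)
  have hlim : Tendsto (fun n : ℕ => (1 + (n : ℝ))⁻¹ * ‖y‖) atTop (𝓝 0) := by
    have h : Tendsto (fun n : ℕ => (1 + (n : ℝ))⁻¹) atTop (𝓝 0) :=
      tendsto_inv_atTop_zero.comp
        (tendsto_atTop_add_const_left _ 1 tendsto_natCast_atTop_atTop)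
    simpa using h.mul_const ‖y‖
  obtain ⟨N, hN⟩ := eventually_atTop.1 (hlim.eventually (gt_mem_nhds (half_pos hε)))
  refine ⟨N, fun n hn => ?_⟩
  have h1 : ‖(1 - H.specProj n) (H.resolvent y)‖ ≤ (1 + (n : ℝ))⁻¹ * ‖y‖ := by
    have hb := H.norm_powNeg_mul_one_sub_specProj_le (E := n) (Nat.cast_nonneg n) one_pos
    have hc : (1 - H.specProj n) * H.resolvent = H.powNeg 1 * (1 - H.specProj n) := by
      rw [← powNeg_one, sub_mul, mul_sub, one_mul, mul_one, (H.specProj_commute_powNeg _ _).eq]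
    rw [Real.rpow_neg_one, ← hc] at hb
    exact ((1 - H.specProj n) * H.resolvent).le_of_opNorm_le hb y
  have h2 : ‖(1 - H.specProj n) (x - H.resolvent y)‖ ≤ ‖x - H.resolvent y‖ := by
    simpa using (1 - H.specProj n).le_of_opNorm_le (H.norm_one_sub_specProj_le n)
      (x - H.resolvent y)
  have h3 : x - H.specProj n x =
      (1 - H.specProj n) (x - H.resolvent y) + (1 - H.specProj n) (H.resolvent y) := by
    rw [← map_add, sub_add_cancel]; rfl
  rw [dist_comm, dist_eq_norm, h3]
  rw [dist_eq_norm] at hy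
  linarith [norm_add_le ((1 - H.specProj n) (x - H.resolvent y))
    ((1 - H.specProj n) (H.resolvent y)), hN n hn]

end

end Hamiltonian

/-! ### Boundary values of analytic functions -/

/-- Smooth functions with compact support on the real line. -/
structure IsTest (f : ℝ → ℂ) : Prop where
  contDiff : ContDiff ℝ ((⊤ : ℕ∞) : WithTop ℕ∞) f
  compact : HasCompactSupport f

namespace IsTest

variable {f : ℝ → ℂ}

theorem deriv (hf : IsTest f) : IsTest (deriv f) :=
  ⟨(contDiff_infty_iff_deriv.1 hf.1).2, hf.2.deriv⟩

theorem iteratedDeriv (hf : IsTest f) (n : ℕ) : IsTest (iteratedDeriv n f) := by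
  induction n with
  | zero => rwa [iteratedDeriv_zero]
  | succ n ih => rw [iteratedDeriv_succ]; exact ih.deriv

theorem integrable (hf : IsTest f) : Integrable f :=
  hf.1.continuous.integrable_of_hasCompactSupport hf.2

theorem hasDerivAt (hf : IsTest f) (x : ℝ) : HasDerivAt f (_root_.deriv f x) x :=
  (hf.1.differentiable (by simp) x).hasDerivAt

end IsTest

theorem LineTest.isTest (f : LineTest) : IsTest f := ⟨f.contDiff, f.hasCompactSupport⟩

/-- `∫ f(x) G(x - i y) dx`. -/
noncomputable def lineIntegral (f : ℝ → ℂ) (G : ℂ → ℂ) (y : ℝ) : ℂ :=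
  ∫ x : ℝ, f x * G (x - I * y)

theorem im_ofReal_sub_I_mul (x y : ℝ) : ((x : ℂ) - I * y).im = -y := by simp

theorem integrable_mul_of_isTest {f : ℝ → ℂ} (hf : IsTest f) {G : ℂ → ℂ}
    (hG : DifferentiableOn ℂ G {z | z.im < 0}) {y : ℝ} (hy : 0 < y) :
    Integrable fun x : ℝ => f x * G (x - I * y) := by
  have hc : Continuous fun x : ℝ => G (x - I * y) :=
    hG.continuousOn.comp_continuous (by fun_prop) fun x => by
      rw [mem_ofPred_eq, im_ofReal_sub_I_mul]; linarith
  exact (hf.1.continuous.mul hc).integrable_of_hasCompactSupport hf.2.mul_right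

theorem norm_lineIntegral_le {f : ℝ → ℂ} (hf : IsTest f) {G : ℂ → ℂ} {y B : ℝ}
    (hB : ∀ x : ℝ, ‖G (x - I * y)‖ ≤ B) :
    ‖lineIntegral f G y‖ ≤ B * ∫ x : ℝ, ‖f x‖ := by
  rw [← integral_const_mul]
  refine norm_integral_le_of_norm_le (hf.integrable.norm.const_mul B)
    (Eventually.of_forall fun x => ?_)
  rw [norm_mul, mul_comm]
  exact mul_le_mul_of_nonneg_right (hB x) (norm_nonneg _)

/-- By analyticity, differentiating G(x - iy) in y is -i times differentiating it in x, and
integration by parts moves the derivative to f. So y-derivatives of the smeared function cost only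
derivatives of f, never powers of 1/y. -/
theorem hasDerivAt_lineIntegral {f : ℝ → ℂ} (hf : IsTest f) {G : ℂ → ℂ}
    (hG : DifferentiableOn ℂ G {z | z.im < 0}) {y : ℝ} (hy : 0 < y) :
    HasDerivAt (lineIntegral f G) (I * lineIntegral (deriv f) G y) y := by
  have hopen : IsOpen {z : ℂ | z.im < 0} := isOpen_lt Complex.continuous_im continuous_const
  have hG' : DifferentiableOn ℂ (deriv G) {z | z.im < 0} := hG.deriv hopen
  have hmem : ∀ (x : ℝ) {v : ℝ}, 0 < v → (x : ℂ) - I * v ∈ {z : ℂ | z.im < 0} := fun x v hv => by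
    rw [mem_ofPred_eq, im_ofReal_sub_I_mul]; linarith
  have hder : ∀ z ∈ {z : ℂ | z.im < 0}, HasDerivAt G (deriv G z) z := fun z hz =>
    (hG.differentiableAt (hopen.mem_nhds hz)).hasDerivAt
  have hcomp : IsCompact (tsupport f ×ˢ Icc (y / 2) (2 * y)) := hf.2.isCompact.prod isCompact_Icc
  obtain ⟨C, hC⟩ := hcomp.exists_bound_of_continuousOn
    (f := fun q : ℝ × ℝ => deriv G ((q.1 : ℂ) - I * q.2))
    (hG'.continuousOn.comp (by fun_prop) fun q hq => hmem _ (by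
      have := hq.2.1; linarith))
  have hC0 : 0 ≤ |C| := abs_nonneg C
  have hdx : ∀ x : ℝ, HasDerivAt (fun x : ℝ => G (x - I * y)) (deriv G (x - I * y)) x := by
    intro x
    have h1 : HasDerivAt (fun x : ℝ => (x : ℂ) - I * y) 1 x :=
      (Complex.ofRealCLM.hasDerivAt (x := x)).sub_const _
    have h2 := (hder _ (hmem x hy)).comp x h1
    rwa [mul_one] at h2
  have hdv : ∀ (x : ℝ) {v : ℝ}, 0 < v →
      HasDerivAt (fun v : ℝ => G (x - I * v)) (deriv G (x - I * v) * (-I)) v := by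
    intro x v hv
    have h1 : HasDerivAt (fun v : ℝ => (x : ℂ) - I * v) (-I) v := by
      simpa using ((Complex.ofRealCLM.hasDerivAt (x := v)).const_mul I).const_sub (x : ℂ)
    exact (hder _ (hmem x hv)).comp v h1
  have hG'i : Integrable fun x : ℝ => f x * deriv G (x - I * y) :=
    integrable_mul_of_isTest hf hG' hy
  have hpart : ∫ x : ℝ, f x * deriv G (x - I * y) = -∫ x : ℝ, deriv f x * G (x - I * y) :=
    integral_mul_deriv_eq_deriv_mul_of_integrable (fun x _ => hf.hasDerivAt x)
      (fun x _ => hdx x) hG'i (integrable_mul_of_isTest hf.deriv hG hy)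
      (integrable_mul_of_isTest hf hG hy)
  have hmain := (hasDerivAt_integral_of_dominated_loc_of_deriv_le (μ := volume)
    (F := fun (v : ℝ) (x : ℝ) => f x * G (x - I * v))
    (F' := fun (v : ℝ) (x : ℝ) => f x * (deriv G (x - I * v) * (-I)))
    (bound := fun x => ‖f x‖ * |C|) (s := Ioo (y / 2) (2 * y))
    (Ioo_mem_nhds (by linarith) (by linarith))
    (by
      filter_upwards [Ioi_mem_nhds hy] with v hv
      exact (integrable_mul_of_isTest hf hG hv).aestronglyMeasurable)
    (integrable_mul_of_isTest hf hG hy)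
    (by
      have h := hG'i.mul_const (-I)
      simp only [mul_assoc] at h
      exact h.aestronglyMeasurable)
    (Eventually.of_forall fun x v hv => by
      rw [norm_mul, norm_mul, norm_neg, norm_I, mul_one]
      by_cases hx : x ∈ tsupport f
      · exact mul_le_mul_of_nonneg_left
          ((hC (x, v) ⟨hx, Ioo_subset_Icc_self hv⟩).trans (le_abs_self C)) (norm_nonneg _)
      · simp [image_eq_zero_of_notMem_tsupport hx])
    (hf.integrable.norm.mul_const _)
    (Eventually.of_forall fun x v hv =>
      (hdv x (by have := hv.1; linarith)).const_mul (f x))).2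
  have hval : ∫ x : ℝ, f x * (deriv G (x - I * y) * (-I)) = I * lineIntegral (deriv f) G y := by
    unfold lineIntegral
    simp only [← mul_assoc]
    rw [integral_mul_const, hpart]
    ring
  rw [hval] at hmain
  exact hmain

/-- This is Taylor's formula with the expansion point y as the variable: the derivative of the sum
telescopes and only the top-order remainder term survives. -/
theorem hasDerivAt_taylor_lineIntegral {f : ℝ → ℂ} (hf : IsTest f) {G : ℂ → ℂ}
    (hG : DifferentiableOn ℂ G {z | z.im < 0}) (v : ℝ) (m : ℕ) {y : ℝ} (hy : 0 < y) :
    HasDerivAt (fun y : ℝ => ∑ n ∈ Finset.range (m + 1),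
        ((v - y : ℝ) : ℂ) ^ n / (n.factorial : ℂ) * I ^ n * lineIntegral (iteratedDeriv n f) G y)
      (((v - y : ℝ) : ℂ) ^ m / (m.factorial : ℂ) * I ^ (m + 1) *
        lineIntegral (iteratedDeriv (m + 1) f) G y) y := by
  have hd : ∀ n, HasDerivAt (lineIntegral (iteratedDeriv n f) G)
      (I * lineIntegral (iteratedDeriv (n + 1) f) G y) y := fun n => by
    rw [iteratedDeriv_succ]
    exact hasDerivAt_lineIntegral (hf.iteratedDeriv n) hG hy
  have hlin : HasDerivAt (fun y : ℝ => ((v - y : ℝ) : ℂ)) (-1) y := by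
    have h := ((hasDerivAt_id y).const_sub v).ofReal_comp
    simpa using h
  induction m with
  | zero => simpa using hd 0
  | succ m ih =>
    simp only [Finset.sum_range_succ _ (m + 1)]
    have h2 := (((hlin.pow (m + 1)).div_const ((m + 1).factorial : ℂ)).mul_const
      (I ^ (m + 1))).mul (hd (m + 1))
    refine (ih.add h2).congr_deriv ?_
    have hm : ((m : ℂ) + 1) ≠ 0 := by exact_mod_cast Nat.succ_ne_zero m
    have hm2 : (m.factorial : ℂ) ≠ 0 := by exact_mod_cast m.factorial_ne_zero
    simp only [Nat.factorial_succ, Nat.cast_mul, Nat.cast_add, Nat.cast_one, Pi.pow_apply,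
      add_tsub_cancel_right]
    field_simp
    ring

/-- A polynomially bounded analytic function has uniformly bounded smeared-out values near the
boundary. -/
theorem norm_lineIntegral_le_of_bound {f : ℝ → ℂ} (hf : IsTest f) {G : ℂ → ℂ}
    (hG : DifferentiableOn ℂ G {z | z.im < 0}) {M p y₀ : ℝ} (hM : 0 ≤ M) (hp : 0 ≤ p)
    (hy₀ : y₀ ≤ 1)
    (hb : ∀ x y : ℝ, 0 < y → y ≤ y₀ → ‖G (x - I * y)‖ ≤ M * y ^ (-p)) {m : ℕ} (hm : p ≤ m)
    {y : ℝ} (hy : 0 < y) (hyy : y ≤ y₀) :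
    ‖lineIntegral f G y‖ ≤
      M * y₀ ^ (-p) * ∑ n ∈ Finset.range (m + 2), ∫ x : ℝ, ‖iteratedDeriv n f x‖ := by
  have hy₀pos : 0 < y₀ := hy.trans_le hyy
  set N : ℕ → ℝ := fun n => ∫ x : ℝ, ‖iteratedDeriv n f x‖ with hN
  have hN0 : ∀ n, 0 ≤ N n := fun n => integral_nonneg fun x => norm_nonneg _
  have hI : ∀ n v, 0 < v → v ≤ y₀ →
      ‖lineIntegral (iteratedDeriv n f) G v‖ ≤ M * v ^ (-p) * N n := fun n v hv hv2 =>
    norm_lineIntegral_le (hf.iteratedDeriv n) fun x => hb x v hv hv2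
  -- J(v) is the Taylor polynomial about v evaluated at y. It equals the wanted integral at v = y
  -- and involves only the harmless height y₀ at v = y₀; its derivative in between is estimated
  -- next.
  set J : ℝ → ℂ := fun v => ∑ n ∈ Finset.range (m + 1),
    ((y - v : ℝ) : ℂ) ^ n / (n.factorial : ℂ) * I ^ n * lineIntegral (iteratedDeriv n f) G v
    with hJ
  have hone : (1 : ℝ) ≤ y₀ ^ (-p) :=
    Real.one_le_rpow_of_pos_of_le_one_of_nonpos hy₀pos hy₀ (by linarith)
  have hJy : J y = lineIntegral f G y := by
    rw [hJ]
    simp only [sub_self, Complex.ofReal_zero]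
    rw [Finset.sum_eq_single 0]
    · simp
    · intro n _ hn
      simp [hn]
    · simp
  have hfac : ∀ n : ℕ, ∀ r : ℝ, 0 ≤ r → r / (n.factorial : ℝ) ≤ r := fun n r hr =>
    div_le_self hr (by exact_mod_cast n.factorial_pos)
  have hterm : ∀ n : ℕ, ∀ v : ℝ, ‖((y - v : ℝ) : ℂ) ^ n / (n.factorial : ℂ)‖ ≤ |y - v| ^ n := by
    intro n v
    rw [norm_div, norm_pow, Complex.norm_real, Complex.norm_natCast, Real.norm_eq_abs]
    exact hfac _ _ (by positivity)
  have hdiff : ‖J y₀ - J y‖ ≤ M * N (m + 1) * (y₀ - y) := by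
    refine norm_image_sub_le_of_norm_deriv_le_segment'
      (f' := fun v => ((y - v : ℝ) : ℂ) ^ m / (m.factorial : ℂ) * I ^ (m + 1) *
        lineIntegral (iteratedDeriv (m + 1) f) G v) (fun v hv =>
        (hasDerivAt_taylor_lineIntegral hf hG y m (hy.trans_le hv.1)).hasDerivWithinAt)
        (fun v hv => ?_) y₀ ⟨hyy, le_rfl⟩
    have hv0 : 0 < v := hy.trans_le hv.1
    rw [norm_mul, norm_mul, norm_pow, norm_I, one_pow, mul_one]
    -- Since 0 < y ≤ v, the power (y - v)^m of the remainder is at most v^m, which compensates the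
    -- singularity v^{-p} because p ≤ m. This makes the estimate uniform as y → 0.
    have h1 : |y - v| ^ m ≤ v ^ m := by
      refine pow_le_pow_left₀ (abs_nonneg _) ?_ m
      rw [abs_sub_comm, abs_of_nonneg (by linarith [hv.1])]
      linarith
    have h2 : v ^ m * v ^ (-p) ≤ 1 := by
      rw [← Real.rpow_natCast, ← Real.rpow_add hv0]
      exact Real.rpow_le_one hv0.le (by linarith [hv.2]) (by linarith)
    calc _ ≤ |y - v| ^ m * (M * v ^ (-p) * N (m + 1)) :=
          mul_le_mul (hterm m v) (hI (m + 1) v hv0 hv.2.le) (norm_nonneg _) (by positivity)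
      _ ≤ v ^ m * (M * v ^ (-p) * N (m + 1)) := by
          refine mul_le_mul_of_nonneg_right h1 ?_
          have := hN0 (m + 1)
          positivity
      _ = (v ^ m * v ^ (-p)) * (M * N (m + 1)) := by ring
      _ ≤ 1 * (M * N (m + 1)) := by
          refine mul_le_mul_of_nonneg_right h2 ?_
          have := hN0 (m + 1)
          positivity
      _ = _ := one_mul _
  have hJ0 : ‖J y₀‖ ≤ ∑ n ∈ Finset.range (m + 1), M * y₀ ^ (-p) * N n := by
    refine norm_sum_le_of_le _ fun n _ => ?_
    rw [norm_mul, norm_mul, norm_pow, norm_I, one_pow, mul_one]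
    have h1 : |y - y₀| ^ n ≤ 1 := by
      refine pow_le_one₀ (abs_nonneg _) ?_
      rw [abs_sub_comm, abs_of_nonneg (by linarith)]
      linarith
    have h3 := hI n y₀ hy₀pos le_rfl
    calc _ ≤ 1 * (M * y₀ ^ (-p) * N n) :=
          mul_le_mul ((hterm n y₀).trans h1) h3 (norm_nonneg _) zero_le_one
      _ = _ := one_mul _
  have hlast : M * N (m + 1) * (y₀ - y) ≤ M * y₀ ^ (-p) * N (m + 1) := by
    have h0 : 0 ≤ M * N (m + 1) := mul_nonneg hM (hN0 _)
    calc M * N (m + 1) * (y₀ - y) ≤ M * N (m + 1) * 1 := by gcongr; linarith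
      _ ≤ M * N (m + 1) * y₀ ^ (-p) := by gcongr
      _ = _ := by ring
  rw [← hJy, Finset.sum_range_succ, mul_add, Finset.mul_sum]
  have h4 : ‖J y‖ ≤ ‖J y₀‖ + ‖J y₀ - J y‖ := by
    have h5 := norm_sub_le (J y₀) (J y₀ - J y)
    rwa [sub_sub_cancel] at h5
  linarith

/-- The y-derivative is, up to a factor i, the integral against f', which the preceding estimate
bounds uniformly near 0. Hence the smeared function is Lipschitz on (0,y₀] and has a limit at 0. -/
theorem exists_tendsto_lineIntegral {f : ℝ → ℂ} (hf : IsTest f) {G : ℂ → ℂ}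
    (hG : DifferentiableOn ℂ G {z | z.im < 0}) {M p y₀ : ℝ} (hM : 0 ≤ M) (hp : 0 ≤ p)
    (hy₀pos : 0 < y₀) (hy₀ : y₀ ≤ 1)
    (hb : ∀ x y : ℝ, 0 < y → y ≤ y₀ → ‖G (x - I * y)‖ ≤ M * y ^ (-p)) :
    ∃ b, IsBoundaryIntegral f G b := by
  obtain ⟨m, hm⟩ := exists_nat_ge p
  set B := M * y₀ ^ (-p) *
    ∑ n ∈ Finset.range (m + 2), ∫ x : ℝ, ‖iteratedDeriv n (deriv f) x‖ with hB
  have hlip : LipschitzOnWith B.toNNReal (lineIntegral f G) (Ioc 0 y₀) := by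
    refine (convex_Ioc 0 y₀).lipschitzOnWith_of_nnnorm_hasDerivWithin_le
      (fun y hy => (hasDerivAt_lineIntegral hf hG hy.1).hasDerivWithinAt) fun y hy => ?_
    rw [← NNReal.coe_le_coe, coe_nnnorm, norm_mul, norm_I, one_mul]
    exact (norm_lineIntegral_le_of_bound hf.deriv hG hM hp hy₀ hb hm hy.1 hy.2).trans
      (Real.le_coe_toNNReal _)
  have hcau : Cauchy (map (lineIntegral f G) (𝓝[>] 0)) :=
    (cauchy_nhds.mono nhdsWithin_le_nhds).map_of_le hlip.uniformContinuousOn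
      (le_principal_iff.2 (Ioc_mem_nhdsGT hy₀pos))
  exact cauchy_map_iff_exists_tendsto.1 hcau

theorem IsBoundaryIntegral.norm_le {f : ℝ → ℂ} (hf : IsTest f) {G : ℂ → ℂ}
    (hG : DifferentiableOn ℂ G {z | z.im < 0}) {M p y₀ : ℝ} (hM : 0 ≤ M) (hp : 0 ≤ p)
    (hy₀pos : 0 < y₀) (hy₀ : y₀ ≤ 1)
    (hb : ∀ x y : ℝ, 0 < y → y ≤ y₀ → ‖G (x - I * y)‖ ≤ M * y ^ (-p)) {m : ℕ} (hm : p ≤ m)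
    {b : ℂ} (h : IsBoundaryIntegral f G b) :
    ‖b‖ ≤ M * y₀ ^ (-p) *
      ∑ n ∈ Finset.range (m + 2), ∫ x : ℝ, ‖iteratedDeriv n f x‖ := by
  refine le_of_tendsto h.norm ?_
  filter_upwards [Ioc_mem_nhdsGT hy₀pos] with y hy
  exact norm_lineIntegral_le_of_bound hf hG hM hp hy₀ hb hm hy.1 hy.2

/-! ### Uniqueness and linearity of boundary integrals -/

theorem IsBoundaryIntegral.unique {f : ℝ → ℂ} {G : ℂ → ℂ} {b c : ℂ}
    (hb : IsBoundaryIntegral f G b) (hc : IsBoundaryIntegral f G c) : b = c :=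
  tendsto_nhds_unique hb hc

theorem IsBoundaryIntegral.add {f : ℝ → ℂ} (hf : IsTest f) {G F : ℂ → ℂ}
    (hG : DifferentiableOn ℂ G {z | z.im < 0}) (hF : DifferentiableOn ℂ F {z | z.im < 0})
    {b c : ℂ} (hb : IsBoundaryIntegral f G b) (hc : IsBoundaryIntegral f F c) :
    IsBoundaryIntegral f (G + F) (b + c) := by
  refine (Tendsto.add hb hc).congr' ?_
  filter_upwards [self_mem_nhdsWithin] with y hy
  rw [← integral_add (integrable_mul_of_isTest hf hG hy) (integrable_mul_of_isTest hf hF hy)]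
  simp [mul_add]

theorem IsBoundaryIntegral.const_mul {f : ℝ → ℂ} {G : ℂ → ℂ} {b : ℂ} (a : ℂ)
    (hb : IsBoundaryIntegral f G b) : IsBoundaryIntegral f (fun z => a * G z) (a * b) := by
  refine (Tendsto.const_mul a hb).congr fun y => ?_
  rw [← integral_const_mul]
  congr 1
  ext x
  ring

theorem IsBoundaryIntegral.sum {f : ℝ → ℂ} (hf : IsTest f) {ι : Type*} (s : Finset ι)
    {G : ι → ℂ → ℂ} (hG : ∀ i ∈ s, DifferentiableOn ℂ (G i) {z | z.im < 0}) {b : ι → ℂ}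
    (hb : ∀ i ∈ s, IsBoundaryIntegral f (G i) (b i)) :
    IsBoundaryIntegral f (fun z => ∑ i ∈ s, G i z) (∑ i ∈ s, b i) := by
  refine (tendsto_finsetSum s hb).congr' ?_
  filter_upwards [self_mem_nhdsWithin] with y hy
  rw [← integral_finsetSum s fun i hi => integrable_mul_of_isTest hf (hG i hi) hy]
  simp [Finset.mul_sum]

theorem IsBoundaryIntegral.add_test {f g : ℝ → ℂ} (hf : IsTest f) (hg : IsTest g) {G : ℂ → ℂ}
    (hG : DifferentiableOn ℂ G {z | z.im < 0}) {b c : ℂ} (hb : IsBoundaryIntegral f G b)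
    (hc : IsBoundaryIntegral g G c) : IsBoundaryIntegral (f + g) G (b + c) := by
  refine (Tendsto.add hb hc).congr' ?_
  filter_upwards [self_mem_nhdsWithin] with y hy
  rw [← integral_add (integrable_mul_of_isTest hf hG hy) (integrable_mul_of_isTest hg hG hy)]
  simp [add_mul]

theorem IsBoundaryIntegral.smul_test {f : ℝ → ℂ} {G : ℂ → ℂ} {b : ℂ} (a : ℂ)
    (hb : IsBoundaryIntegral f G b) : IsBoundaryIntegral (a • f) G (a * b) := by
  refine (Tendsto.const_mul a hb).congr fun y => ?_
  rw [← integral_const_mul]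
  simp [mul_assoc]

theorem IsBoundaryIntegral.congr {f : ℝ → ℂ} {F G : ℂ → ℂ} {b : ℂ}
    (hb : IsBoundaryIntegral f F b) (h : ∀ z : ℂ, z.im < 0 → F z = G z) :
    IsBoundaryIntegral f G b := by
  refine Tendsto.congr' ?_ hb
  filter_upwards [self_mem_nhdsWithin] with y hy
  have hy' : 0 < y := hy
  congr 1
  ext x
  rw [h _ (by rw [im_ofReal_sub_I_mul]; linarith)]

/-! ### Scaled Sobolev norms -/

theorem sobNorm_nonneg {d : ℝ} (hd : 0 < d) (m : ℕ) (f : ℝ → ℂ) : 0 ≤ sobNorm d m f := by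
  unfold sobNorm
  refine le_trans ?_ (Finset.le_sup' (fun n => d ^ n * ∫ x : ℝ, ‖iteratedDeriv n f x‖)
    (Finset.mem_range.2 (Nat.succ_pos m)))
  exact mul_nonneg (by positivity) (integral_nonneg fun x => norm_nonneg _)

theorem integral_norm_iteratedDeriv_le {d : ℝ} (hd : 0 < d) {m n : ℕ} (hn : n ≤ m) (f : ℝ → ℂ) :
    ∫ x : ℝ, ‖iteratedDeriv n f x‖ ≤ (d ^ n)⁻¹ * sobNorm d m f := by
  rw [← div_eq_inv_mul, le_div_iff₀' (by positivity)]
  exact Finset.le_sup' (fun n => d ^ n * ∫ x : ℝ, ‖iteratedDeriv n f x‖)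
    (Finset.mem_range.2 (Nat.lt_succ_of_le hn))

namespace Hamiltonian

section

/-! ### Normal functionals -/

theorem summable_norm_mul_norm {V : Type*} [NormedAddCommGroup V] {x y : ℕ → V} (hx : Summable fun n => ‖x n‖ ^ 2)
    (hy : Summable fun n => ‖y n‖ ^ 2) : Summable fun n => ‖x n‖ * ‖y n‖ :=
  Summable.of_nonneg_of_le (fun n => by positivity)
    (fun n => by nlinarith [sq_nonneg (‖x n‖ - ‖y n‖)]) (hx.add hy)

variable {V : Type*} [NormedAddCommGroup V] [InnerProductSpace ℂ V]

theorem norm_topology_le_ultraweak :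
    (inferInstance : TopologicalSpace (V →L[ℂ] V)) ≤ ultraweak V := by
  refine le_iInf fun p => continuous_iff_le_induced.1 ?_
  have hs := summable_norm_mul_norm p.2.1 p.2.2
  have hb : ∀ (A : V →L[ℂ] V) (n : ℕ),
      ‖inner ℂ (p.1.1 n) (A (p.1.2 n))‖ ≤ ‖A‖ * (‖p.1.1 n‖ * ‖p.1.2 n‖) := fun A n => by
    calc _ ≤ ‖p.1.1 n‖ * ‖A (p.1.2 n)‖ := norm_inner_le_norm _ _
      _ ≤ ‖p.1.1 n‖ * (‖A‖ * ‖p.1.2 n‖) := by gcongr; exact A.le_opNorm _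
      _ = _ := by ring
  have hsum : ∀ A : V →L[ℂ] V, Summable fun n => inner ℂ (p.1.1 n) (A (p.1.2 n)) := fun A =>
    Summable.of_norm_bounded (hs.mul_left ‖A‖) (hb A)
  let L : (V →L[ℂ] V) →ₗ[ℂ] ℂ :=
    { toFun := fun A => ∑' n, inner ℂ (p.1.1 n) (A (p.1.2 n))
      map_add' := fun A B => by
        rw [← (hsum A).tsum_add (hsum B)]
        simp
      map_smul' := fun c A => by
        rw [RingHom.id_apply, smul_eq_mul, ← tsum_mul_left]
        simp }
  exact (L.mkContinuous (∑' n, ‖p.1.1 n‖ * ‖p.1.2 n‖) fun A => by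
    rw [mul_comm, ← tsum_mul_left]
    exact tsum_of_norm_bounded (hs.mul_left ‖A‖).hasSum (hb A)).continuous

/-- An ultraweakly continuous functional is norm continuous. -/
theorem continuous_of_mem_normalFunctionals {σ : Module.Dual ℂ (V →L[ℂ] V)}
    (hσ : σ ∈ normalFunctionals V) : Continuous σ :=
  continuous_le_dom norm_topology_le_ultraweak hσ

theorem exists_norm_le_of_mem_normalFunctionals {σ : Module.Dual ℂ (V →L[ℂ] V)}
    (hσ : σ ∈ normalFunctionals V) : ∃ C, 0 ≤ C ∧ ∀ A, ‖σ A‖ ≤ C * ‖A‖ := by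
  let L : (V →L[ℂ] V) →L[ℂ] ℂ := ⟨σ, continuous_of_mem_normalFunctionals hσ⟩
  exact ⟨‖L‖, L.opNorm_nonneg, L.le_opNorm⟩

theorem vecFunctional_mem_normalFunctionals (x y : V) :
    vecFunctional x y ∈ normalFunctionals V := by
  have hs : ∀ z : V, Summable fun n => ‖(Pi.single 0 z : ℕ → V) n‖ ^ 2 := fun z =>
    summable_of_ne_finset_zero (s := {0}) fun n hn => by
      rw [Finset.mem_singleton] at hn
      simp [Pi.single_eq_of_ne hn]
  have h := continuous_iInf_dom (t₁ := fun p : {p : (ℕ → V) × (ℕ → V) //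
      (Summable fun n => ‖p.1 n‖ ^ 2) ∧ Summable fun n => ‖p.2 n‖ ^ 2} =>
    TopologicalSpace.induced
      (fun A : V →L[ℂ] V => ∑' n, inner ℂ (p.1.1 n) (A (p.1.2 n))) inferInstance)
    (i := ⟨(Pi.single 0 x, Pi.single 0 y), hs x, hs y⟩) continuous_induced_dom
  have h2 : ⇑(vecFunctional x y) = fun A : V →L[ℂ] V => ∑' n,
      inner ℂ ((Pi.single 0 x : ℕ → V) n) (A ((Pi.single 0 y : ℕ → V) n)) := by
    funext A
    rw [tsum_eq_single 0 fun n hn => by simp [Pi.single_eq_of_ne hn]]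
    simp [vecFunctional]
  change @Continuous _ _ (ultraweak V) _ (vecFunctional x y)
  rw [h2]
  exact h

/-- The functional `σ(S · T)`. -/
noncomputable def compress (σ : Module.Dual ℂ (V →L[ℂ] V)) (S T : V →L[ℂ] V) :
    Module.Dual ℂ (V →L[ℂ] V) :=
  σ ∘ₗ LinearMap.mulLeft ℂ S ∘ₗ LinearMap.mulRight ℂ T

theorem compress_apply (σ : Module.Dual ℂ (V →L[ℂ] V)) (S T A : V →L[ℂ] V) :
    compress σ S T A = σ (S * A * T) := by
  simp [compress, mul_assoc]

variable [CompleteSpace V]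

/-- In a defining functional S moves to the left vectors as its adjoint and T acts on the right
vectors; both new sequences are again square summable. -/
theorem continuous_ultraweak_mul_mul (S T : V →L[ℂ] V) :
    @Continuous _ _ (ultraweak V) (ultraweak V) fun A : V →L[ℂ] V => S * A * T := by
  have hs : ∀ (B : V →L[ℂ] V) {z : ℕ → V}, (Summable fun n => ‖z n‖ ^ 2) →
      Summable fun n => ‖B (z n)‖ ^ 2 := fun B z hz =>
    Summable.of_nonneg_of_le (fun n => by positivity) (fun n => by
      rw [← mul_pow]
      exact pow_le_pow_left₀ (norm_nonneg _) (B.le_opNorm _) 2) (hz.mul_left (‖B‖ ^ 2))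
  refine continuous_iInf_rng.2 fun p => continuous_induced_rng.2 ?_
  have h := continuous_iInf_dom (t₁ := fun p : {p : (ℕ → V) × (ℕ → V) //
      (Summable fun n => ‖p.1 n‖ ^ 2) ∧ Summable fun n => ‖p.2 n‖ ^ 2} =>
    TopologicalSpace.induced
      (fun A : V →L[ℂ] V => ∑' n, inner ℂ (p.1.1 n) (A (p.1.2 n))) inferInstance)
    (i := ⟨(fun n => ContinuousLinearMap.adjoint S (p.1.1 n), fun n => T (p.1.2 n)),
      hs _ p.2.1, hs _ p.2.2⟩) continuous_induced_dom
  convert h using 2 with A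
  refine tsum_congr fun n => ?_
  exact (ContinuousLinearMap.adjoint_inner_left S _ _).symm

theorem compress_mem_normalFunctionals {σ : Module.Dual ℂ (V →L[ℂ] V)}
    (hσ : σ ∈ normalFunctionals V) (S T : V →L[ℂ] V) :
    compress σ S T ∈ normalFunctionals V := by
  have h := @Continuous.comp _ _ _ (ultraweak V) (ultraweak V) _ _ _ hσ
    (continuous_ultraweak_mul_mul S T)
  change @Continuous _ _ (ultraweak V) _ (compress σ S T)
  convert h using 1
  funext A
  exact compress_apply σ S T A

/-! ### Estimates in terms of the energy norms -/

theorem norm_apply_le_lnorm (H : Hamiltonian V) {k : ℝ} {σ : Module.Dual ℂ (V →L[ℂ] V)}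
    (hσ : H.lnorm k σ < ⊤) (B : V →L[ℂ] V) :
    ‖σ B‖ ≤ (H.lnorm k σ).toReal * ‖H.powNeg k * B * H.powNeg k‖ := by
  set r := ‖H.powNeg k * B * H.powNeg k‖ with hr
  set N := (H.lnorm k σ).toReal with hN
  have hN0 : 0 ≤ N := ENNReal.toReal_nonneg
  -- Dividing B by r + ε instead of r normalises it even if r = 0.
  have key : ∀ ε : ℝ, 0 < ε → ‖σ B‖ ≤ N * (r + ε) := by
    intro ε hε
    have hpos : 0 < r + ε := by have := norm_nonneg (H.powNeg k * B * H.powNeg k); linarith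
    have h1 : ‖H.powNeg k * ((((r + ε)⁻¹ : ℝ) : ℂ) • B) * H.powNeg k‖ ≤ 1 := by
      rw [mul_smul_comm, smul_mul_assoc, norm_smul, Complex.norm_real, ← hr,
        Real.norm_of_nonneg (by positivity), inv_mul_le_one₀ hpos]
      linarith
    have h2 := le_iSup₂ (f := fun B (_ : ‖H.powNeg k * B * H.powNeg k‖ ≤ 1) => ‖σ B‖ₑ) _ h1
    have h3 := ENNReal.toReal_mono hσ.ne h2
    rw [toReal_enorm, map_smul, norm_smul, Complex.norm_real,
      Real.norm_of_nonneg (by positivity), inv_mul_le_iff₀ hpos] at h3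
    rwa [mul_comm]
  refine le_of_forall_pos_le_add fun δ hδ => ?_
  refine (key (δ / (N + 1)) (by positivity)).trans ?_
  rw [mul_add]
  have : N * (δ / (N + 1)) ≤ δ := by
    rw [mul_div_assoc', div_le_iff₀ (by positivity)]
    nlinarith
  linarith

theorem lnorm_le_ofReal (H : Hamiltonian V) {k C : ℝ} (hC : 0 ≤ C)
    {σ : Module.Dual ℂ (V →L[ℂ] V)}
    (h : ∀ B, ‖σ B‖ ≤ C * ‖H.powNeg k * B * H.powNeg k‖) :
    H.lnorm k σ ≤ ENNReal.ofReal C := by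
  refine iSup₂_le fun B hB => ?_
  rw [← ofReal_norm]
  exact ENNReal.ofReal_le_ofReal ((h B).trans (mul_le_of_le_one_right hC hB))

theorem norm_apply_le_dualNorm (H : Hamiltonian V) {k : ℝ} (hk : 0 < k)
    {φ : Module.Dual ℂ H.smoothFunctionals} (hφ : H.dualNorm k φ < ⊤)
    (σ : H.smoothFunctionals) :
    ‖φ σ‖ ≤ (H.dualNorm k φ).toReal * (H.lnorm k (σ : Module.Dual ℂ (V →L[ℂ] V))).toReal := by
  set r := (H.lnorm k (σ : Module.Dual ℂ (V →L[ℂ] V))).toReal with hr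
  set N := (H.dualNorm k φ).toReal with hN
  have hr0 : 0 ≤ r := ENNReal.toReal_nonneg
  have hN0 : 0 ≤ N := ENNReal.toReal_nonneg
  have hσ := σ.2.2 k hk
  have key : ∀ ε : ℝ, 0 < ε → ‖φ σ‖ ≤ N * (r + ε) := by
    intro ε hε
    have hpos : 0 < r + ε := by linarith
    have h1 : H.lnorm k (((((r + ε)⁻¹ : ℝ) : ℂ) • σ : H.smoothFunctionals) :
        Module.Dual ℂ (V →L[ℂ] V)) ≤ 1 := by
      rw [← ENNReal.ofReal_one]
      refine H.lnorm_le_ofReal zero_le_one fun B => ?_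
      rw [Submodule.coe_smul, LinearMap.smul_apply, norm_smul, Complex.norm_real,
        Real.norm_of_nonneg (by positivity), inv_mul_le_iff₀ hpos, one_mul]
      exact (H.norm_apply_le_lnorm hσ B).trans
        (mul_le_mul_of_nonneg_right (by linarith) (norm_nonneg _))
    have h2 := le_iSup₂ (f := fun (σ : H.smoothFunctionals) (_ : H.lnorm k σ ≤ 1) => ‖φ σ‖ₑ) _ h1
    have h3 := ENNReal.toReal_mono hφ.ne h2
    rw [toReal_enorm, map_smul, norm_smul, Complex.norm_real,
      Real.norm_of_nonneg (by positivity), inv_mul_le_iff₀ hpos] at h3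
    rwa [mul_comm]
  refine le_of_forall_pos_le_add fun δ hδ => ?_
  refine (key (δ / (N + 1)) (by positivity)).trans ?_
  rw [mul_add]
  have : N * (δ / (N + 1)) ≤ δ := by
    rw [mul_div_assoc', div_le_iff₀ (by positivity)]
    nlinarith
  linarith

theorem dualNorm_le_ofReal (H : Hamiltonian V) {k C : ℝ} (hC : 0 ≤ C)
    {φ : Module.Dual ℂ H.smoothFunctionals}
    (h : ∀ σ : H.smoothFunctionals,
      ‖φ σ‖ ≤ C * (H.lnorm k (σ : Module.Dual ℂ (V →L[ℂ] V))).toReal) :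
    H.dualNorm k φ ≤ ENNReal.ofReal C := by
  refine iSup₂_le fun σ hσ => ?_
  rw [← ofReal_norm]
  refine ENNReal.ofReal_le_ofReal ((h σ).trans (mul_le_of_le_one_right hC ?_))
  exact ENNReal.toReal_mono ENNReal.one_ne_top hσ

/-! ### Cut-off functions -/

/-- A continuous cut-off function that is `1` on `[0,E]` and `0` on `[E+1,∞)`. -/
noncomputable def cutoff (E t : ℝ) : ℝ := max 0 (1 - max 0 (t - E))

theorem cutoff_of_le {E t : ℝ} (h : t ≤ E) : cutoff E t = 1 := by
  simp [cutoff, max_eq_left (sub_nonpos.2 h)]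

theorem cutoff_of_ge {E t : ℝ} (h : E + 1 ≤ t) : cutoff E t = 0 := by
  unfold cutoff
  refine max_eq_left ?_
  have := le_max_right 0 (t - E)
  linarith

theorem cutoff_nonneg (E t : ℝ) : 0 ≤ cutoff E t := le_max_left _ _

theorem cutoff_le_one (E t : ℝ) : cutoff E t ≤ 1 :=
  max_le zero_le_one (by linarith [le_max_left 0 (t - E)])

theorem continuous_cutoff (E : ℝ) : Continuous (cutoff E) := by
  unfold cutoff
  fun_prop

theorem vanishesAtTop_mul_cutoff {f : ℝ → ℂ} (hf : ContinuousOn f (Ici 0)) (E : ℝ) :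
    VanishesAtTop fun t => f t * ((cutoff E t : ℝ) : ℂ) := by
  refine VanishesAtTop.of_eventually_zero
    (hf.mul (Complex.continuous_ofReal.comp (continuous_cutoff E)).continuousOn) ?_
  filter_upwards [eventually_ge_atTop (E + 1)] with t ht
  simp [cutoff_of_ge ht]

theorem continuousOn_rpow_one_add (s : ℝ) :
    ContinuousOn (fun t : ℝ => (((1 + t) ^ s : ℝ) : ℂ)) (Ici 0) := by
  refine Complex.continuous_ofReal.comp_continuousOn ?_
  refine ContinuousOn.rpow_const (by fun_prop) fun t ht => Or.inl ?_
  have : (0 : ℝ) ≤ t := ht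
  positivity

theorem resolvent_injective (H : Hamiltonian V) : Function.Injective H.resolvent := by
  refine (injective_iff_map_eq_zero _).2 fun z hz => ?_
  obtain ⟨x, rfl⟩ := H.onePlus_surjective z
  rw [resolvent_onePlus] at hz
  have : x = 0 := Subtype.ext hz
  rw [this, map_zero]

/-- The cut-off minus 1 vanishes on [0,E] but not at infinity, so the calculus applies only after
multiplication by (1+t)⁻¹. The resulting factor R is cancelled by injectivity. -/
theorem apply_cutoff_mul_specProj (H : Hamiltonian V) (E : ℝ) :
    H.apply (fun t => ((cutoff E t : ℝ) : ℂ)) * H.specProj E = H.specProj E := by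
  have hc : VanishesAtTop fun t => ((cutoff E t : ℝ) : ℂ) := by
    simpa using vanishesAtTop_mul_cutoff (f := fun _ => 1) continuousOn_const E
  have hr := vanishesAtTop_rpow_neg one_pos
  have h := H.apply_mul_specProj_eq_zero (E := E) ((hr.mul hc).sub hr) fun t _ ht => by
    simp [cutoff_of_le ht]
  rw [H.apply_sub (hr.mul hc) hr, H.apply_mul hr hc, sub_mul, sub_eq_zero] at h
  have h2 : H.resolvent * (H.apply (fun t => ((cutoff E t : ℝ) : ℂ)) * H.specProj E) =
      H.resolvent * H.specProj E := by
    rw [← powNeg_one, ← mul_assoc]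
    exact h
  ext x
  exact H.resolvent_injective (congrArg (fun A : V →L[ℂ] V => A x) h2)

/-- `(1 + H)^s P(E)` as a bounded operator. -/
noncomputable def powProj (H : Hamiltonian V) (s E : ℝ) : V →L[ℂ] V :=
  (H.apply fun t => (((1 + t) ^ s : ℝ) : ℂ) * ((cutoff E t : ℝ) : ℂ)) * H.specProj E

theorem powNeg_mul_powProj (H : Hamiltonian V) {s : ℝ} (hs : 0 < s) (E : ℝ) :
    H.powNeg s * H.powProj s E = H.specProj E := by
  unfold powProj
  rw [← mul_assoc]
  have h := vanishesAtTop_mul_cutoff (continuousOn_rpow_one_add s) E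
  have h2 : H.powNeg s * (H.apply fun t => (((1 + t) ^ s : ℝ) : ℂ) * ((cutoff E t : ℝ) : ℂ)) =
      H.apply (fun t => ((cutoff E t : ℝ) : ℂ)) := by
    unfold powNeg
    rw [← H.apply_mul (vanishesAtTop_rpow_neg hs) h]
    refine H.apply_congr fun t ht => ?_
    rw [← mul_assoc, ← Complex.ofReal_mul, ← Real.rpow_add (by positivity)]
    simp
  rw [h2, apply_cutoff_mul_specProj]

theorem powProj_mul_powNeg (H : Hamiltonian V) {s : ℝ} (hs : 0 < s) (E : ℝ) :
    H.powProj s E * H.powNeg s = H.specProj E := by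
  rw [← H.powNeg_mul_powProj hs E]
  unfold powProj
  rw [mul_assoc, (H.specProj_commute_powNeg E s).eq, ← mul_assoc, ← mul_assoc,
    (H.powNeg_commute_apply s _).eq]

/-! ### Energy-bounded functionals and their density -/

/-- P(E) absorbs every power of 1+H: with the bounded operator Q = (1+H)^k P(E) one has P(E) B P(E)
= Q (R^k B R^k) Q, so ‖σ‖_k is at most a multiple of ‖Q‖². -/
theorem mem_smoothFunctionals_of_energyBounded (H : Hamiltonian V) {E : ℝ}
    {σ : Module.Dual ℂ (V →L[ℂ] V)} (hσ : σ ∈ H.energyBounded E) :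
    σ ∈ H.smoothFunctionals := by
  obtain ⟨τ, hτ, h⟩ := hσ
  have hστ : σ = compress τ (H.specProj E) (H.specProj E) :=
    LinearMap.ext fun _ => by rw [h, compress_apply]
  refine ⟨hστ ▸ compress_mem_normalFunctionals hτ _ _, fun k hk => ?_⟩
  obtain ⟨C, hC0, hC⟩ := exists_norm_le_of_mem_normalFunctionals hτ
  have hQ := norm_nonneg (H.powProj k E)
  refine (H.lnorm_le_ofReal (C := C * (‖H.powProj k E‖ * ‖H.powProj k E‖)) (by positivity)
    fun B => ?_).trans_lt ENNReal.ofReal_lt_top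
  rw [h]
  have h1 : H.specProj E * B * H.specProj E =
      H.powProj k E * (H.powNeg k * B * H.powNeg k) * H.powProj k E := by
    nth_rewrite 1 [← H.powProj_mul_powNeg hk E]
    rw [← H.powNeg_mul_powProj hk E]
    simp only [mul_assoc]
  calc _ ≤ C * ‖H.specProj E * B * H.specProj E‖ := hC _
    _ ≤ C * (‖H.powProj k E‖ * ‖H.powNeg k * B * H.powNeg k‖ * ‖H.powProj k E‖) := by
      rw [h1]
      gcongr
      exact (norm_mul_le _ _).trans (mul_le_mul_of_nonneg_right (norm_mul_le _ _) hQ)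
    _ = _ := by ring

theorem energyBounded_apply_specProj (H : Hamiltonian V) {E : ℝ}
    {σ : Module.Dual ℂ (V →L[ℂ] V)} (hσ : σ ∈ H.energyBounded E) (B : V →L[ℂ] V) :
    σ (H.specProj E * B * H.specProj E) = σ B := by
  obtain ⟨τ, hτ, h⟩ := hσ
  rw [h, h]
  congr 1
  simp only [← mul_assoc, H.specProj_mul_self]
  rw [mul_assoc, H.specProj_mul_self]

theorem compress_mem_energyBounded (H : Hamiltonian V) {σ : Module.Dual ℂ (V →L[ℂ] V)}
    (hσ : σ ∈ normalFunctionals V) (E : ℝ) :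
    compress σ (H.specProj E) (H.specProj E) ∈ H.energyBounded E :=
  ⟨σ, hσ, fun _ => compress_apply _ _ _ _⟩

/-- Energy-bounded functionals are dense: a form in `C^∞(Σ)^*` is determined by them. -/
theorem eq_zero_of_forall_energyBounded (H : Hamiltonian V)
    {φ : Module.Dual ℂ H.smoothFunctionals} (hφ : φ ∈ H.smoothDual)
    (h : ∀ E : ℝ, 0 < E → ∀ σ : H.smoothFunctionals,
      (σ : Module.Dual ℂ (V →L[ℂ] V)) ∈ H.energyBounded E → φ σ = 0) : φ = 0 := by
  obtain ⟨k, hk, hfin⟩ := hφ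
  ext σ
  rw [LinearMap.zero_apply]
  have hk1 : 0 < k + 1 := by linarith
  set s := (H.lnorm (k + 1) (σ : Module.Dual ℂ (V →L[ℂ] V))).toReal with hs
  have hs0 : 0 ≤ s := ENNReal.toReal_nonneg
  set N := (H.dualNorm k φ).toReal with hN
  have hN0 : 0 ≤ N := ENNReal.toReal_nonneg
  have key : ∀ n : ℕ, ‖φ σ‖ ≤ N * (s * 2) * (1 + ((n : ℝ) + 1))⁻¹ := by
    intro n
    set E : ℝ := (n : ℝ) + 1 with hE
    have hE0 : 0 < E := by positivity
    set P := H.specProj E with hP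
    have hmem := H.compress_mem_energyBounded σ.2.1 E
    set σE : H.smoothFunctionals := ⟨_, H.mem_smoothFunctionals_of_energyBounded hmem⟩ with hσE
    have h0 : φ σ = φ (σ - σE) := by rw [map_sub, h E hE0 σE hmem, sub_zero]
    -- One spare power of R, available because σ also has finite norm of order k+1, yields the
    -- factor 1/(1+E) on the range of 1 - P.
    have hbound : H.lnorm k ((σ - σE : H.smoothFunctionals) : Module.Dual ℂ (V →L[ℂ] V)) ≤
        ENNReal.ofReal (s * 2 * (1 + E)⁻¹) := by
      refine H.lnorm_le_ofReal (by positivity) fun B => ?_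
      set C := H.powNeg k * B * H.powNeg k with hC
      have h1 : ((σ - σE : H.smoothFunctionals) : Module.Dual ℂ (V →L[ℂ] V)) B =
          (σ : Module.Dual ℂ (V →L[ℂ] V)) (B - P * B * P) := by
        rw [Submodule.coe_sub, LinearMap.sub_apply, map_sub, hσE]
        change _ - compress _ _ _ B = _
        rw [compress_apply]
      have hR := H.norm_powNeg_mul_one_sub_specProj_le hE0.le one_pos
      rw [Real.rpow_neg_one] at hR
      have hR2 : ‖(1 - P) * H.powNeg 1‖ ≤ (1 + E)⁻¹ := by
        have : (1 - P) * H.powNeg 1 = H.powNeg 1 * (1 - P) := by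
          rw [sub_mul, mul_sub, one_mul, mul_one, (H.specProj_commute_powNeg _ _).eq]
        rwa [this]
      -- This rests on C - P C P = (1 - P) C + P C (1 - P), so that each term has a factor 1 - P
      -- next to a power of R.
      have h2 : H.powNeg (k + 1) * (B - P * B * P) * H.powNeg (k + 1) =
          H.powNeg 1 * (1 - P) * C * H.powNeg 1 +
            H.powNeg 1 * (P * C) * ((1 - P) * H.powNeg 1) := by
        have e1 : H.powNeg (k + 1) = H.powNeg 1 * H.powNeg k := by
          rw [add_comm, H.powNeg_add one_pos hk]
        have e2 : H.powNeg (k + 1) = H.powNeg k * H.powNeg 1 := H.powNeg_add hk one_pos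
        have e3 : H.powNeg k * (P * B * P) * H.powNeg k = P * C * P := by
          have hcom := (H.specProj_commute_powNeg E k).eq
          calc H.powNeg k * (P * B * P) * H.powNeg k
              = (H.powNeg k * P) * B * (P * H.powNeg k) := by simp only [mul_assoc]
            _ = (P * H.powNeg k) * B * (H.powNeg k * P) := by rw [hcom]
            _ = P * C * P := by simp only [hC, mul_assoc]
        calc H.powNeg (k + 1) * (B - P * B * P) * H.powNeg (k + 1)
            = (H.powNeg 1 * H.powNeg k) * (B - P * B * P) * (H.powNeg k * H.powNeg 1) := by
              rw [← e1, ← e2]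
          _ = H.powNeg 1 * (C - H.powNeg k * (P * B * P) * H.powNeg k) * H.powNeg 1 := by
              rw [hC]; noncomm_ring
          _ = _ := by rw [e3]; noncomm_ring
      rw [h1]
      refine (H.norm_apply_le_lnorm (σ.2.2 (k + 1) hk1) _).trans ?_
      rw [← hs, h2]
      have hone := H.norm_powNeg_le one_pos
      have hPn := H.norm_specProj_le E
      have b1 : ‖H.powNeg 1 * (1 - P) * C * H.powNeg 1‖ ≤ (1 + E)⁻¹ * ‖C‖ * 1 :=
        (norm_mul_le _ _).trans (mul_le_mul ((norm_mul_le _ _).trans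
          (mul_le_mul_of_nonneg_right hR (norm_nonneg _))) hone (norm_nonneg _) (by positivity))
      have b2 : ‖H.powNeg 1 * (P * C) * ((1 - P) * H.powNeg 1)‖ ≤ 1 * (1 * ‖C‖) * (1 + E)⁻¹ :=
        (norm_mul_le _ _).trans (mul_le_mul ((norm_mul_le _ _).trans
          (mul_le_mul hone ((norm_mul_le _ _).trans
            (mul_le_mul_of_nonneg_right hPn (norm_nonneg _))) (norm_nonneg _) zero_le_one))
            hR2 (norm_nonneg _) (by positivity))
      calc _ ≤ s * ((1 + E)⁻¹ * ‖C‖ * 1 + 1 * (1 * ‖C‖) * (1 + E)⁻¹) := by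
            gcongr
            exact (norm_add_le _ _).trans (add_le_add b1 b2)
        _ = _ := by ring
    rw [h0]
    refine (H.norm_apply_le_dualNorm hk hfin _).trans ?_
    rw [mul_assoc N]
    refine mul_le_mul_of_nonneg_left ?_ hN0
    refine (ENNReal.toReal_mono ENNReal.ofReal_ne_top hbound).trans ?_
    rw [ENNReal.toReal_ofReal (by positivity)]
  have hlim : Tendsto (fun n : ℕ => N * (s * 2) * (1 + ((n : ℝ) + 1))⁻¹) atTop (𝓝 0) := by
    have h : Tendsto (fun n : ℕ => (1 + ((n : ℝ) + 1))⁻¹) atTop (𝓝 0) :=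
      tendsto_inv_atTop_zero.comp (tendsto_atTop_add_const_left _ 1
        (tendsto_atTop_add_const_right _ 1 tendsto_natCast_atTop_atTop))
    simpa using h.const_mul (N * (s * 2))
  exact norm_le_zero_iff.1 (ge_of_tendsto' hlim key)

end

end Hamiltonian

namespace Hamiltonian

section

variable {V : Type*} [NormedAddCommGroup V] [InnerProductSpace ℂ V] [CompleteSpace V]

/-! ### Smooth vectors -/

/-- The vectors in `C^∞(H) = ⋂_s (1 + H)^(-s) V`. -/
def IsSmooth (H : Hamiltonian V) (x : V) : Prop := ∀ s : ℝ, 0 < s → ∃ y, x = H.powNeg s y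

variable {H : Hamiltonian V}

theorem IsSmooth.add {x y : V} (hx : H.IsSmooth x) (hy : H.IsSmooth y) : H.IsSmooth (x + y) :=
  fun s hs => by
    obtain ⟨u, rfl⟩ := hx s hs
    obtain ⟨v, rfl⟩ := hy s hs
    exact ⟨u + v, (map_add _ _ _).symm⟩

theorem IsSmooth.smul {x : V} (hx : H.IsSmooth x) (c : ℂ) : H.IsSmooth (c • x) :=
  fun s hs => by
    obtain ⟨u, rfl⟩ := hx s hs
    exact ⟨c • u, (map_smul _ _ _).symm⟩

theorem IsSmooth.sub {x y : V} (hx : H.IsSmooth x) (hy : H.IsSmooth y) : H.IsSmooth (x - y) := by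
  simpa [sub_eq_add_neg] using hx.add (hy.smul (-1))

theorem IsSmooth.map {x : V} (hx : H.IsSmooth x) {A : V →L[ℂ] V}
    (hA : ∀ s, Commute A (H.powNeg s)) : H.IsSmooth (A x) := fun s hs => by
  obtain ⟨u, rfl⟩ := hx s hs
  exact ⟨A u, congrArg (fun B : V →L[ℂ] V => B u) (hA s).eq⟩

theorem isSmooth_apply (H : Hamiltonian V) {f : ℝ → ℂ}
    (hf : ∀ s : ℝ, 0 < s → VanishesAtTop fun t => f t * (((1 + t) ^ s : ℝ) : ℂ)) (x : V) :
    H.IsSmooth (H.apply f x) := fun s hs =>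
  ⟨H.apply (fun t => f t * (((1 + t) ^ s : ℝ) : ℂ)) x,
    congrArg (fun B : V →L[ℂ] V => B x) (H.apply_eq_powNeg_mul hs (hf s hs))⟩

theorem isSmooth_specProj (H : Hamiltonian V) (E : ℝ) (x : V) : H.IsSmooth (H.specProj E x) :=
  fun s hs => ⟨H.powProj s E x,
    (congrArg (fun B : V →L[ℂ] V => B x) (H.powNeg_mul_powProj hs E)).symm⟩

theorem IsSmooth.powNeg {x : V} (hx : H.IsSmooth x) (s : ℝ) : H.IsSmooth (H.powNeg s x) :=
  hx.map fun k => H.powNeg_commute s k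

theorem norm_vecFunctional_powNeg_le (H : Hamiltonian V) (ℓ : ℝ) (x y : V) (B : V →L[ℂ] V) :
    ‖vecFunctional (H.powNeg ℓ x) (H.powNeg ℓ y) B‖ ≤
      ‖x‖ * ‖y‖ * ‖H.powNeg ℓ * B * H.powNeg ℓ‖ := by
  have h : vecFunctional (H.powNeg ℓ x) (H.powNeg ℓ y) B =
      inner ℂ x ((H.powNeg ℓ * B * H.powNeg ℓ) y) := by
    change inner ℂ (H.powNeg ℓ x) (B (H.powNeg ℓ y)) = inner ℂ x (H.powNeg ℓ (B (H.powNeg ℓ y)))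
    rw [← ContinuousLinearMap.adjoint_inner_left (H.powNeg ℓ), adjoint_powNeg]
  rw [h]
  calc _ ≤ ‖x‖ * ‖(H.powNeg ℓ * B * H.powNeg ℓ) y‖ := norm_inner_le_norm _ _
    _ ≤ ‖x‖ * (‖H.powNeg ℓ * B * H.powNeg ℓ‖ * ‖y‖) := by
      gcongr
      exact ContinuousLinearMap.le_opNorm _ _
    _ = _ := by ring

theorem vecFunctional_mem_smoothFunctionals {x y : V} (hx : H.IsSmooth x) (hy : H.IsSmooth y) :
    vecFunctional x y ∈ H.smoothFunctionals := by
  refine ⟨vecFunctional_mem_normalFunctionals x y, fun k hk => ?_⟩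
  obtain ⟨u, rfl⟩ := hx k hk
  obtain ⟨v, rfl⟩ := hy k hk
  exact (H.lnorm_le_ofReal (by positivity) (H.norm_vecFunctional_powNeg_le k u v)).trans_lt
    ENNReal.ofReal_lt_top

/-! ### Elements of C^∞(Σ)^* as sesquilinear forms on smooth vectors -/

section

variable (φ : Module.Dual ℂ H.smoothFunctionals)

theorem form_eq {x y : V} (hx : H.IsSmooth x) (hy : H.IsSmooth y) :
    H.form φ x y = φ ⟨vecFunctional x y, vecFunctional_mem_smoothFunctionals hx hy⟩ :=
  dif_pos _

theorem form_add_left {x x' y : V} (hx : H.IsSmooth x) (hx' : H.IsSmooth x')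
    (hy : H.IsSmooth y) : H.form φ (x + x') y = H.form φ x y + H.form φ x' y := by
  rw [form_eq φ (hx.add hx') hy, form_eq φ hx hy, form_eq φ hx' hy, ← map_add]
  congr 1
  refine Subtype.ext (LinearMap.ext fun A => ?_)
  exact inner_add_left _ _ _

theorem form_add_right {x y y' : V} (hx : H.IsSmooth x) (hy : H.IsSmooth y)
    (hy' : H.IsSmooth y') : H.form φ x (y + y') = H.form φ x y + H.form φ x y' := by
  rw [form_eq φ hx (hy.add hy'), form_eq φ hx hy, form_eq φ hx hy', ← map_add]
  congr 1
  refine Subtype.ext (LinearMap.ext fun A => ?_)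
  exact (congrArg _ (map_add A _ _)).trans (inner_add_right _ _ _)

theorem form_smul_left {x y : V} (hx : H.IsSmooth x) (hy : H.IsSmooth y) (c : ℂ) :
    H.form φ (c • x) y = starRingEnd ℂ c * H.form φ x y := by
  rw [form_eq φ (hx.smul c) hy, form_eq φ hx hy, ← smul_eq_mul, ← map_smul]
  congr 1
  refine Subtype.ext (LinearMap.ext fun A => ?_)
  exact inner_smul_left _ _ _

theorem form_smul_right {x y : V} (hx : H.IsSmooth x) (hy : H.IsSmooth y) (c : ℂ) :
    H.form φ x (c • y) = c * H.form φ x y := by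
  rw [form_eq φ hx (hy.smul c), form_eq φ hx hy, ← smul_eq_mul, ← map_smul]
  congr 1
  refine Subtype.ext (LinearMap.ext fun A => ?_)
  exact (congrArg _ (map_smul A _ _)).trans (inner_smul_right _ _ _)

theorem form_sub_left {x x' y : V} (hx : H.IsSmooth x) (hx' : H.IsSmooth x')
    (hy : H.IsSmooth y) : H.form φ (x - x') y = H.form φ x y - H.form φ x' y := by
  have h := form_add_left φ (hx.sub hx') hx' hy
  rw [sub_add_cancel] at h
  rw [h, add_sub_cancel_right]

theorem form_sub_right {x y y' : V} (hx : H.IsSmooth x) (hy : H.IsSmooth y)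
    (hy' : H.IsSmooth y') : H.form φ x (y - y') = H.form φ x y - H.form φ x y' := by
  have h := form_add_right φ hx (hy.sub hy') hy'
  rw [sub_add_cancel] at h
  rw [h, add_sub_cancel_right]

variable {φ}

theorem norm_form_powNeg_le {ℓ : ℝ} (hℓ : 0 < ℓ) (hφ : H.dualNorm ℓ φ < ⊤) {x y : V}
    (hx : H.IsSmooth x) (hy : H.IsSmooth y) :
    ‖H.form φ (H.powNeg ℓ x) (H.powNeg ℓ y)‖ ≤ (H.dualNorm ℓ φ).toReal * (‖x‖ * ‖y‖) := by
  rw [form_eq φ (hx.powNeg ℓ) (hy.powNeg ℓ)]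
  refine (H.norm_apply_le_dualNorm hℓ hφ _).trans ?_
  gcongr
  have h := H.lnorm_le_ofReal (by positivity) (H.norm_vecFunctional_powNeg_le ℓ x y)
  refine (ENNReal.toReal_mono ENNReal.ofReal_ne_top h).trans ?_
  rw [ENNReal.toReal_ofReal (by positivity)]

theorem norm_form_powNeg_sub_le {ℓ : ℝ} (hℓ : 0 < ℓ) (hφ : H.dualNorm ℓ φ < ⊤) {x y x' y' : V}
    (hx : H.IsSmooth x) (hy : H.IsSmooth y) (hx' : H.IsSmooth x') (hy' : H.IsSmooth y') :
    ‖H.form φ (H.powNeg ℓ x) (H.powNeg ℓ y) - H.form φ (H.powNeg ℓ x') (H.powNeg ℓ y')‖ ≤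
      (H.dualNorm ℓ φ).toReal * (‖x - x'‖ * ‖y‖ + ‖x'‖ * ‖y - y'‖) := by
  have h : H.form φ (H.powNeg ℓ x) (H.powNeg ℓ y) - H.form φ (H.powNeg ℓ x') (H.powNeg ℓ y') =
      H.form φ (H.powNeg ℓ (x - x')) (H.powNeg ℓ y) +
        H.form φ (H.powNeg ℓ x') (H.powNeg ℓ (y - y')) := by
    rw [map_sub, map_sub, form_sub_left φ (hx.powNeg ℓ) (hx'.powNeg ℓ) (hy.powNeg ℓ),
      form_sub_right φ (hx'.powNeg ℓ) (hy.powNeg ℓ) (hy'.powNeg ℓ)]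
    ring
  rw [h, mul_add]
  exact (norm_add_le _ _).trans (add_le_add (norm_form_powNeg_le hℓ hφ (hx.sub hx') hy)
    (norm_form_powNeg_le hℓ hφ hx' (hy.sub hy')))

theorem norm_specProj_apply_le (H : Hamiltonian V) (E : ℝ) (x : V) : ‖H.specProj E x‖ ≤ ‖x‖ := by
  simpa using (H.specProj E).le_of_opNorm_le (H.norm_specProj_le E) x

/-- The bounded operator `(1 + H)^(-ℓ) φ (1 + H)^(-ℓ)`. -/
theorem exists_regularized {ℓ : ℝ} (hℓ : 0 < ℓ) (hφ : H.dualNorm ℓ φ < ⊤) :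
    ∃ A : V →L[ℂ] V, ‖A‖ ≤ (H.dualNorm ℓ φ).toReal ∧ ∀ x y : V, H.IsSmooth x → H.IsSmooth y →
      inner ℂ x (A y) = H.form φ (H.powNeg ℓ x) (H.powNeg ℓ y) := by
  set N := (H.dualNorm ℓ φ).toReal with hN
  have hN0 : 0 ≤ N := ENNReal.toReal_nonneg
  have hsm : ∀ (n : ℕ) (x : V), H.IsSmooth (H.powNeg ℓ (H.specProj n x)) := fun n x =>
    (H.isSmooth_specProj n x).powNeg ℓ
  -- The form has its meaning only on smooth vectors, so x and y are first projected by P(n). The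
  -- joint bound makes the values Cauchy in n, and the limit is a bounded sesquilinear form on all
  -- of V.
  let a : ℕ → V → V → ℂ := fun n x y =>
    H.form φ (H.powNeg ℓ (H.specProj n x)) (H.powNeg ℓ (H.specProj n y))
  have hcau : ∀ x y : V, CauchySeq fun n => a n x y := by
    intro x y
    have hx := (H.tendsto_specProj x).cauchySeq
    have hy := (H.tendsto_specProj y).cauchySeq
    rw [Metric.cauchySeq_iff] at hx hy ⊢
    intro ε hε
    have hδ : 0 < ε / ((N + 1) * (‖x‖ + ‖y‖ + 1)) := by positivity
    obtain ⟨N1, h1⟩ := hx _ hδ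
    obtain ⟨N2, h2⟩ := hy _ hδ
    refine ⟨max N1 N2, fun m hm n hn => ?_⟩
    have e1 := h1 m (le_of_max_le_left hm) n (le_of_max_le_left hn)
    have e2 := h2 m (le_of_max_le_right hm) n (le_of_max_le_right hn)
    rw [dist_eq_norm] at e1 e2 ⊢
    set δ := ε / ((N + 1) * (‖x‖ + ‖y‖ + 1)) with hδdef
    calc _ ≤ N * (‖H.specProj m x - H.specProj n x‖ * ‖H.specProj m y‖ +
          ‖H.specProj n x‖ * ‖H.specProj m y - H.specProj n y‖) :=
          norm_form_powNeg_sub_le hℓ hφ (H.isSmooth_specProj _ _) (H.isSmooth_specProj _ _)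
            (H.isSmooth_specProj _ _) (H.isSmooth_specProj _ _)
      _ ≤ N * (δ * ‖y‖ + ‖x‖ * δ) := by
          gcongr
          · exact H.norm_specProj_apply_le _ _
          · exact H.norm_specProj_apply_le _ _
      _ = δ * (N * (‖x‖ + ‖y‖)) := by ring
      _ < δ * ((N + 1) * (‖x‖ + ‖y‖ + 1)) := by
          gcongr ?_ * ?_
          nlinarith [norm_nonneg x, norm_nonneg y, mul_nonneg hN0 (norm_nonneg x),
            mul_nonneg hN0 (norm_nonneg y)]
      _ = ε := by rw [hδdef]; field_simp
  choose b hb using fun x y => cauchySeq_tendsto_of_complete (hcau x y)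
  have hbound : ∀ x y, ‖b x y‖ ≤ N * ‖x‖ * ‖y‖ := fun x y => by
    refine le_of_tendsto (hb x y).norm (Eventually.of_forall fun n => ?_)
    calc _ ≤ N * (‖H.specProj n x‖ * ‖H.specProj n y‖) :=
          norm_form_powNeg_le hℓ hφ (H.isSmooth_specProj _ _) (H.isSmooth_specProj _ _)
      _ ≤ N * (‖x‖ * ‖y‖) := by
          gcongr
          · exact H.norm_specProj_apply_le _ _
          · exact H.norm_specProj_apply_le _ _
      _ = _ := by ring
  let B : V →L⋆[ℂ] V →L[ℂ] ℂ := LinearMap.mkContinuous₂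
    (LinearMap.mk₂'ₛₗ (starRingEnd ℂ) (RingHom.id ℂ) b
      (fun x x' y => tendsto_nhds_unique (hb (x + x') y) (((hb x y).add (hb x' y)).congr
        fun n => by
          simp only [a, map_add]
          rw [form_add_left φ (hsm n x) (hsm n x') (hsm n y)]))
      (fun c x y => tendsto_nhds_unique (hb (c • x) y) (((hb x y).const_mul _).congr
        fun n => by
          simp only [a, map_smul]
          rw [form_smul_left φ (hsm n x) (hsm n y)]))
      (fun x y y' => tendsto_nhds_unique (hb x (y + y')) (((hb x y).add (hb x y')).congr
        fun n => by
          simp only [a, map_add]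
          rw [form_add_right φ (hsm n x) (hsm n y) (hsm n y')]))
      (fun c x y => tendsto_nhds_unique (hb x (c • y)) (((hb x y).const_mul _).congr
        fun n => by
          simp only [a, map_smul]
          rw [form_smul_right φ (hsm n x) (hsm n y)]; rfl))) N hbound
  -- The Riesz operator of B acts in the left argument of the inner product, so its adjoint is the
  -- operator that represents b on the right.
  have hA : ∀ x y : V, inner ℂ x
      (ContinuousLinearMap.adjoint (InnerProductSpace.continuousLinearMapOfBilin B) y) =
        b x y := fun x y => by
    rw [ContinuousLinearMap.adjoint_inner_right,
      InnerProductSpace.continuousLinearMapOfBilin_apply]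
    rfl
  refine ⟨ContinuousLinearMap.adjoint (InnerProductSpace.continuousLinearMapOfBilin B),
    ContinuousLinearMap.opNorm_le_of_re_inner_le hN0 fun x y hx hy => ?_, fun x y hx hy => ?_⟩
  · rw [← inner_re_symm, hA]
    refine (Complex.re_le_norm _).trans ((hbound y x).trans_eq ?_)
    rw [hx, hy, mul_one, mul_one]
  · rw [hA]
    refine tendsto_nhds_unique (hb x y) ?_
    rw [tendsto_iff_norm_sub_tendsto_zero]
    have hlim : Tendsto (fun n : ℕ => N * (‖H.specProj n x - x‖ * ‖H.specProj n y‖ +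
        ‖x‖ * ‖H.specProj n y - y‖)) atTop (𝓝 0) := by
      have l1 := tendsto_iff_norm_sub_tendsto_zero.1 (H.tendsto_specProj x)
      have l2 := tendsto_iff_norm_sub_tendsto_zero.1 (H.tendsto_specProj y)
      simpa using ((l1.mul (H.tendsto_specProj y).norm).add (l2.const_mul ‖x‖)).const_mul N
    refine squeeze_zero (fun n => norm_nonneg _) (fun n => ?_) hlim
    exact norm_form_powNeg_sub_le hℓ hφ (H.isSmooth_specProj _ _) (H.isSmooth_specProj _ _) hx hy

/-- Smooth vectors are dense, since they contain all P(n) x. Thus the operator obtained by choice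
from `exists_regularized` is unique, and so depends linearly on φ. -/
theorem eq_of_inner_smooth {A B : V →L[ℂ] V}
    (h : ∀ x y : V, H.IsSmooth x → H.IsSmooth y → inner ℂ x (A y) = inner ℂ x (B y)) :
    A = B := by
  ext y
  refine ext_inner_left ℂ fun x => ?_
  have h1 : ∀ C : V →L[ℂ] V, Tendsto (fun n : ℕ => (inner ℂ (H.specProj n x)
      (C (H.specProj n y)) : ℂ)) atTop (𝓝 (inner ℂ x (C y))) := fun C =>
    (H.tendsto_specProj x).inner ((C.continuous.tendsto y).comp (H.tendsto_specProj y))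
  refine tendsto_nhds_unique (h1 A) ((h1 B).congr fun n => ?_)
  exact (h _ _ (H.isSmooth_specProj _ _) (H.isSmooth_specProj _ _)).symm

end

/-- The linear map `φ ↦ (1 + H)^(-ℓ) φ (1 + H)^(-ℓ)` from `Σ_ℓ^*` to the bounded operators. -/
noncomputable def regularized (H : Hamiltonian V) {ℓ : ℝ} (hℓ : 0 < ℓ) :
    H.dualSpace ℓ →ₗ[ℂ] (V →L[ℂ] V) where
  toFun φ := (exists_regularized hℓ φ.2).choose
  map_add' φ ψ := by
    refine eq_of_inner_smooth (H := H) fun x y hx hy => ?_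
    rw [(exists_regularized hℓ (φ + ψ).2).choose_spec.2 x y hx hy, add_apply, inner_add_right,
      (exists_regularized hℓ φ.2).choose_spec.2 x y hx hy,
      (exists_regularized hℓ ψ.2).choose_spec.2 x y hx hy]
    simp only [form_eq _ (hx.powNeg ℓ) (hy.powNeg ℓ)]
    rfl
  map_smul' c φ := by
    refine eq_of_inner_smooth (H := H) fun x y hx hy => ?_
    rw [(exists_regularized hℓ (c • φ).2).choose_spec.2 x y hx hy, smul_apply, inner_smul_right,
      RingHom.id_apply, (exists_regularized hℓ φ.2).choose_spec.2 x y hx hy]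
    simp only [form_eq _ (hx.powNeg ℓ) (hy.powNeg ℓ)]
    rfl

theorem norm_regularized_le (H : Hamiltonian V) {ℓ : ℝ} (hℓ : 0 < ℓ) (φ : H.dualSpace ℓ) :
    ‖H.regularized hℓ φ‖ ≤ (H.dualNorm ℓ φ).toReal :=
  (exists_regularized hℓ φ.2).choose_spec.1

theorem inner_regularized (H : Hamiltonian V) {ℓ : ℝ} (hℓ : 0 < ℓ) (φ : H.dualSpace ℓ) {x y : V}
    (hx : H.IsSmooth x) (hy : H.IsSmooth y) :
    inner ℂ x (H.regularized hℓ φ y) = H.form φ (H.powNeg ℓ x) (H.powNeg ℓ y) :=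
  (exists_regularized hℓ φ.2).choose_spec.2 x y hx hy

/-- The bounded operator `S φ T` in terms of `(1 + H)^(-ℓ) φ (1 + H)^(-ℓ)`. -/
theorem sandwich_eq (H : Hamiltonian V) {ℓ : ℝ} (hℓ : 0 < ℓ) (φ : H.dualSpace ℓ)
    {S T S' T' : V →L[ℂ] V} (hS : ContinuousLinearMap.adjoint S =
      H.powNeg ℓ * ContinuousLinearMap.adjoint S') (hT : T = H.powNeg ℓ * T')
    (hS' : ∀ x, H.IsSmooth (ContinuousLinearMap.adjoint S' x)) (hT' : ∀ x, H.IsSmooth (T' x)) :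
    H.sandwich S φ T = S' * H.regularized hℓ φ * T' := by
  have hex : ∀ x y, inner ℂ x ((S' * H.regularized hℓ φ * T') y) =
      H.form φ (ContinuousLinearMap.adjoint S x) (T y) := fun x y => by
    rw [hS, hT]
    change inner ℂ x (S' (H.regularized hℓ φ (T' y))) =
      H.form φ (H.powNeg ℓ (ContinuousLinearMap.adjoint S' x)) (H.powNeg ℓ (T' y))
    rw [← ContinuousLinearMap.adjoint_inner_left, H.inner_regularized hℓ φ (hS' x) (hT' y)]
  have h : ∃ A : V →L[ℂ] V, ∀ x y, inner ℂ x (A y) =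
      H.form φ (ContinuousLinearMap.adjoint S x) (T y) := ⟨_, hex⟩
  rw [sandwich, dif_pos h]
  ext y
  refine ext_inner_left ℂ fun x => ?_
  rw [h.choose_spec, hex]

end

end Hamiltonian

/-! ### Decay of exponentials times powers -/

theorem VanishesAtTop.congr {f g : ℝ → ℂ} (hf : VanishesAtTop f) (h : ∀ t, 0 ≤ t → f t = g t) :
    VanishesAtTop g :=
  ⟨hf.1.congr fun t ht => (h t ht).symm, hf.2.congr' <| by
    filter_upwards [eventually_ge_atTop 0] with t ht using h t ht⟩

theorem vanishesAtTop_exp_mul_rpow {ζ : ℂ} (hζ : ζ.re < 0) (s : ℝ) :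
    VanishesAtTop fun t => Complex.exp (ζ * t) * (((1 + t) ^ s : ℝ) : ℂ) := by
  refine VanishesAtTop.of_norm_le
    (b := fun t => Real.exp (-ζ.re) * ((1 + t) ^ s * Real.exp (-(-ζ.re) * (1 + t))))
    ((by fun_prop : Continuous fun t : ℝ => Complex.exp (ζ * t)).continuousOn.mul
      (Hamiltonian.continuousOn_rpow_one_add s)) ?_ ?_
  · have h := (tendsto_rpow_mul_exp_neg_mul_atTop_nhds_zero s (-ζ.re) (by linarith)).comp
      (tendsto_atTop_add_const_left _ (1 : ℝ) tendsto_id)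
    simpa using h.const_mul (Real.exp (-ζ.re))
  · filter_upwards [eventually_ge_atTop 0] with t ht
    have h0 : 0 ≤ (1 + t) ^ s := by positivity
    rw [norm_mul, Complex.norm_real, Real.norm_of_nonneg h0, Complex.norm_exp,
      Complex.re_mul_ofReal, mul_left_comm, ← Real.exp_add, mul_comm]
    refine le_of_eq ?_
    congr 2
    ring

theorem vanishesAtTop_id_mul_exp {δ : ℝ} (hδ : 0 < δ) :
    VanishesAtTop fun t => (t : ℂ) * Complex.exp (-((δ : ℂ) * t)) := by
  refine VanishesAtTop.of_norm_le (b := fun t => t ^ (1 : ℝ) * Real.exp (-δ * t))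
    (by fun_prop) (tendsto_rpow_mul_exp_neg_mul_atTop_nhds_zero 1 δ hδ) ?_
  filter_upwards [eventually_ge_atTop 0] with t ht
  rw [norm_mul, Complex.norm_real, Real.norm_of_nonneg ht, Complex.norm_exp, Real.rpow_one]
  simp

namespace Hamiltonian

section

variable {V : Type*} [NormedAddCommGroup V] [InnerProductSpace ℂ V] [CompleteSpace V]

/-! ### Analytic families of operators -/

/-- The difference quotient converges in operator norm because the openness of U leaves room:
exp(ζ₀t) g(t) is exp(-2δt) times a bounded function. This controls the quadratic remainder |w|²
exp|w| with |w| ≤ δt, uniformly in t. -/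
theorem differentiableOn_apply_exp_mul (H : Hamiltonian V) {g : ℝ → ℂ} {U : Set ℂ}
    (hU : IsOpen U) (hg : ∀ ζ ∈ U, VanishesAtTop fun t => Complex.exp (ζ * t) * g t) :
    DifferentiableOn ℂ (fun ζ : ℂ => H.apply fun t => Complex.exp (ζ * t) * g t) U := by
  intro ζ₀ hζ₀
  obtain ⟨ε, hε, hball⟩ := Metric.isOpen_iff.1 hU ζ₀ hζ₀
  -- One δ pays for exp|w|, the other for the factor t².
  obtain ⟨δ, hδ, hδε⟩ : ∃ δ : ℝ, 0 < δ ∧ 2 * δ < ε := ⟨ε / 4, by positivity, by linarith⟩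
  have hshift : ζ₀ + ((2 * δ : ℝ) : ℂ) ∈ U := hball <| by
    rw [Metric.mem_ball, dist_eq_norm, add_sub_cancel_left, Complex.norm_real,
      Real.norm_of_nonneg (by positivity)]
    exact hδε
  have hf := hg _ hshift
  obtain ⟨C, hC0, hC⟩ := hf.exists_norm_le
  have hsplit : ∀ t : ℝ, Complex.exp (ζ₀ * t) * g t = Complex.exp (-(((2 * δ : ℝ) : ℂ) * t)) *
      (Complex.exp ((ζ₀ + ((2 * δ : ℝ) : ℂ)) * t) * g t) := fun t => by
    rw [← mul_assoc, ← Complex.exp_add]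
    congr 2
    ring
  have hD : VanishesAtTop fun t => (t : ℂ) * (Complex.exp (ζ₀ * t) * g t) :=
    ((vanishesAtTop_id_mul_exp (δ := 2 * δ) (by positivity)).mul hf).congr fun t _ => by
      rw [hsplit t]; ring
  have hder : HasDerivAt (fun ζ : ℂ => H.apply fun t => Complex.exp (ζ * t) * g t)
      (H.apply fun t => (t : ℂ) * (Complex.exp (ζ₀ * t) * g t)) ζ₀ := by
    rw [hasDerivAt_iff_isLittleO]
    refine Asymptotics.IsBigO.trans_isLittleO (g := fun ζ => ‖ζ - ζ₀‖ ^ 2) ?_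
      (Asymptotics.isLittleO_pow_sub_sub ζ₀ one_lt_two)
    refine Asymptotics.IsBigO.of_bound (C * (2 / δ ^ 2)) ?_
    filter_upwards [Metric.ball_mem_nhds ζ₀ hδ] with ζ hζ
    have hnear : ‖ζ - ζ₀‖ < δ := by rwa [← dist_eq_norm]
    have hζU : ζ ∈ U := hball (Metric.ball_subset_ball (by linarith) hζ)
    rw [← H.apply_sub (hg ζ hζU) (hg ζ₀ hζ₀), ← H.apply_const_mul _ hD,
      ← H.apply_sub ((hg ζ hζU).sub (hg ζ₀ hζ₀)) (hD.const_mul _), norm_pow, norm_norm]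
    refine H.norm_apply_le (by positivity) fun t ht => ?_
    set w : ℂ := (ζ - ζ₀) * t with hw
    have hwn : ‖w‖ = ‖ζ - ζ₀‖ * t := by
      rw [hw, norm_mul, Complex.norm_real, Real.norm_of_nonneg ht]
    have hrem : Complex.exp (ζ * t) * g t - Complex.exp (ζ₀ * t) * g t -
        (ζ - ζ₀) * ((t : ℂ) * (Complex.exp (ζ₀ * t) * g t)) =
        Complex.exp (-(((2 * δ : ℝ) : ℂ) * t)) *
          (Complex.exp ((ζ₀ + ((2 * δ : ℝ) : ℂ)) * t) * g t) * (Complex.exp w - 1 - w) := by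
      rw [← hsplit t]
      have : Complex.exp (ζ * t) = Complex.exp (ζ₀ * t) * Complex.exp w := by
        rw [← Complex.exp_add]
        congr 1
        rw [hw]
        ring
      rw [this, hw]
      ring
    have hexp : ‖Complex.exp w - 1 - w‖ ≤ ‖w‖ ^ 2 * Real.exp ‖w‖ := by
      have h := Complex.norm_exp_sub_sum_le_norm_mul_exp w 2
      simpa [Finset.sum_range_succ, sub_sub] using h
    have hquad : t ^ 2 * Real.exp (-(δ * t)) ≤ 2 / δ ^ 2 := by
      have h := Real.quadratic_le_exp_of_nonneg (x := δ * t) (by positivity)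
      have h2 : (δ * t) ^ 2 / 2 ≤ Real.exp (δ * t) := by nlinarith [mul_nonneg hδ.le ht]
      rw [Real.exp_neg, ← div_eq_mul_inv, div_le_div_iff₀ (Real.exp_pos _) (by positivity)]
      nlinarith
    have he1 : ‖Complex.exp (-(((2 * δ : ℝ) : ℂ) * t))‖ = Real.exp (-(2 * δ * t)) := by
      rw [Complex.norm_exp, Complex.neg_re, ← Complex.ofReal_mul, Complex.ofReal_re]
    rw [hrem, norm_mul, norm_mul, he1]
    have hle : ‖w‖ ≤ δ * t := by rw [hwn]; gcongr
    calc _ ≤ Real.exp (-(2 * δ * t)) * C * (‖w‖ ^ 2 * Real.exp (δ * t)) := by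
          gcongr
          · exact hC t ht
          · exact hexp.trans (by gcongr)
      _ = C * (t ^ 2 * (Real.exp (-(2 * δ * t)) * Real.exp (δ * t))) * ‖ζ - ζ₀‖ ^ 2 := by
          rw [hwn]; ring
      _ = C * (t ^ 2 * Real.exp (-(δ * t))) * ‖ζ - ζ₀‖ ^ 2 := by
          rw [← Real.exp_add]; ring_nf
      _ ≤ _ := by gcongr
  exact hder.differentiableAt.differentiableWithinAt

/-- `(1 + H)^ℓ exp(i z H / 2)`, cut off at the energy `E + 1`. -/
noncomputable def lowOp (H : Hamiltonian V) (ℓ E : ℝ) (z : ℂ) : V →L[ℂ] V :=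
  H.apply fun t => Complex.exp (I * z / 2 * t) *
    ((((1 + t) ^ ℓ : ℝ) : ℂ) * ((cutoff E t : ℝ) : ℂ))

/-- `(1 + H)^ℓ exp(-i z H / 2)` for `Im z < 0`. -/
noncomputable def decayOp (H : Hamiltonian V) (ℓ : ℝ) (z : ℂ) : V →L[ℂ] V :=
  H.apply fun t => Complex.exp (-(I * z / 2) * t) * (((1 + t) ^ ℓ : ℝ) : ℂ)

theorem vanishesAtTop_low (ℓ E : ℝ) (ζ : ℂ) :
    VanishesAtTop fun t => Complex.exp (ζ * t) *
      ((((1 + t) ^ ℓ : ℝ) : ℂ) * ((cutoff E t : ℝ) : ℂ)) :=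
  (vanishesAtTop_mul_cutoff (((by fun_prop : Continuous fun t : ℝ =>
    Complex.exp (ζ * t)).continuousOn.mul (continuousOn_rpow_one_add ℓ))) E).congr
      fun t _ => mul_assoc _ _ _

theorem re_I_mul_half (z : ℂ) : (I * z / 2).re = -z.im / 2 := by simp

theorem re_neg_I_mul_half (z : ℂ) : (-(I * z / 2)).re = z.im / 2 := by
  rw [Complex.neg_re, re_I_mul_half]
  ring

theorem vanishesAtTop_decay (ℓ : ℝ) {z : ℂ} (hz : z.im < 0) :
    VanishesAtTop fun t => Complex.exp (-(I * z / 2) * t) * (((1 + t) ^ ℓ : ℝ) : ℂ) :=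
  vanishesAtTop_exp_mul_rpow (by rw [re_neg_I_mul_half]; linarith) ℓ

theorem differentiable_lowOp (H : Hamiltonian V) (ℓ E : ℝ) : Differentiable ℂ (H.lowOp ℓ E) := by
  have h := H.differentiableOn_apply_exp_mul isOpen_univ
    (fun ζ _ => vanishesAtTop_low ℓ E ζ)
  rw [differentiableOn_univ] at h
  exact h.comp (by fun_prop : Differentiable ℂ fun z : ℂ => I * z / 2)

theorem differentiableOn_decayOp (H : Hamiltonian V) (ℓ : ℝ) :
    DifferentiableOn ℂ (H.decayOp ℓ) {z | z.im < 0} := by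
  have h := H.differentiableOn_apply_exp_mul (U := {ζ | ζ.re < 0})
    (isOpen_lt Complex.continuous_re continuous_const)
    (fun ζ hζ => vanishesAtTop_exp_mul_rpow hζ ℓ)
  refine h.comp ((by fun_prop : Differentiable ℂ fun z : ℂ => -(I * z / 2)).differentiableOn)
    fun z hz => ?_
  have hz' : z.im < 0 := hz
  rw [mem_ofPred_eq, re_neg_I_mul_half]
  linarith

/-- The exponential growth in E enters here: the cut-off confines t to [0,E+1]. It stays bounded
only as long as -Im z is of order 1/E. -/
theorem norm_lowOp_le (H : Hamiltonian V) {ℓ E : ℝ} (hℓ : 0 < ℓ) (hE : 0 ≤ E) {z : ℂ}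
    (hz : z.im ≤ 0) : ‖H.lowOp ℓ E z‖ ≤ Real.exp (-z.im / 2 * (E + 1)) * (E + 2) ^ ℓ := by
  refine H.norm_apply_le (by positivity) fun t ht => ?_
  have h0 : 0 ≤ (1 + t) ^ ℓ := by positivity
  rw [norm_mul, norm_mul, Complex.norm_exp, Complex.re_mul_ofReal, re_I_mul_half,
    Complex.norm_real, Complex.norm_real, Real.norm_of_nonneg h0,
    Real.norm_of_nonneg (cutoff_nonneg E t)]
  rcases le_total t (E + 1) with h | h
  · have h1 : (1 + t) ^ ℓ * cutoff E t ≤ (E + 2) ^ ℓ * 1 := by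
      refine mul_le_mul (Real.rpow_le_rpow (by positivity) (by linarith) hℓ.le)
        (cutoff_le_one E t) (cutoff_nonneg E t) (by positivity)
    rw [mul_one] at h1
    refine mul_le_mul (Real.exp_le_exp.2 ?_) h1
      (mul_nonneg h0 (cutoff_nonneg E t)) (Real.exp_pos _).le
    exact mul_le_mul_of_nonneg_left h (by linarith)
  · rw [cutoff_of_ge h, mul_zero, mul_zero]
    positivity

theorem norm_decayOp_le (H : Hamiltonian V) {ℓ : ℝ} (hℓ : 0 < ℓ) {z : ℂ}
    (hz : z.im < 0) (hz1 : -1 ≤ z.im) :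
    ‖H.decayOp ℓ z‖ ≤ (2 * ℓ) ^ ℓ * Real.exp 1 * (-z.im) ^ (-ℓ) := by
  have hy : 0 < -z.im := by linarith
  refine H.norm_apply_le (by positivity) fun t ht => ?_
  have h0 : 0 ≤ (1 + t) ^ ℓ := by positivity
  rw [norm_mul, Complex.norm_exp, Complex.re_mul_ofReal, re_neg_I_mul_half,
    Complex.norm_real, Real.norm_of_nonneg h0]
  set y := -z.im with hydef
  have hzy : z.im / 2 * t = -(y * t / 2) := by rw [hydef]; ring
  rw [hzy]
  -- This is x ≤ exp x at x = y(1+t)/(2ℓ), chosen so that its ℓ-th power produces exp(y(1+t)/2),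
  -- which the damping factor cancels up to exp(y/2) ≤ e.
  have h1 : (1 + t) ≤ (2 * ℓ / y) * Real.exp (y * (1 + t) / 2 / ℓ) := by
    have h := Real.add_one_le_exp (y * (1 + t) / 2 / ℓ)
    have h2 : y * (1 + t) / 2 / ℓ ≤ Real.exp (y * (1 + t) / 2 / ℓ) := by linarith
    calc (1 + t) = (2 * ℓ / y) * (y * (1 + t) / 2 / ℓ) := by field_simp
      _ ≤ _ := by gcongr
  have h2 : (1 + t) ^ ℓ ≤ (2 * ℓ) ^ ℓ * y ^ (-ℓ) * Real.exp (y * (1 + t) / 2) := by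
    refine (Real.rpow_le_rpow (by positivity) h1 hℓ.le).trans_eq ?_
    rw [Real.mul_rpow (by positivity) (Real.exp_pos _).le, Real.div_rpow (by positivity) hy.le,
      ← Real.exp_mul, Real.rpow_neg hy.le, div_mul_cancel₀ _ hℓ.ne']
    rfl
  calc Real.exp (-(y * t / 2)) * (1 + t) ^ ℓ
      ≤ Real.exp (-(y * t / 2)) * ((2 * ℓ) ^ ℓ * y ^ (-ℓ) * Real.exp (y * (1 + t) / 2)) := by
        gcongr
    _ = (2 * ℓ) ^ ℓ * y ^ (-ℓ) * Real.exp (y / 2) := by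
        rw [mul_left_comm, ← Real.exp_add]
        ring_nf
    _ ≤ (2 * ℓ) ^ ℓ * y ^ (-ℓ) * Real.exp 1 := by
        gcongr
        linarith
    _ = _ := by ring

/-! ### The correlation function through bounded operators -/

/-- The operator `(1 + H)^(2ℓ) exp(-i z H)` between two regularized fields, with cut-off outer
factors. -/
noncomputable def kernelOp (H : Hamiltonian V) {ℓ : ℝ} (hℓ : 0 < ℓ) (E F : ℝ)
    (φ φ' : H.dualSpace ℓ) (z : ℂ) : V →L[ℂ] V :=
  H.lowOp ℓ E z * H.regularized hℓ φ * H.decayOp ℓ z *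
    (H.decayOp ℓ z * H.regularized hℓ φ' * H.lowOp ℓ F z)

theorem differentiableOn_kernelOp (H : Hamiltonian V) {ℓ : ℝ} (hℓ : 0 < ℓ) (E F : ℝ)
    (φ φ' : H.dualSpace ℓ) : DifferentiableOn ℂ (H.kernelOp hℓ E F φ φ') {z | z.im < 0} := by
  have h1 := (H.differentiable_lowOp ℓ E).differentiableOn (s := {z | z.im < 0})
  have h2 := (H.differentiable_lowOp ℓ F).differentiableOn (s := {z | z.im < 0})
  have h3 := H.differentiableOn_decayOp ℓ
  exact ((h1.mul_const _).mul h3).mul ((h3.mul_const _).mul h2)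

theorem norm_kernelOp_le (H : Hamiltonian V) {ℓ : ℝ} (hℓ : 0 < ℓ) {E F : ℝ} (hE : 0 ≤ E)
    (hF : 0 ≤ F) (φ φ' : H.dualSpace ℓ) {z : ℂ} (hz : z.im < 0) (hz1 : -1 ≤ z.im) :
    ‖H.kernelOp hℓ E F φ φ' z‖ ≤
      (Real.exp (-z.im / 2 * (E + 1)) * (E + 2) ^ ℓ) *
      (Real.exp (-z.im / 2 * (F + 1)) * (F + 2) ^ ℓ) *
      ((2 * ℓ) ^ ℓ * Real.exp 1) ^ 2 * (-z.im) ^ (-(2 * ℓ)) *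
      ((H.dualNorm ℓ φ).toReal * (H.dualNorm ℓ φ').toReal) := by
  have hy : 0 < -z.im := by linarith
  have a1 := H.norm_lowOp_le hℓ hE hz.le
  have a2 := H.norm_lowOp_le hℓ hF hz.le
  have a3 := H.norm_decayOp_le hℓ hz hz1
  have a4 := H.norm_regularized_le hℓ φ
  have a5 := H.norm_regularized_le hℓ φ'
  have hpow : (-z.im) ^ (-(2 * ℓ)) = (-z.im) ^ (-ℓ) * (-z.im) ^ (-ℓ) := by
    rw [← Real.rpow_add hy]; ring_nf
  have b1 := (norm_mul_le (H.lowOp ℓ E z * H.regularized hℓ φ) (H.decayOp ℓ z)).trans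
    (mul_le_mul ((norm_mul_le _ _).trans (mul_le_mul a1 a4 (norm_nonneg _) (by positivity)))
      a3 (norm_nonneg _) (by positivity))
  have b2 := (norm_mul_le (H.decayOp ℓ z * H.regularized hℓ φ') (H.lowOp ℓ F z)).trans
    (mul_le_mul ((norm_mul_le _ _).trans (mul_le_mul a3 a5 (norm_nonneg _) (by positivity)))
      a2 (norm_nonneg _) (by positivity))
  refine ((norm_mul_le _ _).trans (mul_le_mul b1 b2 (norm_nonneg _) (by positivity))).trans_eq ?_
  rw [hpow]
  ring

theorem conj_I_mul_half (z : ℂ) (t : ℝ) :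
    (starRingEnd ℂ) (I * z / 2 * t) = I * -(starRingEnd ℂ) z * t / 2 := by
  simp only [map_mul, map_div₀, conj_I, map_ofNat, Complex.conj_ofReal]
  ring

/-- Each exponential is written as (1+H)^{-ℓ} times `lowOp` or `decayOp`, and the powers regularize
the fields, so that both `sandwich` operators are products of bounded operators. On the left, the
adjoint turns the parameter -z̄ back into z. -/
theorem corr_eq (H : Hamiltonian V) {ℓ : ℝ} (hℓ : 0 < ℓ) (E : ℝ)
    (σ : Module.Dual ℂ (V →L[ℂ] V)) (φ φ' : H.dualSpace ℓ) {z : ℂ} (hz : z.im < 0) :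
    H.corr E σ φ φ' z =
      σ (H.specProj E * H.kernelOp hℓ E E φ φ' z * H.specProj E) := by
  have hcomm : ∀ (A : V →L[ℂ] V) (f : ℝ → ℂ), A = H.apply f → ∀ s, Commute A (H.powNeg s) :=
    fun A f hA s => by rw [hA]; exact H.apply_commute _ _
  have hlow : ∀ w : ℂ, H.expLow E w = H.powNeg ℓ * (H.lowOp ℓ E w * H.specProj E) := fun w => by
    unfold expLow lowOp
    rw [← mul_assoc]
    congr 1
    have hv : VanishesAtTop fun t : ℝ => Complex.exp (I * w * t / 2) *
        ((max 0 (1 - max 0 (t - E)) : ℝ) : ℂ) * (((1 + t) ^ ℓ : ℝ) : ℂ) :=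
      (vanishesAtTop_low ℓ E (I * w / 2)).congr fun t _ => by
        rw [cutoff]; ring_nf
    rw [H.apply_eq_powNeg_mul hℓ hv]
    congr 1
    exact H.apply_congr fun t _ => by rw [cutoff]; ring_nf
  have hadjlow : ContinuousLinearMap.adjoint (H.lowOp ℓ E z) =
      H.lowOp ℓ E (-(starRingEnd ℂ) z) := by
    unfold lowOp
    rw [adjoint_apply]
    refine H.apply_congr fun t _ => ?_
    rw [← starRingEnd_apply, map_mul, map_mul, Complex.conj_ofReal, Complex.conj_ofReal,
      ← Complex.exp_conj, conj_I_mul_half]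
    ring_nf
  have hdec : H.expDecay z = H.powNeg ℓ * H.decayOp ℓ z := by
    unfold expDecay decayOp
    have hv : VanishesAtTop fun t : ℝ => Complex.exp (-(I * z * t / 2)) *
        (((1 + t) ^ ℓ : ℝ) : ℂ) :=
      (vanishesAtTop_decay ℓ hz).congr fun t _ => by ring_nf
    rw [H.apply_eq_powNeg_mul hℓ hv]
    congr 1
    exact H.apply_congr fun t _ => by ring_nf
  have hvs : ∀ s : ℝ, VanishesAtTop fun t => Complex.exp (-(I * z / 2) * t) *
      (((1 + t) ^ ℓ : ℝ) : ℂ) * (((1 + t) ^ s : ℝ) : ℂ) := fun s =>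
    (vanishesAtTop_decay (ℓ + s) hz).congr fun t ht => by
      rw [Real.rpow_add (by positivity), Complex.ofReal_mul, mul_assoc]
  have hleft : H.sandwich (ContinuousLinearMap.adjoint (H.expLow E (-(starRingEnd ℂ) z))) φ
      (H.expDecay z) = H.specProj E * H.lowOp ℓ E z * H.regularized hℓ φ * H.decayOp ℓ z := by
    have hadj : ContinuousLinearMap.adjoint (H.specProj E * H.lowOp ℓ E z) =
        H.lowOp ℓ E (-(starRingEnd ℂ) z) * H.specProj E := by
      rw [← ContinuousLinearMap.star_eq_adjoint, star_mul, ContinuousLinearMap.star_eq_adjoint,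
        ContinuousLinearMap.star_eq_adjoint, adjoint_specProj, hadjlow]
    refine H.sandwich_eq hℓ φ ?_ hdec (fun x => ?_) (fun x => H.isSmooth_apply (fun s _ => hvs s) x)
    · rw [ContinuousLinearMap.adjoint_adjoint, hlow, hadj]
    · rw [hadj]
      exact (H.isSmooth_specProj E x).map (hcomm _ _ rfl)
  have hright : H.sandwich (H.expDecay z) φ' (H.expLow E z) =
      H.decayOp ℓ z * H.regularized hℓ φ' * (H.lowOp ℓ E z * H.specProj E) := by
    refine H.sandwich_eq hℓ φ' ?_ (hlow z) (fun x => ?_)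
      fun x => (H.isSmooth_specProj E x).map (hcomm _ _ rfl)
    · have h : H.expDecay z = H.decayOp ℓ z * H.powNeg ℓ := by
        rw [hdec, (hcomm (H.decayOp ℓ z) _ rfl ℓ).eq]
      rw [h, ← ContinuousLinearMap.star_eq_adjoint, star_mul,
        ContinuousLinearMap.star_eq_adjoint, ContinuousLinearMap.star_eq_adjoint, adjoint_powNeg]
    · unfold decayOp
      rw [adjoint_apply]
      refine H.isSmooth_apply (fun s _ => ((hvs s).star).congr fun t _ => ?_) x
      simp [mul_assoc]
  rw [corr, if_pos hz, hleft, hright]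
  congr 1

/-- The exponent 2ℓ comes from the two `decayOp` factors. For -1 ≤ Im z < 0 the outer exponentials
are bounded by constants that depend on E. -/
theorem corr_mem_kernelSpace (H : Hamiltonian V) {ℓ : ℝ} (hℓ : 0 < ℓ) {E : ℝ} (hE : 0 < E)
    {σ : Module.Dual ℂ (V →L[ℂ] V)} (hσ : σ ∈ normalFunctionals V) (φ φ' : H.dualSpace ℓ) :
    H.corr E σ φ φ' ∈ kernelSpace (2 * ℓ) := by
  refine ⟨?_, fun z hz => if_neg (not_lt.2 hz), ?_⟩
  · have h : DifferentiableOn ℂ (fun z => σ (H.specProj E * H.kernelOp hℓ E E φ φ' z *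
        H.specProj E)) {z | z.im < 0} := by
      let L : (V →L[ℂ] V) →L[ℂ] ℂ := ⟨σ, continuous_of_mem_normalFunctionals hσ⟩
      exact L.differentiable.comp_differentiableOn
        (((H.differentiableOn_kernelOp hℓ E E φ φ').const_mul _).mul_const _)
    exact h.congr fun z hz => H.corr_eq hℓ E σ φ φ' hz
  · obtain ⟨C, hC0, hC⟩ := exists_norm_le_of_mem_normalFunctionals hσ
    set D := (Real.exp (E + 1) * (E + 2) ^ ℓ) * (Real.exp (E + 1) * (E + 2) ^ ℓ) *
      ((2 * ℓ) ^ ℓ * Real.exp 1) ^ 2 *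
      ((H.dualNorm ℓ φ).toReal * (H.dualNorm ℓ φ').toReal) with hD
    refine lt_of_le_of_lt (iSup₂_le fun z hz => ?_) (ENNReal.ofReal_lt_top (r := C * D))
    have hy : 0 < -z.im := by linarith [hz.2]
    rw [← ofReal_norm, ← ENNReal.ofReal_mul (norm_nonneg _)]
    refine ENNReal.ofReal_le_ofReal ?_
    rw [H.corr_eq hℓ E σ φ φ' hz.2, abs_of_neg hz.2]
    have hP := H.norm_specProj_le E
    have hexp : Real.exp (-z.im / 2 * (E + 1)) ≤ Real.exp (E + 1) :=
      Real.exp_le_exp.2 (by nlinarith [hz.1, hz.2])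
    have hk : ‖H.kernelOp hℓ E E φ φ' z‖ ≤ D * (-z.im) ^ (-(2 * ℓ)) := by
      refine (H.norm_kernelOp_le hℓ hE.le hE.le φ φ' hz.2 hz.1).trans ?_
      rw [hD]
      calc _ ≤ (Real.exp (E + 1) * (E + 2) ^ ℓ) * (Real.exp (E + 1) * (E + 2) ^ ℓ) *
          ((2 * ℓ) ^ ℓ * Real.exp 1) ^ 2 * (-z.im) ^ (-(2 * ℓ)) *
          ((H.dualNorm ℓ φ).toReal * (H.dualNorm ℓ φ').toReal) := by gcongr
        _ = _ := by ring
    have h1 : ‖H.specProj E * H.kernelOp hℓ E E φ φ' z * H.specProj E‖ ≤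
        D * (-z.im) ^ (-(2 * ℓ)) := by
      calc _ ≤ ‖H.specProj E‖ * ‖H.kernelOp hℓ E E φ φ' z‖ * ‖H.specProj E‖ :=
            (norm_mul_le _ _).trans (mul_le_mul_of_nonneg_right (norm_mul_le _ _) (norm_nonneg _))
        _ ≤ 1 * (D * (-z.im) ^ (-(2 * ℓ))) * 1 := by gcongr
        _ = _ := by ring
    calc _ ≤ C * (D * (-z.im) ^ (-(2 * ℓ))) * (-z.im) ^ (2 * ℓ) := by
          gcongr
          exact (hC _).trans (by gcongr)
      _ = C * D * ((-z.im) ^ (-(2 * ℓ)) * (-z.im) ^ (2 * ℓ)) := by ring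
      _ = C * D := by rw [← Real.rpow_add hy]; simp

end

end Hamiltonian

namespace Hamiltonian

section

variable {V : Type*} [NormedAddCommGroup V] [InnerProductSpace ℂ V] [CompleteSpace V]

/-! ### Energy slices -/

/-- The spectral projection for the energy interval `(j,j+1]` (for `[0,1]` if `j = 0`). -/
noncomputable def slice (H : Hamiltonian V) : ℕ → V →L[ℂ] V
  | 0 => H.specProj 1
  | j + 1 => H.specProj (j + 2) - H.specProj (j + 1)

theorem sum_slice (H : Hamiltonian V) (N : ℕ) :
    ∑ j ∈ Finset.range (N + 1), H.slice j = H.specProj (N + 1) := by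
  induction N with
  | zero => simp [slice]
  | succ N ih =>
    rw [Finset.sum_range_succ, ih, slice, add_sub_cancel]
    congr 1
    push_cast
    ring

theorem slice_commute_apply (H : Hamiltonian V) (j : ℕ) (f : ℝ → ℂ) :
    Commute (H.slice j) (H.apply f) := by
  cases j with
  | zero => exact H.specProj_commute_apply _ _
  | succ j => exact (H.specProj_commute_apply _ _).sub_left (H.specProj_commute_apply _ _)

theorem slice_succ_eq (H : Hamiltonian V) (j : ℕ) :
    H.slice (j + 1) = (1 - H.specProj (j + 1)) * H.specProj (j + 2) := by
  rw [sub_mul, one_mul, H.specProj_mul_specProj_of_ge (by linarith), slice]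

theorem specProj_mul_slice (H : Hamiltonian V) (j : ℕ) :
    H.specProj (j + 1) * H.slice j = H.slice j := by
  cases j with
  | zero => simp [slice, H.specProj_mul_self]
  | succ j =>
    have h : (((j + 1 : ℕ) : ℝ) + 1) = (j : ℝ) + 2 := by push_cast; ring
    rw [h, slice, mul_sub, H.specProj_mul_self, H.specProj_mul_specProj_of_le (by linarith)]

theorem specProj_mul_slice_eq_zero (H : Hamiltonian V) {E : ℝ} (hE : 0 < E) {j : ℕ}
    (h : E ≤ j) : H.specProj E * H.slice j = 0 := by
  cases j with
  | zero => exact absurd h (by simpa using hE)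
  | succ j =>
    push_cast at h
    rw [slice, mul_sub, H.specProj_mul_specProj_of_ge (by linarith),
      H.specProj_mul_specProj_of_ge (by linarith), sub_self]

theorem slice_mul_specProj_eq_zero (H : Hamiltonian V) {E : ℝ} (hE : 0 < E) {j : ℕ}
    (h : E ≤ j) : H.slice j * H.specProj E = 0 := by
  cases j with
  | zero => exact absurd h (by simpa using hE)
  | succ j =>
    push_cast at h
    rw [slice, sub_mul, H.specProj_mul_specProj_of_le (by linarith),
      H.specProj_mul_specProj_of_le (by linarith), sub_self]

theorem norm_powNeg_mul_slice_le (H : Hamiltonian V) {k : ℝ} (hk : 0 < k) (j : ℕ) :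
    ‖H.powNeg k * H.slice j‖ ≤ (1 + (j : ℝ)) ^ (-k) := by
  cases j with
  | zero =>
    rw [Nat.cast_zero, add_zero, Real.one_rpow]
    exact (norm_mul_le _ _).trans (mul_le_one₀ (H.norm_powNeg_le hk) (norm_nonneg _)
      (H.norm_specProj_le _))
  | succ j =>
    rw [slice_succ_eq, ← mul_assoc]
    have h := H.norm_powNeg_mul_one_sub_specProj_le (E := (j : ℝ) + 1) (by positivity) hk
    push_cast
    calc _ ≤ ‖H.powNeg k * (1 - H.specProj (j + 1))‖ * ‖H.specProj (j + 2)‖ := norm_mul_le _ _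
      _ ≤ (1 + ((j : ℝ) + 1)) ^ (-k) * 1 := by gcongr; exact H.norm_specProj_le _
      _ = _ := mul_one _

theorem norm_slice_mul_powNeg_le (H : Hamiltonian V) {k : ℝ} (hk : 0 < k) (j : ℕ) :
    ‖H.slice j * H.powNeg k‖ ≤ (1 + (j : ℝ)) ^ (-k) := by
  have h : H.slice j * H.powNeg k = H.powNeg k * H.slice j := (H.slice_commute_apply j _).eq
  rw [h]
  exact H.norm_powNeg_mul_slice_le hk j

theorem vanishesAtTop_low_sub (ℓ E F : ℝ) (z : ℂ) :
    VanishesAtTop fun t => Complex.exp (I * z / 2 * t) *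
      ((((1 + t) ^ ℓ : ℝ) : ℂ) * ((cutoff E t : ℝ) : ℂ)) - Complex.exp (I * z / 2 * t) *
      ((((1 + t) ^ ℓ : ℝ) : ℂ) * ((cutoff F t : ℝ) : ℂ)) :=
  (vanishesAtTop_low ℓ E _).sub (vanishesAtTop_low ℓ F _)

theorem lowOp_sub_mul_specProj (H : Hamiltonian V) (ℓ : ℝ) {E F G : ℝ} (hE : G ≤ E) (hF : G ≤ F)
    (z : ℂ) : (H.lowOp ℓ E z - H.lowOp ℓ F z) * H.specProj G = 0 := by
  unfold lowOp
  rw [← H.apply_sub (vanishesAtTop_low ℓ E _) (vanishesAtTop_low ℓ F _)]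
  exact H.apply_mul_specProj_eq_zero (vanishesAtTop_low_sub ℓ E F z) fun t _ ht => by
    rw [cutoff_of_le (ht.trans hE), cutoff_of_le (ht.trans hF), sub_self]

theorem slice_commute_lowOp (H : Hamiltonian V) (ℓ E : ℝ) (j : ℕ) (z : ℂ) :
    Commute (H.slice j) (H.lowOp ℓ E z) := H.slice_commute_apply _ _

theorem specProj_commute_lowOp (H : Hamiltonian V) (ℓ E F : ℝ) (z : ℂ) :
    Commute (H.specProj F) (H.lowOp ℓ E z) := H.specProj_commute_apply _ _

/-- Both cut-offs are 1 on [0, min(E,j+1)], and the slice followed by P(E) involves no higher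
energies. -/
theorem lowOp_mul_slice_mul_specProj (H : Hamiltonian V) (ℓ E : ℝ) (j : ℕ) (z : ℂ) :
    H.lowOp ℓ E z * (H.slice j * H.specProj E) =
      H.lowOp ℓ (j + 1) z * (H.slice j * H.specProj E) := by
  rw [← sub_eq_zero, ← sub_mul]
  rcases le_total E (j + 1) with h | h
  · have h1 := H.lowOp_sub_mul_specProj ℓ le_rfl h z
    rw [← mul_assoc, ← ((H.slice_commute_lowOp ℓ E j z).sub_right
      (H.slice_commute_lowOp ℓ (j + 1) j z)).eq, mul_assoc, h1, mul_zero]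
  · have h1 := H.lowOp_sub_mul_specProj ℓ h le_rfl z
    rw [← H.specProj_mul_slice j, ← mul_assoc, ← mul_assoc, h1, zero_mul, zero_mul]

theorem specProj_mul_slice_mul_lowOp (H : Hamiltonian V) (ℓ E : ℝ) (j : ℕ) (z : ℂ) :
    H.specProj E * (H.slice j * H.lowOp ℓ E z) =
      H.specProj E * (H.slice j * H.lowOp ℓ (j + 1) z) := by
  have hc := (H.slice_commute_lowOp ℓ E j z).sub_right (H.slice_commute_lowOp ℓ (j + 1) j z)
  have hp := (H.specProj_commute_lowOp ℓ E E z).sub_right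
    (H.specProj_commute_lowOp ℓ (j + 1) E z)
  rw [← sub_eq_zero, ← mul_sub, ← mul_sub, hc.eq]
  rcases le_total E (j + 1) with h | h
  · rw [← mul_assoc, hp.eq, H.lowOp_sub_mul_specProj ℓ le_rfl h z, zero_mul]
  · rw [← H.specProj_mul_slice j, ← mul_assoc (H.lowOp ℓ E z - _),
      H.lowOp_sub_mul_specProj ℓ h le_rfl z, zero_mul, mul_zero]

/-- The correlation function between two energy slices. -/
noncomputable def sliceOp (H : Hamiltonian V) {ℓ : ℝ} (hℓ : 0 < ℓ) (φ φ' : H.dualSpace ℓ)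
    (p : ℕ × ℕ) (z : ℂ) : V →L[ℂ] V :=
  H.slice p.1 * H.kernelOp hℓ (p.1 + 1) (p.2 + 1) φ φ' z * H.slice p.2

/-- This removes the dependence on E: between the outer projections the cut-offs at E may be
replaced by those of the slices. Hence the slice functions make sense for all smooth functionals. -/
theorem specProj_sliceOp (H : Hamiltonian V) {ℓ : ℝ} (hℓ : 0 < ℓ) (E : ℝ)
    (φ φ' : H.dualSpace ℓ) (p : ℕ × ℕ) (z : ℂ) :
    H.specProj E * (H.slice p.1 * H.kernelOp hℓ E E φ φ' z * H.slice p.2) * H.specProj E =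
      H.specProj E * H.sliceOp hℓ φ φ' p z * H.specProj E := by
  have h1 := H.specProj_mul_slice_mul_lowOp ℓ E p.1 z
  have h2 := H.lowOp_mul_slice_mul_specProj ℓ E p.2 z
  set M := H.regularized hℓ φ * H.decayOp ℓ z * (H.decayOp ℓ z * H.regularized hℓ φ') with hM
  calc _ = (H.specProj E * (H.slice p.1 * H.lowOp ℓ E z)) * M *
        (H.lowOp ℓ E z * (H.slice p.2 * H.specProj E)) := by
        simp only [hM, kernelOp, mul_assoc]
    _ = (H.specProj E * (H.slice p.1 * H.lowOp ℓ (p.1 + 1) z)) * M *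
        (H.lowOp ℓ (p.2 + 1) z * (H.slice p.2 * H.specProj E)) := by rw [h1, h2]
    _ = _ := by simp only [hM, sliceOp, kernelOp, mul_assoc]

theorem sum_sliceOp (H : Hamiltonian V) {ℓ : ℝ} (hℓ : 0 < ℓ) {E : ℝ} {N : ℕ} (hN : E ≤ N)
    {σ : Module.Dual ℂ (V →L[ℂ] V)} (hσ : σ ∈ H.energyBounded E) (φ φ' : H.dualSpace ℓ) (z : ℂ) :
    σ (H.specProj E * H.kernelOp hℓ E E φ φ' z * H.specProj E) =
      ∑ p ∈ Finset.range (N + 1) ×ˢ Finset.range (N + 1), σ (H.sliceOp hℓ φ φ' p z) := by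
  have h1 : H.specProj E * H.kernelOp hℓ E E φ φ' z * H.specProj E =
      ∑ p ∈ Finset.range (N + 1) ×ˢ Finset.range (N + 1), H.specProj E *
        (H.slice p.1 * H.kernelOp hℓ E E φ φ' z * H.slice p.2) * H.specProj E := by
    rw [← Finset.sum_mul, ← Finset.mul_sum, Finset.sum_product]
    simp only [← Finset.mul_sum, ← Finset.sum_mul]
    rw [sum_slice, ← mul_assoc, ← mul_assoc, H.specProj_mul_specProj_of_ge (by linarith),
      mul_assoc _ (H.specProj _) (H.specProj _), H.specProj_mul_specProj_of_le (by linarith)]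
  rw [h1, map_sum]
  refine Finset.sum_congr rfl fun p _ => ?_
  rw [specProj_sliceOp, H.energyBounded_apply_specProj hσ]

theorem apply_sliceOp_eq_zero (H : Hamiltonian V) {ℓ : ℝ} (hℓ : 0 < ℓ) {E : ℝ} (hE : 0 < E)
    {N : ℕ} (hN : E ≤ N) {σ : Module.Dual ℂ (V →L[ℂ] V)} (hσ : σ ∈ H.energyBounded E)
    (φ φ' : H.dualSpace ℓ) {p : ℕ × ℕ}
    (hp : p ∉ Finset.range (N + 1) ×ˢ Finset.range (N + 1)) (z : ℂ) :
    σ (H.sliceOp hℓ φ φ' p z) = 0 := by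
  rw [← H.energyBounded_apply_specProj hσ, sliceOp]
  by_cases h1 : p.1 < N + 1
  · have h2 : N + 1 ≤ p.2 := by
      by_contra! h
      exact hp (Finset.mem_product.2 ⟨Finset.mem_range.2 h1, Finset.mem_range.2 h⟩)
    have h3 : E ≤ (p.2 : ℝ) := hN.trans (by exact_mod_cast (Nat.le_succ N).trans h2)
    rw [mul_assoc, mul_assoc _ _ (H.specProj E), H.slice_mul_specProj_eq_zero hE h3]
    simp
  · have h3 : E ≤ (p.1 : ℝ) := hN.trans (by
      exact_mod_cast (Nat.le_succ N).trans (not_lt.1 h1))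
    rw [← mul_assoc, ← mul_assoc, H.specProj_mul_slice_eq_zero hE h3]
    simp

/-- In the strip adapted to the two slices the exponentials are bounded. The outer powers contribute
(1+j)^ℓ on a slice j, while R^k contributes (1+j)^{-k}. -/
theorem norm_powNeg_sliceOp_le (H : Hamiltonian V) {ℓ : ℝ} (hℓ : 0 < ℓ) {k : ℝ} (hk : 0 < k)
    (φ φ' : H.dualSpace ℓ) (p : ℕ × ℕ) {z : ℂ} (hz : z.im < 0)
    (hz1 : -z.im ≤ (1 + max (p.1 : ℝ) p.2)⁻¹) :
    ‖H.powNeg k * H.sliceOp hℓ φ φ' p z * H.powNeg k‖ ≤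
      (Real.exp 1 * 3 ^ ℓ) ^ 2 * ((2 * ℓ) ^ ℓ * Real.exp 1) ^ 2 *
      ((H.dualNorm ℓ φ).toReal * (H.dualNorm ℓ φ').toReal) *
      ((1 + (p.1 : ℝ)) ^ (ℓ - k) * (1 + (p.2 : ℝ)) ^ (ℓ - k)) * (-z.im) ^ (-(2 * ℓ)) := by
  have hy : 0 < -z.im := by linarith
  have hmax : (0 : ℝ) ≤ max (p.1 : ℝ) p.2 := le_max_of_le_left (Nat.cast_nonneg _)
  have hy1 : -1 ≤ z.im := by
    have : (1 + max (p.1 : ℝ) p.2)⁻¹ ≤ 1 := inv_le_one_of_one_le₀ (by linarith)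
    linarith
  -- With y(1+j) ≤ 1 the exponent y(j+2)/2 is at most 1, as (j+2)/2 ≤ 1+j; the constant 3 comes from
  -- j+3 ≤ 3(1+j).
  have hlow : ∀ j : ℕ, (j : ℝ) ≤ max (p.1 : ℝ) p.2 →
      Real.exp (-z.im / 2 * ((j : ℝ) + 1 + 1)) * ((j : ℝ) + 1 + 2) ^ ℓ ≤
        Real.exp 1 * 3 ^ ℓ * (1 + (j : ℝ)) ^ ℓ := fun j hj => by
    have h1 : -z.im / 2 * ((j : ℝ) + 1 + 1) ≤ 1 := by
      have h2 : -z.im * (1 + (j : ℝ)) ≤ 1 := by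
        calc -z.im * (1 + (j : ℝ)) ≤
            (1 + max (p.1 : ℝ) p.2)⁻¹ * (1 + max (p.1 : ℝ) p.2) := by gcongr
          _ = 1 := inv_mul_cancel₀ (by positivity)
      have : (0 : ℝ) ≤ j := Nat.cast_nonneg j
      nlinarith
    have h3 : ((j : ℝ) + 1 + 2) ^ ℓ ≤ 3 ^ ℓ * (1 + (j : ℝ)) ^ ℓ := by
      rw [← Real.mul_rpow (by norm_num) (by positivity)]
      have : (0 : ℝ) ≤ j := Nat.cast_nonneg j
      exact Real.rpow_le_rpow (by positivity) (by linarith) hℓ.le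
    rw [mul_assoc]
    gcongr
  have hker := H.norm_kernelOp_le hℓ (E := (p.1 : ℝ) + 1) (F := (p.2 : ℝ) + 1)
    (by positivity) (by positivity) φ φ' hz hy1
  have hassoc : H.powNeg k * H.sliceOp hℓ φ φ' p z * H.powNeg k =
      (H.powNeg k * H.slice p.1) * H.kernelOp hℓ (p.1 + 1) (p.2 + 1) φ φ' z *
        (H.slice p.2 * H.powNeg k) := by
    simp only [sliceOp, mul_assoc]
  have hpow : ∀ j : ℕ, (1 + (j : ℝ)) ^ (ℓ - k) = (1 + (j : ℝ)) ^ ℓ * (1 + (j : ℝ)) ^ (-k) :=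
    fun j => by rw [← Real.rpow_add (by positivity)]; rfl
  rw [hassoc, hpow, hpow]
  calc _ ≤ ‖H.powNeg k * H.slice p.1‖ * ‖H.kernelOp hℓ (p.1 + 1) (p.2 + 1) φ φ' z‖ *
        ‖H.slice p.2 * H.powNeg k‖ :=
        (norm_mul_le _ _).trans (mul_le_mul_of_nonneg_right (norm_mul_le _ _) (norm_nonneg _))
    _ ≤ (1 + (p.1 : ℝ)) ^ (-k) * ((Real.exp 1 * 3 ^ ℓ * (1 + (p.1 : ℝ)) ^ ℓ) *
        (Real.exp 1 * 3 ^ ℓ * (1 + (p.2 : ℝ)) ^ ℓ) *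
        ((2 * ℓ) ^ ℓ * Real.exp 1) ^ 2 * (-z.im) ^ (-(2 * ℓ)) *
        ((H.dualNorm ℓ φ).toReal * (H.dualNorm ℓ φ').toReal)) * (1 + (p.2 : ℝ)) ^ (-k) := by
        have a1 := hlow p.1 (le_max_left _ _)
        have a2 := hlow p.2 (le_max_right _ _)
        refine mul_le_mul (mul_le_mul (H.norm_powNeg_mul_slice_le hk _) (hker.trans ?_)
          (norm_nonneg _) (by positivity)) (H.norm_slice_mul_powNeg_le hk _) (norm_nonneg _)
          (by positivity)
        gcongr
    _ = _ := by ring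

end

end Hamiltonian

theorem norm_le_kernelNorm {ℓ : ℝ} (K : kernelSpace ℓ) {z : ℂ} (hz : z.im < 0)
    (hz1 : -1 ≤ z.im) :
    ‖(K : ℂ → ℂ) z‖ ≤ (kernelNorm ℓ (K : ℂ → ℂ)).toReal * (-z.im) ^ (-ℓ) := by
  have hy : 0 < -z.im := by linarith
  have h := le_iSup₂ (f := fun (z : ℂ) (_ : -1 ≤ z.im ∧ z.im < 0) =>
    ‖(K : ℂ → ℂ) z‖ₑ * ENNReal.ofReal (|z.im| ^ ℓ)) z ⟨hz1, hz⟩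
  have h2 := ENNReal.toReal_mono K.2.2.2.ne h
  rw [ENNReal.toReal_mul, toReal_enorm, ENNReal.toReal_ofReal (by positivity),
    abs_of_neg hz] at h2
  rw [Real.rpow_neg hy.le, ← div_eq_mul_inv, le_div_iff₀ (by positivity)]
  exact h2

namespace Hamiltonian

section

variable {V : Type*} [NormedAddCommGroup V] [InnerProductSpace ℂ V] [CompleteSpace V]

/-! ### The product distribution -/

variable (H : Hamiltonian V) {ℓ : ℝ} (hℓ : 0 < ℓ)

/-- The kernel times the correlation function between two energy slices. -/
noncomputable def sliceFn (K : kernelSpace ℓ) (φ φ' : H.dualSpace ℓ) (σ : H.smoothFunctionals)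
    (p : ℕ × ℕ) (z : ℂ) : ℂ :=
  (K : ℂ → ℂ) z * (σ : Module.Dual ℂ (V →L[ℂ] V)) (H.sliceOp hℓ φ φ' p z)

/-- The boundary value of `sliceFn`, smeared out with `f`. -/
noncomputable def sliceVal (f : LineTest) (K : kernelSpace ℓ) (φ φ' : H.dualSpace ℓ)
    (σ : H.smoothFunctionals) (p : ℕ × ℕ) : ℂ :=
  limUnder (𝓝[>] 0) (lineIntegral f (H.sliceFn hℓ K φ φ' σ p))

/-- The constant in the estimate of the product distribution. -/
noncomputable def productConst (ℓ : ℝ) : ℝ :=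
  (Real.exp 1 * 3 ^ ℓ) ^ 2 * ((2 * ℓ) ^ ℓ * Real.exp 1) ^ 2

/-- The product of the norms of a kernel and two fields. -/
noncomputable def normProd (K : kernelSpace ℓ) (φ φ' : H.dualSpace ℓ) : ℝ :=
  (kernelNorm ℓ (K : ℂ → ℂ)).toReal *
    ((H.dualNorm ℓ (φ : Module.Dual ℂ H.smoothFunctionals)).toReal *
      (H.dualNorm ℓ (φ' : Module.Dual ℂ H.smoothFunctionals)).toReal)

theorem normProd_nonneg (K : kernelSpace ℓ) (φ φ' : H.dualSpace ℓ) : 0 ≤ H.normProd K φ φ' := by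
  unfold normProd
  positivity

theorem productConst_pos {ℓ : ℝ} (hℓ : 0 < ℓ) : 0 < productConst ℓ := by
  unfold productConst
  positivity

/-- The decay of the contributions of the energy slices. -/
noncomputable def sliceWeight (ℓ : ℝ) (p : ℕ × ℕ) : ℝ :=
  (1 + (p.1 : ℝ)) ^ (-(ℓ + 1)) * (1 + (p.2 : ℝ)) ^ (-(ℓ + 1))

theorem sliceWeight_pos (ℓ : ℝ) (p : ℕ × ℕ) : 0 < sliceWeight ℓ p := by
  unfold sliceWeight
  positivity

theorem summable_sliceWeight {ℓ : ℝ} (hℓ : 0 < ℓ) : Summable (sliceWeight ℓ) := by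
  have h : Summable fun n : ℕ => (1 + (n : ℝ)) ^ (-(ℓ + 1)) := by
    have h1 : Summable fun n : ℕ => (n : ℝ) ^ (-(ℓ + 1)) :=
      Real.summable_nat_rpow.2 (by linarith)
    refine ((summable_nat_add_iff 1).2 h1).congr fun n => ?_
    push_cast
    rw [add_comm]
  exact h.mul_of_nonneg h (fun n => by positivity) fun n => by positivity

/-- The sum of the `L¹` norms of the derivatives up to the order `m + 1`. -/
noncomputable def derivSum (m : ℕ) (f : ℝ → ℂ) : ℝ :=
  ∑ n ∈ Finset.range (m + 2), ∫ x : ℝ, ‖iteratedDeriv n f x‖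

theorem derivSum_nonneg (m : ℕ) (f : ℝ → ℂ) : 0 ≤ derivSum m f :=
  Finset.sum_nonneg fun _ _ => integral_nonneg fun _ => norm_nonneg _

/-! ### Smeared boundary values of the slice contributions -/

section

variable (K : kernelSpace ℓ) (φ φ' : H.dualSpace ℓ) (σ : H.smoothFunctionals) (p : ℕ × ℕ)

theorem differentiableOn_sliceFn :
    DifferentiableOn ℂ (H.sliceFn hℓ K φ φ' σ p) {z | z.im < 0} := by
  let L : (V →L[ℂ] V) →L[ℂ] ℂ := ⟨σ, continuous_of_mem_normalFunctionals σ.2.1⟩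
  exact K.2.1.mul (L.differentiable.comp_differentiableOn
    (((H.differentiableOn_kernelOp hℓ _ _ φ φ').const_mul _).mul_const _))

/-- The singularity 3ℓ is ℓ from the kernel and 2ℓ from the operator between the slices; the decay
exponent is (5ℓ+1) - ℓ = 4ℓ+1 on each side. -/
theorem norm_sliceFn_le {x y : ℝ} (hy : 0 < y) (hy1 : y ≤ (1 + max (p.1 : ℝ) p.2)⁻¹) :
    ‖H.sliceFn hℓ K φ φ' σ p (x - I * y)‖ ≤
      productConst ℓ * H.normProd K φ φ' *
        (H.lnorm (5 * ℓ + 1) (σ : Module.Dual ℂ (V →L[ℂ] V))).toReal *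
        ((1 + (p.1 : ℝ)) ^ (-(4 * ℓ + 1)) * (1 + (p.2 : ℝ)) ^ (-(4 * ℓ + 1))) *
        y ^ (-(3 * ℓ)) := by
  have hmax : (0 : ℝ) ≤ max (p.1 : ℝ) p.2 := le_max_of_le_left (Nat.cast_nonneg _)
  have hinv : (1 + max (p.1 : ℝ) p.2)⁻¹ ≤ 1 := inv_le_one_of_one_le₀ (by linarith)
  have him : -((x : ℂ) - I * y).im = y := by rw [im_ofReal_sub_I_mul, neg_neg]
  have hz : ((x : ℂ) - I * y).im < 0 := by rw [im_ofReal_sub_I_mul]; linarith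
  have hz1 : -1 ≤ ((x : ℂ) - I * y).im := by rw [im_ofReal_sub_I_mul]; linarith
  have hk : 0 < 5 * ℓ + 1 := by linarith
  have h1 := norm_le_kernelNorm K hz hz1
  have h2 := H.norm_powNeg_sliceOp_le hℓ hk φ φ' p hz (by rwa [him])
  have h3 := H.norm_apply_le_lnorm (σ.2.2 (5 * ℓ + 1) hk)
    (H.sliceOp hℓ φ φ' p ((x : ℂ) - I * y))
  rw [him] at h1 h2
  have he : ℓ - (5 * ℓ + 1) = -(4 * ℓ + 1) := by ring
  rw [he] at h2
  have hpow : y ^ (-(3 * ℓ)) = y ^ (-ℓ) * y ^ (-(2 * ℓ)) := by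
    rw [← Real.rpow_add hy]; ring_nf
  rw [sliceFn, norm_mul]
  refine (mul_le_mul h1 (h3.trans (mul_le_mul_of_nonneg_left h2 ENNReal.toReal_nonneg))
    (norm_nonneg _) (by positivity)).trans_eq ?_
  rw [hpow, productConst, normProd]
  ring

theorem exists_isBoundaryIntegral_sliceFn (f : LineTest) :
    ∃ b, IsBoundaryIntegral f (H.sliceFn hℓ K φ φ' σ p) b := by
  have hmax : (0 : ℝ) ≤ max (p.1 : ℝ) p.2 := le_max_of_le_left (Nat.cast_nonneg _)
  have h0 := H.normProd_nonneg K φ φ'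
  have h1 := productConst_pos hℓ
  exact exists_tendsto_lineIntegral f.isTest (H.differentiableOn_sliceFn hℓ K φ φ' σ p)
    (p := 3 * ℓ) (by positivity) (by linarith) (y₀ := (1 + max (p.1 : ℝ) p.2)⁻¹)
    (by positivity) (inv_le_one_of_one_le₀ (by linarith))
    fun x y hy hy1 => H.norm_sliceFn_le hℓ K φ φ' σ p hy hy1

theorem isBoundaryIntegral_sliceVal (f : LineTest) :
    IsBoundaryIntegral f (H.sliceFn hℓ K φ φ' σ p) (H.sliceVal hℓ f K φ φ' σ p) := by
  obtain ⟨b, hb⟩ := H.exists_isBoundaryIntegral_sliceFn hℓ K φ φ' σ p f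
  have h : H.sliceVal hℓ f K φ φ' σ p = b := Tendsto.limUnder_eq hb
  rw [h]
  exact hb

/-- The boundary estimate in a strip of height y₀ costs y₀^{-3ℓ}, which reduces the decay 4ℓ+1 to
ℓ+1. The energy order 5ℓ+1 is chosen so that this last exponent exceeds 1. -/
theorem norm_sliceVal_le (f : LineTest) {m : ℕ} (hm : 3 * ℓ ≤ m) :
    ‖H.sliceVal hℓ f K φ φ' σ p‖ ≤ productConst ℓ * H.normProd K φ φ' * derivSum m f *
      (H.lnorm (5 * ℓ + 1) (σ : Module.Dual ℂ (V →L[ℂ] V))).toReal * sliceWeight ℓ p := by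
  have hmax : (0 : ℝ) ≤ max (p.1 : ℝ) p.2 := le_max_of_le_left (Nat.cast_nonneg _)
  have h0 := H.normProd_nonneg K φ φ'
  have h1 := productConst_pos hℓ
  have hS := derivSum_nonneg m f
  set s := (H.lnorm (5 * ℓ + 1) (σ : Module.Dual ℂ (V →L[ℂ] V))).toReal with hs
  have hs0 : 0 ≤ s := ENNReal.toReal_nonneg
  have hb := (H.isBoundaryIntegral_sliceVal hℓ K φ φ' σ p f).norm_le f.isTest
    (H.differentiableOn_sliceFn hℓ K φ φ' σ p)
    (p := 3 * ℓ) (by positivity) (by linarith) (y₀ := (1 + max (p.1 : ℝ) p.2)⁻¹)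
    (by positivity) (inv_le_one_of_one_le₀ (by linarith))
    (fun x y hy hy1 => H.norm_sliceFn_le hℓ K φ φ' σ p hy hy1) hm
  refine hb.trans ?_
  -- Bounding 1 + max(j,k) by (1+j)(1+k) splits the loss into a product over the two slices, at the
  -- full power 3ℓ for each.
  have hpow : ((1 + max (p.1 : ℝ) p.2)⁻¹ : ℝ) ^ (-(3 * ℓ)) ≤
      (1 + (p.1 : ℝ)) ^ (3 * ℓ) * (1 + (p.2 : ℝ)) ^ (3 * ℓ) := by
    rw [Real.inv_rpow (by positivity), Real.rpow_neg (by positivity), inv_inv,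
      ← Real.mul_rpow (by positivity) (by positivity)]
    refine Real.rpow_le_rpow (by positivity) ?_ (by linarith)
    have e1 : (0 : ℝ) ≤ p.1 := Nat.cast_nonneg _
    have e2 : (0 : ℝ) ≤ p.2 := Nat.cast_nonneg _
    have e3 : max (p.1 : ℝ) p.2 ≤ p.1 + p.2 := max_le (by linarith) (by linarith)
    nlinarith [mul_nonneg e1 e2]
  have hw : ∀ j : ℕ, (1 + (j : ℝ)) ^ (-(ℓ + 1)) =
      (1 + (j : ℝ)) ^ (-(4 * ℓ + 1)) * (1 + (j : ℝ)) ^ (3 * ℓ) := fun j => by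
    rw [← Real.rpow_add (by positivity)]; ring_nf
  rw [sliceWeight, hw, hw]
  change _ * derivSum m f ≤ _
  calc _ ≤ productConst ℓ * H.normProd K φ φ' * s *
        ((1 + (p.1 : ℝ)) ^ (-(4 * ℓ + 1)) * (1 + (p.2 : ℝ)) ^ (-(4 * ℓ + 1))) *
        ((1 + (p.1 : ℝ)) ^ (3 * ℓ) * (1 + (p.2 : ℝ)) ^ (3 * ℓ)) * derivSum m f := by gcongr
    _ = _ := by ring

theorem summable_sliceVal (f : LineTest) : Summable (H.sliceVal hℓ f K φ φ' σ) := by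
  obtain ⟨m, hm⟩ := exists_nat_ge (3 * ℓ)
  exact Summable.of_norm_bounded ((summable_sliceWeight hℓ).mul_left _)
    fun p => H.norm_sliceVal_le hℓ K φ φ' σ p f hm

theorem norm_tsum_sliceVal_le (f : LineTest) {m : ℕ} (hm : 3 * ℓ ≤ m) :
    ‖∑' p, H.sliceVal hℓ f K φ φ' σ p‖ ≤
      productConst ℓ * (∑' p, sliceWeight ℓ p) * derivSum m f * H.normProd K φ φ' *
        (H.lnorm (5 * ℓ + 1) (σ : Module.Dual ℂ (V →L[ℂ] V))).toReal := by
  refine (tsum_of_norm_bounded ((summable_sliceWeight hℓ).mul_left _).hasSum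
    fun p => H.norm_sliceVal_le hℓ K φ φ' σ p f hm).trans_eq ?_
  rw [tsum_mul_left]
  ring

variable {K φ φ' σ p}

theorem sliceVal_eq {f : LineTest} {b : ℂ}
    (h : IsBoundaryIntegral f (H.sliceFn hℓ K φ φ' σ p) b) :
    H.sliceVal hℓ f K φ φ' σ p = b :=
  (H.isBoundaryIntegral_sliceVal hℓ K φ φ' σ p f).unique h

variable {K₁ K₂ : kernelSpace ℓ} {φ₁ φ₂ φ₁' φ₂' : H.dualSpace ℓ} {σ₁ σ₂ : H.smoothFunctionals}

/-- Stated for pointwise sums of slice functions, so that it serves additivity in the kernel, in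
both fields and in the functional alike. -/
theorem tsum_sliceVal_add (f : LineTest)
    (h : ∀ p z, H.sliceFn hℓ K φ φ' σ p z =
      H.sliceFn hℓ K₁ φ₁ φ₁' σ₁ p z + H.sliceFn hℓ K₂ φ₂ φ₂' σ₂ p z) :
    ∑' p, H.sliceVal hℓ f K φ φ' σ p =
      ∑' p, H.sliceVal hℓ f K₁ φ₁ φ₁' σ₁ p + ∑' p, H.sliceVal hℓ f K₂ φ₂ φ₂' σ₂ p := by
  rw [← (H.summable_sliceVal hℓ _ _ _ _ f).tsum_add (H.summable_sliceVal hℓ _ _ _ _ f)]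
  exact tsum_congr fun p => H.sliceVal_eq hℓ <|
    ((H.isBoundaryIntegral_sliceVal hℓ K₁ φ₁ φ₁' σ₁ p f).add f.isTest
      (H.differentiableOn_sliceFn hℓ _ _ _ _ p) (H.differentiableOn_sliceFn hℓ _ _ _ _ p)
      (H.isBoundaryIntegral_sliceVal hℓ K₂ φ₂ φ₂' σ₂ p f)).congr fun z _ => (h p z).symm

theorem tsum_sliceVal_smul (f : LineTest) (c : ℂ)
    (h : ∀ p z, H.sliceFn hℓ K φ φ' σ p z = c * H.sliceFn hℓ K₁ φ₁ φ₁' σ₁ p z) :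
    ∑' p, H.sliceVal hℓ f K φ φ' σ p = c * ∑' p, H.sliceVal hℓ f K₁ φ₁ φ₁' σ₁ p := by
  rw [← tsum_mul_left]
  exact tsum_congr fun p => H.sliceVal_eq hℓ <|
    ((H.isBoundaryIntegral_sliceVal hℓ K₁ φ₁ φ₁' σ₁ p f).const_mul c).congr
      fun z _ => (h p z).symm

theorem tsum_sliceVal_add_test (f g : LineTest) :
    ∑' p, H.sliceVal hℓ (f + g) K φ φ' σ p =
      ∑' p, H.sliceVal hℓ f K φ φ' σ p + ∑' p, H.sliceVal hℓ g K φ φ' σ p := by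
  rw [← (H.summable_sliceVal hℓ _ _ _ _ f).tsum_add (H.summable_sliceVal hℓ _ _ _ _ g)]
  exact tsum_congr fun p => H.sliceVal_eq hℓ <|
    (H.isBoundaryIntegral_sliceVal hℓ K φ φ' σ p f).add_test f.isTest g.isTest
      (H.differentiableOn_sliceFn hℓ _ _ _ _ p) (H.isBoundaryIntegral_sliceVal hℓ K φ φ' σ p g)

theorem tsum_sliceVal_smul_test (f : LineTest) (c : ℂ) :
    ∑' p, H.sliceVal hℓ (c • f) K φ φ' σ p = c * ∑' p, H.sliceVal hℓ f K φ φ' σ p := by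
  rw [← tsum_mul_left]
  exact tsum_congr fun p => H.sliceVal_eq hℓ <|
    (H.isBoundaryIntegral_sliceVal hℓ K φ φ' σ p f).smul_test c

end

section

variable (φ₁ φ₂ φ' : H.dualSpace ℓ) (c : ℂ) (p : ℕ × ℕ) (z : ℂ)

theorem sliceOp_add_left : H.sliceOp hℓ (φ₁ + φ₂) φ' p z =
    H.sliceOp hℓ φ₁ φ' p z + H.sliceOp hℓ φ₂ φ' p z := by
  simp only [sliceOp, kernelOp, map_add, mul_add, add_mul]

theorem sliceOp_add_right : H.sliceOp hℓ φ' (φ₁ + φ₂) p z =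
    H.sliceOp hℓ φ' φ₁ p z + H.sliceOp hℓ φ' φ₂ p z := by
  simp only [sliceOp, kernelOp, map_add, mul_add, add_mul]

theorem sliceOp_smul_left : H.sliceOp hℓ (c • φ₁) φ' p z = c • H.sliceOp hℓ φ₁ φ' p z := by
  simp only [sliceOp, kernelOp, map_smul, mul_smul_comm, smul_mul_assoc]

theorem sliceOp_smul_right : H.sliceOp hℓ φ' (c • φ₁) p z = c • H.sliceOp hℓ φ' φ₁ p z := by
  simp only [sliceOp, kernelOp, map_smul, mul_smul_comm, smul_mul_assoc]

end

/-- The form `σ ↦ ∫ f(s') K(s' - i0) σ(φ(s'/2 - i0) φ'(-s'/2 + i0)) ds'`. -/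
noncomputable def productForm (f : LineTest) (K : kernelSpace ℓ) (φ φ' : H.dualSpace ℓ) :
    Module.Dual ℂ H.smoothFunctionals where
  toFun σ := ∑' p, H.sliceVal hℓ f K φ φ' σ p
  map_add' σ τ := H.tsum_sliceVal_add hℓ f fun p z => by
    simp only [sliceFn, Submodule.coe_add, LinearMap.add_apply, mul_add]
  map_smul' c σ := H.tsum_sliceVal_smul hℓ f c fun p z => by
    simp only [sliceFn, Submodule.coe_smul, LinearMap.smul_apply, smul_eq_mul]
    ring

theorem productForm_mem_smoothDual (f : LineTest) (K : kernelSpace ℓ) (φ φ' : H.dualSpace ℓ) :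
    H.productForm hℓ f K φ φ' ∈ H.smoothDual := by
  obtain ⟨m, hm⟩ := exists_nat_ge (3 * ℓ)
  have h0 := H.normProd_nonneg K φ φ'
  have h1 := productConst_pos hℓ
  have hS := derivSum_nonneg m f
  have hW : 0 ≤ ∑' p, sliceWeight ℓ p := tsum_nonneg fun p => (sliceWeight_pos ℓ p).le
  exact ⟨5 * ℓ + 1, by linarith, (H.dualNorm_le_ofReal (by positivity)
    fun σ => H.norm_tsum_sliceVal_le hℓ K φ φ' σ f hm).trans_lt ENNReal.ofReal_lt_top⟩

/-- The product distribution of a kernel and two fields. -/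
noncomputable def productDistribution (K : kernelSpace ℓ) (φ φ' : H.dualSpace ℓ) :
    LineTest →ₗ[ℂ] H.smoothDual where
  toFun f := ⟨H.productForm hℓ f K φ φ', H.productForm_mem_smoothDual hℓ f K φ φ'⟩
  map_add' f g := Subtype.ext <| LinearMap.ext fun _ => H.tsum_sliceVal_add_test hℓ f g
  map_smul' c f := Subtype.ext <| LinearMap.ext fun _ => H.tsum_sliceVal_smul_test hℓ f c

/-- The product distribution as a bilinear map in the fields. -/
noncomputable def productBilinear (K : kernelSpace ℓ) :
    H.dualSpace ℓ →ₗ[ℂ] H.dualSpace ℓ →ₗ[ℂ] LineTest →ₗ[ℂ] H.smoothDual :=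
  LinearMap.mk₂ ℂ (H.productDistribution hℓ K)
    (fun φ₁ φ₂ φ' => LinearMap.ext fun f => Subtype.ext <| LinearMap.ext fun σ =>
      H.tsum_sliceVal_add hℓ f fun p z => by
        simp only [sliceFn, sliceOp_add_left, map_add, mul_add])
    (fun c φ φ' => LinearMap.ext fun f => Subtype.ext <| LinearMap.ext fun σ =>
      H.tsum_sliceVal_smul hℓ f c fun p z => by
        simp only [sliceFn, sliceOp_smul_left, map_smul, smul_eq_mul]
        ring)
    (fun φ φ₁ φ₂ => LinearMap.ext fun f => Subtype.ext <| LinearMap.ext fun σ =>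
      H.tsum_sliceVal_add hℓ f fun p z => by
        simp only [sliceFn, sliceOp_add_right, map_add, mul_add])
    (fun c φ φ' => LinearMap.ext fun f => Subtype.ext <| LinearMap.ext fun σ =>
      H.tsum_sliceVal_smul hℓ f c fun p z => by
        simp only [sliceFn, sliceOp_smul_right, map_smul, smul_eq_mul]
        ring)

/-- The product distribution as a linear map on the product space of level `ℓ`. -/
noncomputable def productMap : H.ProductSpace ℓ →ₗ[ℂ] (LineTest →ₗ[ℂ] H.smoothDual) :=
  TensorProduct.lift
    { toFun := fun K => TensorProduct.lift (H.productBilinear hℓ K)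
      map_add' := fun K L => TensorProduct.ext' fun φ φ' => LinearMap.ext fun f =>
        Subtype.ext <| LinearMap.ext fun σ => H.tsum_sliceVal_add hℓ f fun p z => by
          simp only [sliceFn, Submodule.coe_add, Pi.add_apply, add_mul]
      map_smul' := fun c K => TensorProduct.ext' fun φ φ' => LinearMap.ext fun f =>
        Subtype.ext <| LinearMap.ext fun σ => H.tsum_sliceVal_smul hℓ f c fun p z => by
          simp only [sliceFn, Submodule.coe_smul, Pi.smul_apply, smul_eq_mul, mul_assoc] }

/-! ### Expectation values, uniqueness and norm estimates -/

variable {n : ℕ} (K : Fin n → kernelSpace ℓ) (φ φ' : Fin n → H.dualSpace ℓ)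

theorem productMap_sum_apply (f : LineTest) (σ : H.smoothFunctionals) :
    (H.productMap hℓ (∑ j, K j ⊗ₜ[ℂ] (φ j ⊗ₜ[ℂ] φ' j)) f :
        Module.Dual ℂ H.smoothFunctionals) σ =
      ∑ j, ∑' p, H.sliceVal hℓ f (K j) (φ j) (φ' j) σ p := by
  rw [map_sum, LinearMap.sum_apply, Submodule.coe_sum, LinearMap.sum_apply]
  rfl

theorem dualNorm_productMap_le (f : LineTest) {m : ℕ} (hm : 3 * ℓ ≤ m) :
    H.dualNorm (5 * ℓ + 1) (H.productMap hℓ (∑ j, K j ⊗ₜ[ℂ] (φ j ⊗ₜ[ℂ] φ' j)) f) ≤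
      ENNReal.ofReal (productConst ℓ * (∑' p, sliceWeight ℓ p) * derivSum m f *
        ∑ j, H.normProd (K j) (φ j) (φ' j)) := by
  have h1 := productConst_pos hℓ
  have hS := derivSum_nonneg m f
  have hW : 0 ≤ ∑' p, sliceWeight ℓ p := tsum_nonneg fun p => (sliceWeight_pos ℓ p).le
  have h0 : 0 ≤ ∑ j, H.normProd (K j) (φ j) (φ' j) :=
    Finset.sum_nonneg fun j _ => H.normProd_nonneg _ _ _
  refine H.dualNorm_le_ofReal (by positivity) fun σ => ?_
  rw [productMap_sum_apply, Finset.mul_sum, Finset.sum_mul]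
  exact norm_sum_le_of_le _ fun j _ => H.norm_tsum_sliceVal_le hℓ _ _ _ σ f hm

theorem derivSum_le {d : ℝ} (hd : 0 < d) (m : ℕ) (f : ℝ → ℂ) :
    derivSum m f ≤ (∑ n ∈ Finset.range (m + 2), (d ^ n)⁻¹) * sobNorm d (m + 1) f := by
  rw [derivSum, Finset.sum_mul]
  exact Finset.sum_le_sum fun n hn => integral_norm_iteratedDeriv_le hd
    (Nat.lt_succ_iff.1 (Finset.mem_range.1 hn)) f

theorem isDistribution_productMap :
    H.IsDistribution (H.productMap hℓ (∑ j, K j ⊗ₜ[ℂ] (φ j ⊗ₜ[ℂ] φ' j))) := by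
  obtain ⟨m, hm⟩ := exists_nat_ge (3 * ℓ)
  have h1 := productConst_pos hℓ
  have hW : 0 ≤ ∑' p, sliceWeight ℓ p := tsum_nonneg fun p => (sliceWeight_pos ℓ p).le
  have h0 : 0 ≤ ∑ j, H.normProd (K j) (φ j) (φ' j) :=
    Finset.sum_nonneg fun j _ => H.normProd_nonneg _ _ _
  refine ⟨5 * ℓ + 1, by linarith, m + 1, fun d hd => ⟨productConst ℓ * (∑' p, sliceWeight ℓ p) *
    (∑ j, H.normProd (K j) (φ j) (φ' j)) * ∑ n ∈ Finset.range (m + 2), (d ^ n)⁻¹, fun f _ => ?_⟩⟩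
  refine (H.dualNorm_productMap_le hℓ K φ φ' f hm).trans (ENNReal.ofReal_le_ofReal ?_)
  calc _ ≤ productConst ℓ * (∑' p, sliceWeight ℓ p) *
        ((∑ n ∈ Finset.range (m + 2), (d ^ n)⁻¹) * sobNorm d (m + 1) f) *
        ∑ j, H.normProd (K j) (φ j) (φ' j) := by
        gcongr
        exact derivSum_le hd m f
    _ = _ := by ring

/-- An energy-bounded functional annihilates all but finitely many slices, so the limit y → 0 and
the sum interchange although the strips shrink with the energy. -/
theorem isBoundaryIntegral_corr {E : ℝ} (hE : 0 < E) {σ : H.smoothFunctionals}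
    (hσ : (σ : Module.Dual ℂ (V →L[ℂ] V)) ∈ H.energyBounded E) (f : LineTest)
    (K : kernelSpace ℓ) (φ φ' : H.dualSpace ℓ) :
    IsBoundaryIntegral f (fun z => (K : ℂ → ℂ) z * H.corr E σ φ φ' z)
      (∑' p, H.sliceVal hℓ f K φ φ' σ p) := by
  obtain ⟨N, hN⟩ := exists_nat_ge E
  have hzero : ∀ p ∉ Finset.range (N + 1) ×ˢ Finset.range (N + 1),
      H.sliceVal hℓ f K φ φ' σ p = 0 := fun p hp => by
    refine H.sliceVal_eq hℓ ?_
    have hfun : H.sliceFn hℓ K φ φ' σ p = fun _ => 0 := by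
      funext z
      rw [sliceFn, H.apply_sliceOp_eq_zero hℓ hE hN hσ φ φ' hp, mul_zero]
    rw [hfun, IsBoundaryIntegral]
    simp
  rw [tsum_eq_sum hzero]
  refine (IsBoundaryIntegral.sum f.isTest _
    (fun p _ => H.differentiableOn_sliceFn hℓ K φ φ' σ p)
    (fun p _ => H.isBoundaryIntegral_sliceVal hℓ K φ φ' σ p f)).congr fun z hz => ?_
  rw [H.corr_eq hℓ E _ φ φ' hz, H.sum_sliceOp hℓ hN hσ, Finset.mul_sum]
  rfl

theorem hasProductExpectations_productMap :
    H.HasProductExpectations (fun j => K j) (fun j => φ j) (fun j => φ' j)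
      (H.productMap hℓ (∑ j, K j ⊗ₜ[ℂ] (φ j ⊗ₜ[ℂ] φ' j))) := fun _ hE σ hσ f =>
  ⟨fun j => ∑' p, H.sliceVal hℓ f (K j) (φ j) (φ' j) σ p,
    fun j => H.isBoundaryIntegral_corr hℓ hE hσ f (K j) (φ j) (φ' j),
    H.productMap_sum_apply hℓ K φ φ' f σ⟩

/-- Limits are unique, so T and T' agree on all energy-bounded functionals, and these determine an
element of C^∞(Σ)^*. -/
theorem HasProductExpectations.unique {H : Hamiltonian V} {n : ℕ} {K : Fin n → ℂ → ℂ}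
    {φ φ' : Fin n → Module.Dual ℂ H.smoothFunctionals} {T T' : LineTest →ₗ[ℂ] H.smoothDual}
    (hT : H.HasProductExpectations K φ φ' T) (hT' : H.HasProductExpectations K φ φ' T') :
    T' = T := by
  ext1 f
  rw [← sub_eq_zero]
  refine Subtype.ext (H.eq_zero_of_forall_energyBounded (T' f - T f).2 fun E hE σ hσ => ?_)
  obtain ⟨b, hb, hTb⟩ := hT E hE σ hσ f
  obtain ⟨b', hb', hTb'⟩ := hT' E hE σ hσ f
  rw [Submodule.coe_sub, LinearMap.sub_apply, hTb, hTb', sub_eq_zero]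
  exact Finset.sum_congr rfl fun j _ => (hb' j).unique (hb j)

theorem distNorm_productMap_le {d : ℝ} (hd : 0 < d) (hd1 : d ≤ 1) {m : ℕ} (hm : 3 * ℓ ≤ m) :
    H.distNorm (5 * ℓ + 1) d (m + 1) (H.productMap hℓ (∑ j, K j ⊗ₜ[ℂ] (φ j ⊗ₜ[ℂ] φ' j))) ≤
      ENNReal.ofReal (productConst ℓ * (∑' p, sliceWeight ℓ p) * (m + 2) * (d ^ (m + 1))⁻¹) *
        ∑ j, kernelNorm ℓ (K j : ℂ → ℂ) *
          H.dualNorm ℓ (φ j : Module.Dual ℂ H.smoothFunctionals) *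
          H.dualNorm ℓ (φ' j : Module.Dual ℂ H.smoothFunctionals) := by
  have h1 := productConst_pos hℓ
  have hW : 0 ≤ ∑' p, sliceWeight ℓ p := tsum_nonneg fun p => (sliceWeight_pos ℓ p).le
  have h0 : 0 ≤ ∑ j, H.normProd (K j) (φ j) (φ' j) :=
    Finset.sum_nonneg fun j _ => H.normProd_nonneg _ _ _
  have hsum : ∑ j, kernelNorm ℓ (K j : ℂ → ℂ) *
      H.dualNorm ℓ (φ j : Module.Dual ℂ H.smoothFunctionals) *
      H.dualNorm ℓ (φ' j : Module.Dual ℂ H.smoothFunctionals) =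
      ENNReal.ofReal (∑ j, H.normProd (K j) (φ j) (φ' j)) := by
    rw [ENNReal.ofReal_sum_of_nonneg fun j _ => H.normProd_nonneg _ _ _]
    refine Finset.sum_congr rfl fun j _ => ?_
    rw [normProd, ENNReal.ofReal_mul ENNReal.toReal_nonneg,
      ENNReal.ofReal_mul ENNReal.toReal_nonneg, ENNReal.ofReal_toReal (K j).2.2.2.ne,
      ENNReal.ofReal_toReal (ne_of_lt (φ j).2), ENNReal.ofReal_toReal (ne_of_lt (φ' j).2),
      mul_assoc]
  rw [hsum, ← ENNReal.ofReal_mul (by positivity)]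
  refine iSup₂_le fun f hf => ?_
  refine (H.dualNorm_productMap_le hℓ K φ φ' f hm).trans (ENNReal.ofReal_le_ofReal ?_)
  -- For d ≤ 1 the largest of the m+2 terms is the last one.
  have hgeom : ∑ n ∈ Finset.range (m + 2), (d ^ n)⁻¹ ≤ (m + 2) * (d ^ (m + 1))⁻¹ := by
    have h := Finset.sum_le_card_nsmul (Finset.range (m + 2)) (fun n => (d ^ n)⁻¹)
      (d ^ (m + 1))⁻¹ fun n hn => inv_anti₀ (by positivity)
        (pow_le_pow_of_le_one hd.le hd1 (Nat.lt_succ_iff.1 (Finset.mem_range.1 hn)))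
    rw [Finset.card_range, nsmul_eq_mul] at h
    exact_mod_cast h
  have hS : derivSum m f ≤ (m + 2) * (d ^ (m + 1))⁻¹ := by
    calc derivSum m f ≤ (∑ n ∈ Finset.range (m + 2), (d ^ n)⁻¹) * sobNorm d (m + 1) f :=
          derivSum_le hd m f
      _ ≤ ((m + 2) * (d ^ (m + 1))⁻¹) * 1 :=
          mul_le_mul hgeom hf.2 (sobNorm_nonneg hd _ _) (by positivity)
      _ = _ := mul_one _
  calc _ ≤ productConst ℓ * (∑' p, sliceWeight ℓ p) * ((m + 2) * (d ^ (m + 1))⁻¹) *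
        ∑ j, H.normProd (K j) (φ j) (φ' j) := by gcongr
    _ = _ := by ring

end

end Hamiltonian

/-! ### The main theorem -/

theorem mainTheorem10 {V : Type*} [NormedAddCommGroup V] [InnerProductSpace ℂ V] [CompleteSpace V]
    (H : Hamiltonian V) (ℓ : ℝ) (hℓ : 0 < ℓ) :
    (∀ E : ℝ, 0 < E → ∀ σ ∈ H.energyBounded E, σ ∈ H.smoothFunctionals ∧
      ∀ φ ∈ H.dualSpace ℓ, ∀ φ' ∈ H.dualSpace ℓ, ∃ q : ℝ, 0 < q ∧
        H.corr E σ φ φ' ∈ kernelSpace q) ∧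
    ∃ O : H.ProductSpace ℓ →ₗ[ℂ] (LineTest →ₗ[ℂ] H.smoothDual),
      (∀ (n : ℕ) (K : Fin n → kernelSpace ℓ) (φ φ' : Fin n → H.dualSpace ℓ),
        let T := O (∑ j, K j ⊗ₜ[ℂ] (φ j ⊗ₜ[ℂ] φ' j))
        H.IsDistribution T ∧
        H.HasProductExpectations (fun j => K j) (fun j => φ j) (fun j => φ' j) T ∧
        ∀ T' : LineTest →ₗ[ℂ] H.smoothDual, H.IsDistribution T' →
          H.HasProductExpectations (fun j => K j) (fun j => φ j) (fun j => φ' j) T' → T' = T) ∧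
      ∀ m : ℕ, 3 * ℓ + 2 ≤ m → ∃ c : ℝ, 0 < c ∧ ∀ d : ℝ, 0 < d → d ≤ 1 →
        ∀ (n : ℕ) (K : Fin n → kernelSpace ℓ) (φ φ' : Fin n → H.dualSpace ℓ),
          H.distNorm (5 * ℓ + 1) d m (O (∑ j, K j ⊗ₜ[ℂ] (φ j ⊗ₜ[ℂ] φ' j))) ≤
            ENNReal.ofReal (c * (d ^ m)⁻¹) *
              ∑ j, kernelNorm ℓ (K j) * H.dualNorm ℓ (φ j) * H.dualNorm ℓ (φ' j) := by
  refine ⟨fun E hE σ hσ => ?_, H.productMap hℓ, fun n K φ φ' => ?_, fun m hm => ?_⟩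
  · have hsm := H.mem_smoothFunctionals_of_energyBounded hσ
    exact ⟨hsm, fun φ hφ φ' hφ' => ⟨2 * ℓ, by linarith,
      H.corr_mem_kernelSpace hℓ hE hsm.1 ⟨φ, hφ⟩ ⟨φ', hφ'⟩⟩⟩
  · have hT := H.hasProductExpectations_productMap hℓ K φ φ'
    exact ⟨H.isDistribution_productMap hℓ K φ φ', hT, fun T' _ hT' => hT.unique hT'⟩
  -- The boundary estimate with Taylor order k ≥ 3ℓ uses derivatives up to order k+1, which is why m
  -- is written as k+1.
  · obtain ⟨k, rfl⟩ : ∃ k, m = k + 1 := Nat.exists_eq_succ_of_ne_zero (by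
      rintro rfl
      norm_num at hm
      linarith)
    push_cast at hm
    have hW : 0 < ∑' p, Hamiltonian.sliceWeight ℓ p :=
      (Hamiltonian.summable_sliceWeight hℓ).tsum_pos
        (fun p => (Hamiltonian.sliceWeight_pos ℓ p).le) (0, 0) (Hamiltonian.sliceWeight_pos ℓ _)
    have hC := Hamiltonian.productConst_pos hℓ
    exact ⟨Hamiltonian.productConst ℓ * (∑' p, Hamiltonian.sliceWeight ℓ p) * (k + 2),
      by positivity, fun d hd hd1 n K φ φ' =>
        H.distNorm_productMap_le hℓ K φ φ' hd hd1 (by linarith)⟩
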